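/- Let $n\ge 4$ and $i\in\{1,\dots,n\}$. Put $V=\mathbb{R}^{\binom n2}/\Phi(\mathbb{R}^n)$, where $\Phi(a)_{\{j,k\}}=a_j+a_k$. For $I\subset\{1,\dots,n\}$ let $v_I\in V$ be the class of the vector whose entry at $\{j,k\}$ is $1$ if exactly one of $j,k$ lies in $I$ and $0$ otherwise, and let $\Lambda\subset V$ be the lattice generated by all $v_I$ with $2\le|I|\le n-2$. A combinatorial type of rational $n$-marked tropical curves is a finite tree together with $n$ labelled unbounded ends attached to its vertices, such that every vertex has valence at least $3$ (counting bounded edges and ends). Its cone in $V$ is generated by the vectors $v_I$, where $I$ runs over the splittings of the ends given by the bounded edges. The cones of all types form the moduli space $\mathcal{M}_{0,n}$. The Psi-class $\psi_i$ consists of the cones of all types for which the $i$-th end is at a vertex of valence at least $4$, with all weights equal to $1$. A tropical cycle of dimension $k$ in $V$ is a rational polyhedral fan $X$ of pure dimension $k$ with non-zero rational weights $w(\sigma)$ on its $k$-dimensional cones such that, for each $(k-1)$-dimensional cone $\tau$ of $X$, the balancing condition $\sum_{\sigma>\tau}w(\sigma)\,v_{\sigma/\tau}\in V_\tau$ holds.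 Here the sum is over the $k$-dimensional cones $\sigma$ of $X$ having $\tau$ as a face, $V_\tau$ is the linear span of $\tau$, and $v_{\sigma/\tau}$ is the primitive normal vector of $\sigma$ relative to $\tau$ with respect to $\Lambda$. The support $|X|$ is the union of the cones of $X$. The empty fan is the zero cycle. Then $\mathcal{M}_{0,n}$ is of pure dimension $n-3$, and $\psi_i$ is an irreducible codimension-1 cycle in it. More precisely: 1. The cones of $\psi_i$ are cones of $\mathcal{M}_{0,n}$, and $\psi_i$ is a non-zero tropical cycle of dimension $n-4$. 2. $\psi_i$ is connected in codimension 1: any two $(n-4)$-dimensional cones of $\psi_i$ can be joined by a finite sequence of $(n-4)$-dimensional cones of $\psi_i$ in which any two consecutive distinct cones intersect in dimension $n-5$. 3. $\psi_i$ is locally irreducible: at each $(n-5)$-dimensional cone $\tau$ of $\psi_i$, the rational weights on the adjacent $(n-4)$-dimensional cones of $\psi_i$ satisfying the balancing condition at $\tau$ are unique up to a common multiple. 4. $\psi_i$ is (globally) irreducible: there is no non-zero tropical cycle $Y$ of dimension $n-4$ in $V$ with $|Y|\subsetneq|\psi_i|$. -/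

import Mathlib

noncomputable section

namespace TropicalModuli

section Cycles

variable {V : Type*} [AddCommGroup V] [Module ℝ V]

/-- A cone is rational with respect to `Λ` if it is generated by finitely many vectors of `Λ`. -/
def IsRationalCone (Λ : Submodule ℤ V) (σ : PointedCone ℝ V) : Prop :=
  ∃ s : Finset V, (s : Set V) ⊆ (Λ : Set V) ∧ σ = PointedCone.hull ℝ (s : Set V)

/-- The linear subspace `V_σ` spanned by a cone `σ`. -/
def linearSpan (σ : PointedCone ℝ V) : Submodule ℝ V :=
  Submodule.span ℝ (σ : Set V)

/-- The dimension of a cone. -/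
def dim (σ : PointedCone ℝ V) : ℕ :=
  Module.finrank ℝ (linearSpan σ)

variable (V) in
/-- The data of a weighted fan: a set of cones together with rational weights. Only the weights of
the cones of top dimension are relevant. -/
structure WeightedFan where
  /-- The cones of the fan. -/
  cones : Set (PointedCone ℝ V)
  /-- The weights. -/
  weight : PointedCone ℝ V → ℚ

/-- A rational polyhedral fan: a finite set of rational polyhedral cones that contains all faces of
its members, any two of which intersect in a common face. -/
structure IsRationalFan (Λ : Submodule ℤ V) (C : Set (PointedCone ℝ V)) : Prop where
  finite : C.Finite
  rational : ∀ σ ∈ C, IsRationalCone Λ σ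
  face_mem : ∀ σ ∈ C, ∀ τ : PointedCone ℝ V, τ.IsFaceOf σ → τ ∈ C
  inf_isFaceOf : ∀ σ ∈ C, ∀ σ' ∈ C, (σ ⊓ σ').IsFaceOf σ ∧ (σ ⊓ σ').IsFaceOf σ'

/-- Every cone has dimension at most `k` and is a face of a cone of dimension `k`. -/
def IsPureOfDim (k : ℕ) (C : Set (PointedCone ℝ V)) : Prop :=
  ∀ σ ∈ C, dim σ ≤ k ∧ ∃ σ' ∈ C, σ.IsFaceOf σ' ∧ dim σ' = k

/-- The support of a set of cones: the union of the cones. -/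
def support (C : Set (PointedCone ℝ V)) : Set V :=
  ⋃ σ ∈ C, (σ : Set V)

/-- The `k`-dimensional cones of `C` that have `τ` as a face. -/
def facetsAt (k : ℕ) (C : Set (PointedCone ℝ V)) (τ : PointedCone ℝ V) :
    Set (PointedCone ℝ V) :=
  {σ | σ ∈ C ∧ dim σ = k ∧ τ.IsFaceOf σ}

/-- For a face `τ` of codimension one of `σ`: the class of `v` modulo `Λ ∩ V_τ` is the primitive
normal vector `v_{σ/τ}`, i.e. the generator of `(Λ ∩ V_σ) / (Λ ∩ V_τ) ≅ ℤ` pointing into `σ`. -/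
structure IsPrimitiveNormal (Λ : Submodule ℤ V) (τ σ : PointedCone ℝ V) (v : V) : Prop where
  mem_lattice : v ∈ Λ
  mem_linearSpan : v ∈ linearSpan σ
  generates : ∀ x ∈ Λ, x ∈ linearSpan σ → ∃ m : ℤ, x - m • v ∈ linearSpan τ
  points_into : ∃ y ∈ σ, v - y ∈ linearSpan τ

/-- The balancing condition `∑_{σ > τ} a(σ) v_{σ/τ} = 0 mod V_τ` for weights `a` on the
`k`-dimensional cones of `C` adjacent to `τ`. (It does not depend on the representatives chosen for
the primitive normal vectors.) -/
def IsBalancedAt (Λ : Submodule ℤ V) (k : ℕ) (C : Set (PointedCone ℝ V))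
    (a : PointedCone ℝ V → ℚ) (τ : PointedCone ℝ V) : Prop :=
  ∃ v : PointedCone ℝ V → V,
    (∀ σ ∈ facetsAt k C τ, IsPrimitiveNormal Λ τ σ (v σ)) ∧
    ∑ᶠ σ ∈ facetsAt k C τ, ((a σ : ℚ) : ℝ) • v σ ∈ linearSpan τ

/-- `X` is a tropical cycle of dimension `k` with respect to the lattice `Λ`: a rational fan of
pure dimension `k` with non-zero rational weights on its `k`-dimensional cones that is balanced at
each of its cones of dimension `k - 1`. (The empty fan is the zero cycle.) -/
structure IsTropicalCycle (Λ : Submodule ℤ V) (k : ℕ) (X : WeightedFan V) : Prop where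
  isRationalFan : IsRationalFan Λ X.cones
  isPureOfDim : IsPureOfDim k X.cones
  weight_ne_zero : ∀ σ ∈ X.cones, dim σ = k → X.weight σ ≠ 0
  balanced : ∀ τ ∈ X.cones, dim τ + 1 = k → IsBalancedAt Λ k X.cones X.weight τ

/-- `X` is (globally) irreducible: it is a non-zero tropical cycle, and there is no non-zero
tropical cycle `Y` of the same dimension with `|Y| ⊊ |X|`. -/
structure IsIrreducibleCycle (Λ : Submodule ℤ V) (k : ℕ) (X : WeightedFan V) : Prop where
  isTropicalCycle : IsTropicalCycle Λ k X
  nonempty : X.cones.Nonempty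
  not_ssubset : ∀ Y : WeightedFan V, IsTropicalCycle Λ k Y → Y.cones.Nonempty →
    ¬ support Y.cones ⊂ support X.cones

/-- `X` is locally irreducible: at each cone `τ` of dimension `k - 1`, the balancing condition
determines the weights of the adjacent `k`-dimensional cones up to a common multiple. -/
def IsLocallyIrreducible (Λ : Submodule ℤ V) (k : ℕ) (X : WeightedFan V) : Prop :=
  ∀ τ ∈ X.cones, dim τ + 1 = k → ∀ a : PointedCone ℝ V → ℚ, IsBalancedAt Λ k X.cones a τ →
    ∃ c : ℚ, ∀ σ ∈ facetsAt k X.cones τ, a σ = c * X.weight σ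

/-- Any two `k`-dimensional cones are joined by a chain of `k`-dimensional cones in which
consecutive ones intersect in dimension `k - 1`. -/
def IsConnectedInCodimOne (k : ℕ) (C : Set (PointedCone ℝ V)) : Prop :=
  ∀ σ ∈ C, ∀ σ' ∈ C, dim σ = k → dim σ' = k →
    Relation.ReflTransGen
      (fun ρ ρ' => ρ' ∈ C ∧ dim ρ' = k ∧ dim (ρ ⊓ ρ') + 1 = k) σ σ'

end Cycles

section Moduli

/-- Unordered pairs of distinct labels, as increasing pairs. -/
abbrev Pairs (n : ℕ) : Type := {p : Fin n × Fin n // p.1 < p.2}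

/-- The map `ℝⁿ → ℝ^(n choose 2)`, `a ↦ (a_i + a_j)_{i < j}`. -/
def phi (n : ℕ) : (Fin n → ℝ) →ₗ[ℝ] (Pairs n → ℝ) where
  toFun a p := a p.1.1 + a p.1.2
  map_add' a b := by
    funext p
    simp only [Pi.add_apply]
    ring
  map_smul' c a := by
    funext p
    simp only [Pi.smul_apply, smul_eq_mul, RingHom.id_apply]
    ring

/-- The ambient space `ℝ^(n choose 2) / Φ(ℝⁿ)` of the moduli space of `n`-marked curves. -/
abbrev Ambient (n : ℕ) : Type := (Pairs n → ℝ) ⧸ LinearMap.range (phi n)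

open Classical in
/-- The vector with entry `1` at `{i, j}` if `I` contains exactly one of `i`, `j`, and `0`
otherwise: the distances between the ends of a curve with a single bounded edge, of length one,
separating the ends in `I` from the others. -/
def splitDist {n : ℕ} (I : Set (Fin n)) : Pairs n → ℝ :=
  fun p => if (p.1.1 ∈ I ↔ p.1.2 ∈ I) then 0 else 1

/-- The class `v_I` of `splitDist I` in the ambient space. -/
def splitVec {n : ℕ} (I : Set (Fin n)) : Ambient n :=
  (LinearMap.range (phi n)).mkQ (splitDist I)

/-- The lattice generated by the vectors `v_I` with `2 ≤ |I| ≤ n - 2`. -/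
def lattice (n : ℕ) : Submodule ℤ (Ambient n) :=
  Submodule.span ℤ {x | ∃ I : Set (Fin n), 2 ≤ I.ncard ∧ 2 ≤ Iᶜ.ncard ∧ x = splitVec I}

/-- A combinatorial type of rational `n`-marked abstract tropical curves: a finite tree whose
vertices carry unbounded ends labelled by `Fin n` (the `i`-th end sits at the vertex `mark i`), such
that every vertex has valence at least `3`, where both bounded edges and ends are counted. -/
structure CombType (n : ℕ) where
  /-- The number of vertices. -/
  size : ℕ
  /-- The tree of bounded edges. -/
  graph : SimpleGraph (Fin size)
  isTree : graph.IsTree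
  /-- The vertex to which the `i`-th end is attached. -/
  mark : Fin n → Fin size
  three_le_valence : ∀ u, 3 ≤ (graph.neighborSet u).ncard + {i | mark i = u}.ncard

namespace CombType

variable {n : ℕ} (T : CombType n)

/-- The valence of a vertex: the number of bounded edges and ends at it. -/
def valence (u : Fin T.size) : ℕ :=
  (T.graph.neighborSet u).ncard + {i | T.mark i = u}.ncard

/-- The set of ends on the same side as `u` after removing the edge `{u, w}`. -/
def side (u w : Fin T.size) : Set (Fin n) :=
  {i | (T.graph.deleteEdges {s(u, w)}).Reachable u (T.mark i)}

/-- The closed cone of all curves whose type is `T` or a contraction of `T`: the cone generated by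
the vectors `v_I`, where `I` runs over the splits of the ends given by the bounded edges of `T`.
A curve with edge lengths `ℓ` corresponds to `∑_e ℓ(e) v_{I(e)}`, the class of the vector of
distances between its ends. -/
def cone : PointedCone ℝ (Ambient n) :=
  PointedCone.hull ℝ {x | ∃ u w, T.graph.Adj u w ∧ x = splitVec (T.side u w)}

end CombType

/-- The cones of the moduli space of rational `n`-marked abstract tropical curves. -/
def moduliCones (n : ℕ) : Set (PointedCone ℝ (Ambient n)) :=
  {σ | ∃ T : CombType n, σ = T.cone}

/-- The Psi-class `ψ_i`: the cones of all types in which the `i`-th end is at a vertex of valence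
at least four, with all weights equal to one. -/
def psiClass (n : ℕ) (i : Fin n) : WeightedFan (Ambient n) where
  cones := {σ | ∃ T : CombType n, 4 ≤ T.valence (T.mark i) ∧ σ = T.cone}
  weight := fun _ => 1

end Moduli

end TropicalModuli

end

/-!
Fix the end `i`. Cutting a bounded edge of a tree separates the ends, and the part without the
`i`-th end is called a cluster. The clusters of a type form a laminar family `F` on the remaining
ends (`IsLaminar`), every laminar family arises in this way, and the cone of the type is
generated by the vectors `v_K`, `K ∈ F`. The `i`-th end is at the root of the tree of clusters; it
is at a vertex of valence at least four if and only if there are three other ends no two of which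
lie in a common cluster (`HasThreeBranches`). This translates the moduli space and the Psi-class
into families of finite sets (`mem_moduliCones`, `mem_psiClass`).

The differences of two Gromov products at the `i`-th end are well-defined linear forms on the
ambient space (`exists_gromovDiff`). On the vectors of the clusters of a laminar family they provide
an integral dual system (`IsLaminar.exists_dualSystem`), so that the cones are simplicial and
unimodular: faces correspond to subfamilies, the dimension is the number of clusters, and `v_K` is
the primitive normal vector when a cluster `K` is added. Distinct families have cones meeting in the
cone of the common clusters. The dimensions are then found by counting: a laminar family on `m`
points has at most `m - 2` clusters, `m - 3` if there are three branches at the root, and smaller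
families can be enlarged.

A cone of codimension one of the Psi-class has exactly one vertex that can be resolved further, with
branches `B x` for `x` in a set `Q` of three or four elements, and its facets arise by adding a
cluster `B x ∪ B y` (`IsLaminar.exists_isLocalModel`). The sum of the vectors of all `B x ∪ B y` is
a combination of the vectors of the `B x` and of their union (`sum_offDiag_clusterVec`), which is
the balancing condition. Conversely, the difference of the Gromov products of the pairs `x, y` and
`x, z` vanishes on the cone and on the normal vectors of all facets except those of `B x ∪ B y` and
`B x ∪ B z`, so that balanced weights agree on these two facets (`IsLocalModel.weight_eq`); this
gives local irreducibility. Connectedness in codimension one is a statement about laminar families: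
the clusters of a second facet are brought into a first one by exchanging clusters one at a time
(`IsFacetFamily.reflTransGen`).

Global irreducibility follows for every tropical cycle `X` that is locally irreducible and connected
in codimension one (`isIrreducibleCycle_of_isLocallyIrreducible`). If `|Y| ⊆ |X|`, balancing of `Y`
shows that a facet of `X` that meets `Y` in full dimension is contained in `|Y|`
(`subset_support_of_dim_inf_eq`). If such a facet has a face `τ` of codimension one, the weights of
`Y` at a generic point of `τ` define balanced weights on the facets of `X` at `τ`, so by local
irreducibility all of these meet `Y` in full dimension (`exists_dim_inf_eq_of_mem_support`). Hence
`Y` covers `X` along chains of facets.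
-/

noncomputable section

namespace TropicalModuli

/-! ### Polyhedral cones and rational fans -/

section Cones

variable {V : Type*} [AddCommGroup V] [Module ℝ V]

theorem mem_linearSpan {σ : PointedCone ℝ V} {x : V} (hx : x ∈ σ) : x ∈ linearSpan σ :=
  Submodule.subset_span hx

theorem linearSpan_mono {σ τ : PointedCone ℝ V} (h : τ ≤ σ) : linearSpan τ ≤ linearSpan σ :=
  Submodule.span_mono h

theorem linearSpan_hull (s : Set V) :
    linearSpan (PointedCone.hull ℝ s) = Submodule.span ℝ s := by
  apply le_antisymm
  · exact Submodule.span_le.2 (PointedCone.hull_le_span ℝ s)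
  · exact Submodule.span_mono PointedCone.subset_hull

theorem mem_linearSpan_iff {σ : PointedCone ℝ V} {x : V} :
    x ∈ linearSpan σ ↔ ∃ a ∈ σ, ∃ b ∈ σ, x = a - b := by
  constructor
  · intro hx
    induction hx using Submodule.span_induction with
    | mem x h => exact ⟨x, h, 0, σ.zero_mem, by simp⟩
    | zero => exact ⟨0, σ.zero_mem, 0, σ.zero_mem, by simp⟩
    | add x y _ _ hx hy =>
      obtain ⟨a, ha, b, hb, rfl⟩ := hx
      obtain ⟨c, hc, d, hd, rfl⟩ := hy
      exact ⟨a + c, σ.add_mem ha hc, b + d, σ.add_mem hb hd, by abel⟩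
    | smul r x _ hx =>
      obtain ⟨a, ha, b, hb, rfl⟩ := hx
      rcases le_total 0 r with h | h
      · exact ⟨r • a, σ.smul_mem h ha, r • b, σ.smul_mem h hb, by rw [smul_sub]⟩
      · have h' : 0 ≤ -r := by linarith
        exact ⟨(-r) • b, σ.smul_mem h' hb, (-r) • a, σ.smul_mem h' ha, by module⟩
  · rintro ⟨a, ha, b, hb, rfl⟩
    exact Submodule.sub_mem _ (mem_linearSpan ha) (mem_linearSpan hb)

/-- A face of a cone is the intersection of the cone with the linear span of the face. -/
theorem mem_of_isFaceOf_of_mem_linearSpan {σ τ : PointedCone ℝ V} (h : τ.IsFaceOf σ) {x : V}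
    (hx : x ∈ σ) (hx' : x ∈ linearSpan τ) : x ∈ τ := by
  obtain ⟨a, ha, b, hb, rfl⟩ := mem_linearSpan_iff.1 hx'
  exact h.mem_of_add_mem_left hx (h.le hb) (by simpa using ha)

theorem eq_of_isFaceOf_of_linearSpan_le {σ τ : PointedCone ℝ V} (h : τ.IsFaceOf σ)
    (hs : linearSpan σ ≤ linearSpan τ) : τ = σ :=
  le_antisymm h.le fun _ hx => mem_of_isFaceOf_of_mem_linearSpan h hx (hs (mem_linearSpan hx))

/-- A cone is not covered by finitely many subspaces that do not contain it. -/
theorem exists_mem_forall_notMem (σ : PointedCone ℝ V) {S : Set (Submodule ℝ V)} (hS : S.Finite)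
    (h : ∀ W ∈ S, ¬ (σ : Set V) ⊆ W) : ∃ x ∈ σ, ∀ W ∈ S, x ∉ W := by
  induction S, hS using Set.Finite.induction_on with
  | empty => exact ⟨0, σ.zero_mem, by simp⟩
  | @insert W S _ hSf ih =>
    obtain ⟨x, hx, hxS⟩ := ih fun W' hW' => h W' (Set.mem_insert_of_mem _ hW')
    obtain ⟨y, hy, hyW⟩ := Set.not_subset.1 (h W (Set.mem_insert _ _))
    -- On the ray `x + t y`, every one of the subspaces is met at most once.
    have hfin : ∀ W' ∈ insert W S, {t : ℝ | x + t • y ∈ W'}.Subsingleton := by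
      intro W' hW' s hs t ht
      by_contra hne
      have hsub : (s - t) • y ∈ W' := by
        have := W'.sub_mem hs ht
        convert this using 1
        module
      have hy' : y ∈ W' := (W'.smul_mem_iff (sub_ne_zero.2 hne)).1 hsub
      have hx' : x ∈ W' := by
        have := W'.sub_mem hs (W'.smul_mem s hy')
        simpa using this
      rcases hW' with rfl | hW'
      · exact hyW hy'
      · exact hxS _ hW' hx'
    have hbad : (⋃ W' ∈ insert W S, {t : ℝ | x + t • y ∈ W'}).Finite :=
      (hSf.insert W).biUnion fun W' hW' => (hfin W' hW').finite
    obtain ⟨t, ht, ht'⟩ := (Set.Ici_infinite (0 : ℝ)).exists_notMem_finite hbad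
    refine ⟨x + t • y, σ.add_mem hx (σ.smul_mem ht hy), fun W' hW' hmem => ht' ?_⟩
    exact Set.mem_biUnion hW' hmem

/-- The point `z` lies in the relative interior of the cone `σ`: a small multiple of any element of
`σ` can be subtracted from `z` within `σ`. -/
def InRelInt (σ : PointedCone ℝ V) (z : V) : Prop :=
  z ∈ σ ∧ ∀ x ∈ σ, ∃ ε : ℝ, 0 < ε ∧ z - ε • x ∈ σ

theorem add_smul_mem_of_le {σ : PointedCone ℝ V} {z u : V} {ε t : ℝ} (hz : z ∈ σ)
    (h : z + ε • u ∈ σ) (ht : 0 ≤ t) (hte : t ≤ ε) : z + t • u ∈ σ := by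
  rcases ht.eq_or_lt with rfl | ht'
  · simpa using hz
  have hε : 0 < ε := ht'.trans_le hte
  have h1 : z + t • u = (1 - t / ε) • z + (t / ε) • (z + ε • u) := by
    rw [smul_add, smul_smul, div_mul_cancel₀ _ hε.ne']
    module
  rw [h1]
  refine σ.add_mem (σ.smul_mem ?_ hz) (σ.smul_mem (by positivity) h)
  rw [sub_nonneg, div_le_one hε]
  exact hte

theorem InRelInt.exists_add_smul_mem {σ : PointedCone ℝ V} {z u : V} (hz : InRelInt σ z)
    (hu : u ∈ linearSpan σ) : ∃ ε : ℝ, 0 < ε ∧ ∀ t, 0 ≤ t → t ≤ ε → z + t • u ∈ σ := by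
  obtain ⟨a, ha, b, hb, rfl⟩ := mem_linearSpan_iff.1 hu
  obtain ⟨ε, hε, h⟩ := hz.2 b hb
  refine ⟨ε, hε, fun t ht hte => add_smul_mem_of_le hz.1 ?_ ht hte⟩
  have := σ.add_mem h (σ.smul_mem hε.le ha)
  convert this using 1
  module

theorem InRelInt.combination {σ : PointedCone ℝ V} {q p : V} (hq : InRelInt σ q) (hp : p ∈ σ)
    {a b : ℝ} (ha : 0 < a) (hb : 0 ≤ b) : InRelInt σ (a • q + b • p) := by
  refine ⟨σ.add_mem (σ.smul_mem ha.le hq.1) (σ.smul_mem hb hp), fun x hx => ?_⟩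
  obtain ⟨ε, hε, h⟩ := hq.2 x hx
  refine ⟨a * ε, by positivity, ?_⟩
  have := σ.add_mem (σ.smul_mem ha.le h) (σ.smul_mem hb hp)
  convert this using 1
  module

/-- The face of `ρ` whose relative interior contains a given point `z` of `ρ`: it consists of the
elements of `ρ` of which a small multiple can be subtracted from `z` within `ρ`. -/
def carrierFace (ρ : PointedCone ℝ V) (z : V) (hz : z ∈ ρ) : PointedCone ℝ V where
  carrier := {x | x ∈ ρ ∧ ∃ ε : ℝ, 0 < ε ∧ z - ε • x ∈ ρ}
  add_mem' := by
    rintro x y ⟨hx, ε, hε, hx'⟩ ⟨hy, δ, hδ, hy'⟩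
    refine ⟨ρ.add_mem hx hy, min ε δ / 2, by positivity, ?_⟩
    have key : ∀ {w : V} {η : ℝ}, w ∈ ρ → 0 < η → z - η • w ∈ ρ → min ε δ ≤ η →
        z - min ε δ • w ∈ ρ := by
      intro w η hw hη h hle
      have := ρ.add_mem h (ρ.smul_mem (sub_nonneg.2 hle) hw)
      convert this using 1
      module
    have h1 := key hx hε hx' (min_le_left _ _)
    have h2 := key hy hδ hy' (min_le_right _ _)
    have := ρ.smul_mem (r := 1 / 2) (by norm_num) (ρ.add_mem h1 h2)
    convert this using 1
    module
  zero_mem' := ⟨ρ.zero_mem, 1, one_pos, by simpa using hz⟩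
  smul_mem' := by
    rintro ⟨c, hc⟩ x ⟨hx, ε, hε, hx'⟩
    refine ⟨ρ.smul_mem hc hx, ε / (c + 1), by positivity, ?_⟩
    have h : z - (ε / (c + 1)) • (c • x) = (1 - c / (c + 1)) • z + (c / (c + 1)) • (z - ε • x) := by
      have : ε / (c + 1) * c = c / (c + 1) * ε := by ring
      rw [smul_sub, smul_smul, smul_smul, this]
      module
    change z - (ε / (c + 1)) • (c • x) ∈ ρ
    rw [h]
    refine ρ.add_mem (ρ.smul_mem ?_ hz) (ρ.smul_mem (by positivity) hx')
    rw [sub_nonneg, div_le_one (by positivity)]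
    linarith

theorem carrierFace_isFaceOf (ρ : PointedCone ℝ V) (z : V) (hz : z ∈ ρ) :
    (carrierFace ρ z hz).IsFaceOf ρ := by
  refine PointedCone.IsFaceOf.of_mem_of_add_mem_left (fun x hx => hx.1) ?_
  rintro x y hx hy ⟨_, ε, hε, h⟩
  refine ⟨hx, ε, hε, ?_⟩
  have := ρ.add_mem h (ρ.smul_mem hε.le hy)
  convert this using 1
  module

theorem carrierFace_inRelInt (ρ : PointedCone ℝ V) (z : V) (hz : z ∈ ρ) :
    InRelInt (carrierFace ρ z hz) z := by
  have hzz : z ∈ carrierFace ρ z hz := ⟨hz, 1, one_pos, by simp⟩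
  refine ⟨hzz, fun x hx => ?_⟩
  obtain ⟨hx, ε, hε, h⟩ := hx
  refine ⟨ε, hε, ?_⟩
  refine (carrierFace_isFaceOf ρ z hz).mem_of_add_mem_left h (ρ.smul_mem hε.le hx) ?_
  simpa using hzz

theorem mem_support {C : Set (PointedCone ℝ V)} {x : V} : x ∈ support C ↔ ∃ σ ∈ C, x ∈ σ := by
  simp [support]

namespace IsRationalFan

variable {Λ : Submodule ℤ V} {C : Set (PointedCone ℝ V)}

theorem exists_carrier (hC : IsRationalFan Λ C) {z : V} (hz : z ∈ support C) :
    ∃ ρ ∈ C, InRelInt ρ z := by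
  obtain ⟨σ, hσ, hz⟩ := mem_support.1 hz
  exact ⟨_, hC.face_mem σ hσ _ (carrierFace_isFaceOf σ z hz), carrierFace_inRelInt σ z hz⟩

theorem isFaceOf_of_inRelInt (hC : IsRationalFan Λ C) {ρ σ : PointedCone ℝ V} {z : V}
    (hρ : ρ ∈ C) (hσ : σ ∈ C) (hz : InRelInt ρ z) (hzσ : z ∈ σ) : ρ.IsFaceOf σ := by
  have h := hC.inf_isFaceOf ρ hρ σ hσ
  have : ρ ⊓ σ = ρ := by
    refine le_antisymm inf_le_left fun x hx => ?_
    obtain ⟨ε, hε, h'⟩ := hz.2 x hx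
    refine h.1.mem_of_smul_add_mem (y := z - ε • x) hx h' hε ?_
    have : ε • x + (z - ε • x) = z := by abel
    rw [this]
    exact ⟨hz.1, hzσ⟩
  rw [← this]
  exact h.2

theorem inRelInt_of_forall_notMem (hC : IsRationalFan Λ C) {σ : PointedCone ℝ V} (hσ : σ ∈ C)
    {z : V} (hz : z ∈ σ)
    (h : ∀ ρ ∈ C, ¬ (σ : Set V) ⊆ linearSpan ρ → z ∉ linearSpan ρ) : InRelInt σ z := by
  obtain ⟨ρ, hρ, hzρ⟩ := hC.exists_carrier (mem_support.2 ⟨σ, hσ, hz⟩)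
  have hf := hC.isFaceOf_of_inRelInt hρ hσ hzρ hz
  have hsub : (σ : Set V) ⊆ linearSpan ρ := by
    by_contra hn
    exact h ρ hρ hn (mem_linearSpan hzρ.1)
  rwa [← eq_of_isFaceOf_of_linearSpan_le hf (Submodule.span_le.2 hsub)]

/-- A cone of a fan has points in its relative interior that avoid finitely many subspaces, none of
which contains the cone. -/
theorem exists_inRelInt (hC : IsRationalFan Λ C) {σ : PointedCone ℝ V} (hσ : σ ∈ C)
    {S : Set (Submodule ℝ V)} (hS : S.Finite) (h : ∀ W ∈ S, ¬ (σ : Set V) ⊆ W) :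
    ∃ z, InRelInt σ z ∧ ∀ W ∈ S, z ∉ W := by
  have hfin : (linearSpan '' {ρ | ρ ∈ C ∧ ¬ (σ : Set V) ⊆ linearSpan ρ}).Finite :=
    (hC.finite.subset fun ρ hρ => hρ.1).image _
  obtain ⟨z, hz, hz'⟩ := exists_mem_forall_notMem σ (hfin.union hS) (by
    rintro W (⟨ρ, hρ, rfl⟩ | hW)
    · exact hρ.2
    · exact h W hW)
  refine ⟨z, hC.inRelInt_of_forall_notMem hσ hz fun ρ hρ hn => ?_, fun W hW => hz' W (Or.inr hW)⟩
  exact hz' _ (Or.inl ⟨ρ, ⟨hρ, hn⟩, rfl⟩)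

end IsRationalFan

/-- Fourier–Motzkin elimination of one nonnegative variable from finitely many linear
inequalities. -/
theorem exists_halfspaces_of_ray (s : Finset (V →ₗ[ℝ] ℝ)) (v : V) :
    ∃ s' : Finset (V →ₗ[ℝ] ℝ),
      ∀ x, (∃ c : ℝ, 0 ≤ c ∧ ∀ f ∈ s, 0 ≤ f (x - c • v)) ↔ ∀ f ∈ s', 0 ≤ f x := by
  classical
  refine ⟨(s.filter fun f => f v = 0) ∪ (s.filter fun f => 0 < f v) ∪
    ((s.filter fun f => 0 < f v) ×ˢ (s.filter fun f => f v < 0)).image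
      (fun p => p.1 v • p.2 - p.2 v • p.1), fun x => ?_⟩
  constructor
  · rintro ⟨c, hc, h⟩ f hf
    simp only [Finset.mem_union, Finset.mem_filter, Finset.mem_image, Finset.mem_product] at hf
    rcases hf with (⟨hf, hv⟩ | ⟨hf, hv⟩) | ⟨⟨f, g⟩, ⟨⟨hf, hfv⟩, hg, hgv⟩, rfl⟩
    · have := h f hf
      simpa [hv] using this
    · have := h f hf
      simp only [map_sub, map_smul, smul_eq_mul] at this
      nlinarith
    · have h1 := h f hf
      have h2 := h g hg
      simp only [map_sub, map_smul, smul_eq_mul, LinearMap.sub_apply, LinearMap.smul_apply]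
        at h1 h2 ⊢
      dsimp only at hfv hgv
      nlinarith [mul_nonneg h1 (neg_nonneg.2 hgv.le), mul_nonneg h2 hfv.le]
  · intro h
    have h0 : ∀ f ∈ s, f v = 0 → 0 ≤ f x := fun f hf hv => h f (by simp [hf, hv])
    have h1 : ∀ f ∈ s, 0 < f v → 0 ≤ f x := fun f hf hv => h f (by simp [hf, hv])
    have h2 : ∀ f ∈ s, ∀ g ∈ s, 0 < f v → g v < 0 → 0 ≤ f v * g x - g v * f x := by
      intro f hf g hg hfv hgv
      have := h (f v • g - g v • f) (by
        simp only [Finset.mem_union, Finset.mem_image, Finset.mem_product, Finset.mem_filter]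
        exact Or.inr ⟨(f, g), ⟨⟨hf, hfv⟩, hg, hgv⟩, rfl⟩)
      simpa using this
    -- The smallest admissible coefficient is the largest of the lower bounds.
    let lower : Finset ℝ := insert 0 ((s.filter fun f => f v < 0).image fun f => f x / f v)
    have hne : lower.Nonempty := ⟨0, Finset.mem_insert_self _ _⟩
    refine ⟨lower.max' hne, lower.le_max' 0 (Finset.mem_insert_self _ _), fun f hf => ?_⟩
    simp only [map_sub, map_smul, smul_eq_mul]
    rcases lt_trichotomy (f v) 0 with hv | hv | hv
    · have : f x / f v ≤ lower.max' hne := lower.le_max' _ (by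
        refine Finset.mem_insert_of_mem (Finset.mem_image.2 ⟨f, ?_, rfl⟩)
        simp [hf, hv])
      rw [div_le_iff_of_neg hv] at this
      linarith
    · simpa [hv] using h0 f hf hv
    · have hle : lower.max' hne ≤ f x / f v := by
        refine Finset.max'_le _ _ _ fun y hy => ?_
        rcases Finset.mem_insert.1 hy with rfl | hy
        · exact div_nonneg (h1 f hf hv) hv.le
        · obtain ⟨g, hg, rfl⟩ := Finset.mem_image.1 hy
          obtain ⟨hg, hgv⟩ := Finset.mem_filter.1 hg
          have := h2 f hf g hg hv hgv
          rw [div_le_iff_of_neg hgv, div_mul_eq_mul_div, div_le_iff₀ hv]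
          linarith
      rw [le_div_iff₀ hv] at hle
      linarith

theorem mem_hull_insert_iff {s : Set V} {v x : V} :
    x ∈ PointedCone.hull ℝ (insert v s) ↔
      ∃ c : ℝ, 0 ≤ c ∧ x - c • v ∈ PointedCone.hull ℝ s := by
  rw [PointedCone.hull, Submodule.mem_span_insert]
  constructor
  · rintro ⟨⟨c, hc⟩, z, hz, rfl⟩
    exact ⟨c, hc, by simpa [Nonneg.mk_smul] using hz⟩
  · rintro ⟨c, hc, h⟩
    exact ⟨⟨c, hc⟩, _, h, by simp [Nonneg.mk_smul]⟩

/-- A finitely generated cone is an intersection of finitely many half-spaces. -/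
theorem exists_halfspaces [FiniteDimensional ℝ V] (t : Finset V) :
    ∃ s : Finset (V →ₗ[ℝ] ℝ),
      ∀ x, x ∈ PointedCone.hull ℝ (t : Set V) ↔ ∀ f ∈ s, 0 ≤ f x := by
  classical
  induction t using Finset.induction_on with
  | empty =>
    let b := Module.finBasis ℝ V
    refine ⟨Finset.univ.image b.coord ∪ Finset.univ.image fun i => -b.coord i, fun x => ?_⟩
    simp only [Finset.coe_empty, PointedCone.hull, Submodule.span_empty, Submodule.mem_bot]
    constructor
    · rintro rfl
      simp
    · intro h
      rw [← b.forall_coord_eq_zero_iff]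
      intro i
      apply le_antisymm
      · have := h (-b.coord i) (by simp)
        simpa using this
      · exact h (b.coord i) (by simp)
  | insert v t _ ih =>
    obtain ⟨s, hs⟩ := ih
    obtain ⟨s', hs'⟩ := exists_halfspaces_of_ray s v
    refine ⟨s', fun x => ?_⟩
    rw [Finset.coe_insert, mem_hull_insert_iff, ← hs']
    simp_rw [hs]

variable {Λ : Submodule ℤ V}

theorem IsRationalCone.isClosed_line [FiniteDimensional ℝ V] {σ : PointedCone ℝ V}
    (h : IsRationalCone Λ σ) (z u : V) : IsClosed {t : ℝ | z + t • u ∈ σ} := by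
  obtain ⟨t, _, rfl⟩ := h
  obtain ⟨s, hs⟩ := exists_halfspaces t
  have : {t' : ℝ | z + t' • u ∈ PointedCone.hull ℝ (t : Set V)} =
      ⋂ f ∈ s, {t' : ℝ | 0 ≤ f z + t' * f u} := by
    ext t'
    simp [hs]
  rw [this]
  exact isClosed_biInter fun f _ => isClosed_le continuous_const (by fun_prop)

theorem IsRationalFan.isClosed_line [FiniteDimensional ℝ V] {C : Set (PointedCone ℝ V)}
    (hC : IsRationalFan Λ C) (z u : V) : IsClosed {t : ℝ | z + t • u ∈ support C} := by
  have : {t : ℝ | z + t • u ∈ support C} = ⋃ σ ∈ C, {t : ℝ | z + t • u ∈ σ} := by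
    ext t
    simp [mem_support]
  rw [this]
  exact hC.finite.isClosed_biUnion fun σ hσ => (hC.rational σ hσ).isClosed_line z u

/-- A germ of a ray in the support of a fan is contained in one of its cones. -/
theorem IsRationalFan.exists_mem_of_germ [FiniteDimensional ℝ V] {C : Set (PointedCone ℝ V)}
    (hC : IsRationalFan Λ C) {z u : V} {ε : ℝ} (hε : 0 < ε)
    (h : ∀ t, 0 < t → t ≤ ε → z + t • u ∈ support C) :
    ∃ σ ∈ C, z ∈ σ ∧ ∃ t : ℝ, 0 < t ∧ z + t • u ∈ σ := by
  have h0 : (0 : ℝ) ∈ closure (⋃ σ ∈ C, ({t : ℝ | z + t • u ∈ σ} ∩ Set.Ioi 0)) := by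
    have hsub : Set.Ioc 0 ε ⊆ ⋃ σ ∈ C, ({t : ℝ | z + t • u ∈ σ} ∩ Set.Ioi 0) := by
      intro t ht
      obtain ⟨σ, hσ, hmem⟩ := mem_support.1 (h t ht.1 ht.2)
      exact Set.mem_biUnion hσ ⟨hmem, ht.1⟩
    refine closure_mono hsub ?_
    rw [closure_Ioc hε.ne]
    exact ⟨le_rfl, hε.le⟩
  rw [hC.finite.closure_biUnion] at h0
  obtain ⟨σ, hσ, h0⟩ := Set.mem_iUnion₂.1 h0
  refine ⟨σ, hσ, ?_, ?_⟩
  · have hcl := closure_mono Set.inter_subset_left h0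
    rw [((hC.rational σ hσ).isClosed_line z u).closure_eq] at hcl
    simpa using hcl
  · obtain ⟨t, ht, ht'⟩ := closure_nonempty_iff.1 ⟨_, h0⟩
    exact ⟨t, ht', ht⟩

end Cones

/-! ### Primitive normal vectors and cycles inside a cone -/

section NormalVectors

variable {V : Type*} [AddCommGroup V] [Module ℝ V] {Λ : Submodule ℤ V}

namespace IsPrimitiveNormal

variable {τ σ : PointedCone ℝ V} {v : V}

theorem linearSpan_le (h : IsPrimitiveNormal Λ τ σ v) (hσ : IsRationalCone Λ σ) :
    linearSpan σ ≤ linearSpan τ ⊔ Submodule.span ℝ {v} := by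
  obtain ⟨s, hs, hσs⟩ := hσ
  rw [hσs, linearSpan_hull, Submodule.span_le]
  intro x hx
  have hx' : x ∈ linearSpan σ := by
    rw [hσs, linearSpan_hull]
    exact Submodule.subset_span hx
  obtain ⟨m, hm⟩ := h.generates x (hs hx) hx'
  have h1 : x = (x - m • v) + (m : ℝ) • v := by
    rw [Int.cast_smul_eq_zsmul]
    abel
  rw [h1]
  exact Submodule.add_mem_sup hm (Submodule.smul_mem _ _ (Submodule.mem_span_singleton_self v))

theorem exists_eq_add_smul (h : IsPrimitiveNormal Λ τ σ v) (hσ : IsRationalCone Λ σ) {x : V}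
    (hx : x ∈ linearSpan σ) : ∃ l ∈ linearSpan τ, ∃ c : ℝ, x = l + c • v := by
  obtain ⟨l, hl, w, hw, rfl⟩ := Submodule.mem_sup.1 (h.linearSpan_le hσ hx)
  obtain ⟨c, rfl⟩ := Submodule.mem_span_singleton.1 hw
  exact ⟨l, hl, c, rfl⟩

theorem notMem [FiniteDimensional ℝ V] (h : IsPrimitiveNormal Λ τ σ v) (hσ : IsRationalCone Λ σ)
    (hdim : dim τ < dim σ) : v ∉ linearSpan τ := by
  intro hv
  have h1 : linearSpan σ ≤ linearSpan τ := by
    refine (h.linearSpan_le hσ).trans (sup_le le_rfl ?_)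
    rwa [Submodule.span_singleton_le_iff_mem]
  exact absurd (Submodule.finrank_mono h1) (not_le.2 hdim)

/-- A cone lies on one side of the span of each of its facets, the side of the normal vector. -/
theorem coeff_nonneg (h : IsPrimitiveNormal Λ τ σ v) (hf : τ.IsFaceOf σ)
    (hv : v ∉ linearSpan τ) {l : V} {c : ℝ} (hl : l ∈ linearSpan τ) (hx : l + c • v ∈ σ) :
    0 ≤ c := by
  by_contra! hc
  obtain ⟨y, hy, hvy⟩ := h.points_into
  have h1 : (l + c • v) + (-c) • y ∈ linearSpan τ := by
    have := Submodule.sub_mem _ hl (Submodule.smul_mem _ (-c) hvy)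
    convert this using 1
    module
  have hy' : (-c) • y ∈ σ := σ.smul_mem (by linarith) hy
  have h2 := mem_of_isFaceOf_of_mem_linearSpan hf (σ.add_mem hx hy') h1
  have h3 := TropicalModuli.mem_linearSpan (hf.mem_of_add_mem_left hx hy' h2)
  have h4 : c • v ∈ linearSpan τ := by simpa using Submodule.sub_mem _ h3 hl
  exact hv ((Submodule.smul_mem_iff _ hc.ne).1 h4)

end IsPrimitiveNormal

/-- Two generators of a lattice of rank one (the lattice vectors of `W` modulo the subspace `L`)
that point into the same direction agree. -/
theorem sub_mem_of_generates {W L : Submodule ℝ V} {v v' : V}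
    (hv : ∀ x ∈ Λ, x ∈ W → ∃ m : ℤ, x - m • v ∈ L)
    (hv' : ∀ x ∈ Λ, x ∈ W → ∃ m : ℤ, x - m • v' ∈ L)
    (hvΛ : v ∈ Λ) (hvΛ' : v' ∈ Λ) (hvW : v ∈ W) (hvW' : v' ∈ W) (hvL : v ∉ L)
    {c : ℝ} (hc : 0 < c) (h : v' - c • v ∈ L) : v' - v ∈ L := by
  obtain ⟨m, hm⟩ := hv v' hvΛ' hvW'
  obtain ⟨m', hm'⟩ := hv' v hvΛ hvW
  rw [← Int.cast_smul_eq_zsmul ℝ] at hm hm'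
  have h1 : (c - m) • v ∈ L := by
    have := L.sub_mem hm h
    convert this using 1
    module
  have hcm : c = m := by
    by_contra hne
    exact hvL ((L.smul_mem_iff (sub_ne_zero.2 hne)).1 h1)
  have h2 : (1 - (m' : ℝ) * m) • v ∈ L := by
    have := L.add_mem hm' (L.smul_mem (m' : ℝ) hm)
    convert this using 1
    module
  have hmm : (1 : ℝ) = (m' : ℝ) * m := by
    by_contra hne
    exact hvL ((L.smul_mem_iff (sub_ne_zero.2 hne)).1 h2)
  have hm1 : m = 1 := by
    have h3 : m' * m = 1 := by exact_mod_cast hmm.symm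
    have h4 : 0 < m := by
      rw [hcm] at hc
      exact_mod_cast hc
    exact Int.eq_one_of_mul_eq_one_left h4.le h3
  rw [hm1] at hm
  simpa using hm

/-- The primitive normal vector is unique modulo the span of the facet. -/
theorem IsPrimitiveNormal.sub_mem [FiniteDimensional ℝ V] {τ σ : PointedCone ℝ V} {v v' : V}
    (h : IsPrimitiveNormal Λ τ σ v) (h' : IsPrimitiveNormal Λ τ σ v') (hf : τ.IsFaceOf σ)
    (hσ : IsRationalCone Λ σ) (hdim : dim τ < dim σ) : v' - v ∈ linearSpan τ := by
  have hv := h.notMem hσ hdim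
  have hv' := h'.notMem hσ hdim
  obtain ⟨y, hy, hvy⟩ := h'.points_into
  obtain ⟨l, hl, c, hc⟩ := h.exists_eq_add_smul hσ (TropicalModuli.mem_linearSpan hy)
  have hc0 : 0 ≤ c := h.coeff_nonneg hf hv hl (hc ▸ hy)
  have h1 : v' - c • v ∈ linearSpan τ := by
    have := Submodule.add_mem _ hvy hl
    convert this using 1
    rw [hc]
    abel
  refine sub_mem_of_generates h.generates h'.generates h.mem_lattice h'.mem_lattice
    h.mem_linearSpan h'.mem_linearSpan hv (hc0.lt_of_ne ?_) h1
  rintro rfl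
  exact hv' (by simpa using h1)

variable [FiniteDimensional ℝ V]

theorem linearSpan_eq_of_le {k : ℕ} {σ σ' : PointedCone ℝ V} (hle : linearSpan σ ≤ linearSpan σ')
    (h : dim σ = k) (h' : dim σ' ≤ k) : linearSpan σ = linearSpan σ' :=
  Submodule.eq_of_le_of_finrank_le hle (h'.trans h.ge)

/-- Two facets at a cone `ρ` of a fan that lie on the same side of `ρ` agree. -/
theorem eq_of_same_side {k : ℕ} {C : Set (PointedCone ℝ V)} (hC : IsRationalFan Λ C)
    {ρ π π' : PointedCone ℝ V} {z : V} (hz : InRelInt ρ z)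
    (hπ : π ∈ facetsAt k C ρ) (hπ' : π' ∈ facetsAt k C ρ) {y y' l : V} {c : ℝ} (hy : y ∈ π)
    (hy' : y' ∈ π') (hl : l ∈ linearSpan ρ) (hc : 0 ≤ c) (h : y' = l + c • y)
    (hspan : linearSpan π' ≤ linearSpan ρ ⊔ Submodule.span ℝ {y'}) : π = π' := by
  obtain ⟨ε, hε, hpush⟩ := hz.exists_add_smul_mem hl
  have h1 : z + ε • y' ∈ π ⊓ π' := by
    constructor
    · have := π.add_mem (hπ.2.2.le (hpush ε hε.le le_rfl)) (π.smul_mem (mul_nonneg hε.le hc) hy)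
      have e : z + ε • y' = z + ε • l + (ε * c) • y := by
        rw [h]
        module
      rwa [← e] at this
    · exact π'.add_mem (hπ'.2.2.le hz.1) (π'.smul_mem hε.le hy')
  have hρle : ρ ≤ π ⊓ π' := le_inf hπ.2.2.le hπ'.2.2.le
  have hface := hC.inf_isFaceOf π hπ.1 π' hπ'.1
  have hle : linearSpan π' ≤ linearSpan (π ⊓ π') := by
    refine hspan.trans (sup_le (linearSpan_mono hρle) ?_)
    rw [Submodule.span_singleton_le_iff_mem]
    have h2 := Submodule.sub_mem _ (mem_linearSpan h1) (mem_linearSpan (hρle hz.1))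
    rw [add_sub_cancel_left] at h2
    exact (Submodule.smul_mem_iff _ hε.ne').1 h2
  have e1 : π ⊓ π' = π' := eq_of_isFaceOf_of_linearSpan_le hface.2 hle
  have e2 : π ⊓ π' = π := by
    refine eq_of_isFaceOf_of_linearSpan_le hface.1 ?_
    have := linearSpan_eq_of_le (linearSpan_mono (inf_le_left : π ⊓ π' ≤ π))
      (by rw [e1]; exact hπ'.2.1) hπ.2.1.le
    exact this.ge
  exact e2.symm.trans e1

/-- If a tropical cycle `Y` meets a top-dimensional cone `σ` of a pure-dimensional fan
containing `|Y|` in full dimension, it contains `σ`. Walking from a generic point of `σ ∩ |Y|`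
to any other point of `σ`, one leaves `|Y|` at most in the relative interior of a cone of
codimension one of `Y`, where balancing provides cones of `Y` on either side. -/
theorem subset_support_of_dim_inf_eq {k : ℕ} {X : Set (PointedCone ℝ V)} {Y : WeightedFan V}
    (hX : IsRationalFan Λ X) (hXk : IsPureOfDim k X) (hY : IsTropicalCycle Λ k Y)
    (hYX : support Y.cones ⊆ support X) {σ ρ₀ : PointedCone ℝ V} (hσ : σ ∈ X) (hσk : dim σ = k)
    (hρ₀ : ρ₀ ∈ Y.cones) (hdim : dim (σ ⊓ ρ₀) = k) : (σ : Set V) ⊆ support Y.cones := by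
  intro p hp
  have hspan₀ : linearSpan (σ ⊓ ρ₀) = linearSpan σ :=
    linearSpan_eq_of_le (linearSpan_mono inf_le_left) hdim hσk.le
  -- The starting point avoids the boundary of `σ` and all lines from `p` to cones of
  -- codimension at least two of `Y`.
  let S₁ : Set (Submodule ℝ V) := linearSpan '' {ρ | ρ ∈ X ∧ ¬ (σ : Set V) ⊆ linearSpan ρ}
  let S₂ : Set (Submodule ℝ V) :=
    (fun ρ => linearSpan ρ ⊔ Submodule.span ℝ {p}) '' {ρ | ρ ∈ Y.cones ∧ dim ρ + 1 < k}
  have hS₁ : S₁.Finite := (hX.finite.subset fun ρ hρ => hρ.1).image _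
  have hS₂ : S₂.Finite := (hY.isRationalFan.finite.subset fun ρ hρ => hρ.1).image _
  obtain ⟨q, hq, hqS⟩ := exists_mem_forall_notMem (σ ⊓ ρ₀) (hS₁.union hS₂) (by
    intro W hW hsub
    have hle : linearSpan σ ≤ W := by
      rw [← hspan₀]
      exact Submodule.span_le.2 hsub
    rcases hW with ⟨ρ, hρ, rfl⟩ | ⟨ρ, hρ, rfl⟩
    · exact hρ.2 fun x hx => hle (mem_linearSpan hx)
    · have h1 : Module.finrank ℝ (linearSpan σ) ≤
          Module.finrank ℝ (linearSpan ρ ⊔ Submodule.span ℝ {p} : Submodule ℝ V) :=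
        Submodule.finrank_mono hle
      have h2 := Submodule.finrank_add_le_finrank_add_finrank (linearSpan ρ)
        (Submodule.span ℝ {p})
      have h3 : Module.finrank ℝ (Submodule.span ℝ {p}) ≤ 1 := by
        have := finrank_span_finset_le_card (R := ℝ) ({p} : Finset V)
        rwa [Finset.coe_singleton, Finset.card_singleton] at this
      have h4 := hρ.2
      unfold dim at h4 hσk
      omega)
  have hqσ : InRelInt σ q := hX.inRelInt_of_forall_notMem hσ hq.1 fun ρ hρ hn =>
    hqS _ (Or.inl ⟨ρ, ⟨hρ, hn⟩, rfl⟩)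
  let u := p - q
  have hseg : Set.Icc (0 : ℝ) 1 ⊆ {t : ℝ | q + t • u ∈ support Y.cones} := by
    refine IsClosed.Icc_subset_of_forall_exists_gt
      ((hY.isRationalFan.isClosed_line q u).inter isClosed_Icc) ?_ ?_
    · exact mem_support.2 ⟨ρ₀, hρ₀, by simpa using hq.2⟩
    rintro t ⟨ht, ht0, ht1⟩ y hy
    suffices hsuff : ∃ ε : ℝ, 0 < ε ∧
        ∀ s, 0 ≤ s → s ≤ ε → (q + t • u) + s • u ∈ support Y.cones by
      obtain ⟨ε, hε, h⟩ := hsuff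
      have hyt : 0 < y - t := sub_pos.2 hy
      refine ⟨t + min ε (y - t), ?_, ?_, ?_⟩
      · have := h (min ε (y - t)) (by positivity) (min_le_left _ _)
        simpa [add_smul, add_assoc] using this
      · have : 0 < min ε (y - t) := by positivity
        linarith
      · have := min_le_right ε (y - t)
        linarith
    obtain ⟨z, hzdef⟩ : ∃ z, z = q + t • u := ⟨_, rfl⟩
    rw [← hzdef]
    have hz_eq : z = (1 - t) • q + t • p := by
      rw [hzdef]
      simp only [u]
      module
    have hzσ : InRelInt σ z := hz_eq ▸ hqσ.combination hp (sub_pos.2 ht1) ht0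
    have huσ : u ∈ linearSpan σ := Submodule.sub_mem _ (mem_linearSpan hp) (mem_linearSpan hq.1)
    have hzY : z ∈ support Y.cones := by
      rw [hzdef]
      exact ht
    -- The cones of `Y` through `z` lie in the span of `σ`.
    have hlocal : ∀ π ∈ Y.cones, z ∈ π → linearSpan π ≤ linearSpan σ := by
      intro π hπ hzπ
      refine Submodule.span_le.2 fun y hy => ?_
      obtain ⟨σ', hσ', hzσ', s, hs, hmem⟩ := hX.exists_mem_of_germ one_pos (z := z) (u := y)
        fun s hs _ => hYX (mem_support.2 ⟨π, hπ, π.add_mem hzπ (π.smul_mem hs.le hy)⟩)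
      have hface := hX.isFaceOf_of_inRelInt hσ hσ' hzσ hzσ'
      have heq := linearSpan_eq_of_le (linearSpan_mono hface.le) hσk (hXk σ' hσ').1
      have h1 := Submodule.sub_mem _ (mem_linearSpan hmem) (mem_linearSpan hzσ')
      rw [add_sub_cancel_left] at h1
      rw [heq]
      exact (Submodule.smul_mem_iff _ hs.ne').1 h1
    obtain ⟨ρ, hρ, hzρ⟩ := hY.isRationalFan.exists_carrier hzY
    have hρk := (hY.isPureOfDim ρ hρ).1
    rcases lt_trichotomy (dim ρ + 1) k with hlt | heq | hgt
    · exfalso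
      refine hqS _ (Or.inr ⟨ρ, ⟨hρ, hlt⟩, rfl⟩) ?_
      have h1 : (1 - t) • q = z + (-t) • p := by
        rw [hz_eq]
        module
      have h2 : (1 - t) • q ∈ linearSpan ρ ⊔ Submodule.span ℝ {p} := by
        rw [h1]
        exact Submodule.add_mem_sup (mem_linearSpan hzρ.1)
          (Submodule.smul_mem _ _ (Submodule.mem_span_singleton_self p))
      exact (Submodule.smul_mem_iff _ (sub_pos.2 ht1).ne').1 h2
    · obtain ⟨v, hv, hbal⟩ := hY.balanced ρ hρ heq
      have hrat : ∀ π ∈ facetsAt k Y.cones ρ, IsRationalCone Λ π := fun π hπ =>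
        hY.isRationalFan.rational π hπ.1
      have hdlt : ∀ π ∈ facetsAt k Y.cones ρ, dim ρ < dim π := fun π hπ => by
        rw [hπ.2.1]
        omega
      -- It suffices to find a facet of `Y` at `ρ` on the side of `u`.
      suffices hside : ∃ π ∈ facetsAt k Y.cones ρ, ∃ l ∈ linearSpan ρ, ∃ c : ℝ, 0 ≤ c ∧
          u = l + c • v π by
        obtain ⟨π, hπ, l, hl, c, hc, hu⟩ := hside
        obtain ⟨y, hy, hvy⟩ := (hv π hπ).points_into
        obtain ⟨ε, hε, hpush⟩ := hzρ.exists_add_smul_mem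
          (Submodule.add_mem _ hl (Submodule.smul_mem _ c hvy))
        refine ⟨ε, hε, fun s hs hsε => mem_support.2 ⟨π, hπ.1, ?_⟩⟩
        have := π.add_mem (hπ.2.2.le (hpush s hs hsε)) (π.smul_mem (mul_nonneg hs hc) hy)
        convert this using 1
        rw [hu]
        module
      obtain ⟨π, hπY, hρπ, hπk⟩ := (hY.isPureOfDim ρ hρ).2
      have hπ : π ∈ facetsAt k Y.cones ρ := ⟨hπY, hπk, hρπ⟩
      have hspanπ : ∀ π' ∈ facetsAt k Y.cones ρ, linearSpan π' = linearSpan σ := fun π' hπ' =>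
        linearSpan_eq_of_le (hlocal π' hπ'.1 (hπ'.2.2.le hzρ.1)) hπ'.2.1 hσk.le
      obtain ⟨l, hl, c, hu⟩ := (hv π hπ).exists_eq_add_smul (hrat π hπ)
        (by rw [hspanπ π hπ]; exact huσ)
      rcases le_or_gt 0 c with hc | hc
      · exact ⟨π, hπ, l, hl, c, hc, hu⟩
      -- Otherwise there is a facet on the side opposite to `π`, by balancing.
      by_cases hall : ∀ π' ∈ facetsAt k Y.cones ρ, π' = π
      · exfalso
        have hset : facetsAt k Y.cones ρ = {π} := by
          ext π'
          exact ⟨hall π', fun h => (Set.mem_singleton_iff.1 h) ▸ hπ⟩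
        rw [hset, finsum_mem_singleton] at hbal
        have hw : ((Y.weight π : ℚ) : ℝ) ≠ 0 := by
          exact_mod_cast hY.weight_ne_zero π hπY hπk
        exact (hv π hπ).notMem (hrat π hπ) (hdlt π hπ) ((Submodule.smul_mem_iff _ hw).1 hbal)
      · push Not at hall
        obtain ⟨π', hπ', hne⟩ := hall
        obtain ⟨l', hl', c', hv'⟩ := (hv π hπ).exists_eq_add_smul (hrat π hπ) (x := v π')
          (by rw [hspanπ π hπ, ← hspanπ π' hπ']; exact (hv π' hπ').mem_linearSpan)
        have hc' : c' < 0 := by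
          by_contra! hc'
          obtain ⟨y, hy, hvy⟩ := (hv π hπ).points_into
          obtain ⟨y', hy', hvy'⟩ := (hv π' hπ').points_into
          refine hne (eq_of_same_side (l := l' + c' • (v π - y) - (v π' - y')) (c := c')
            hY.isRationalFan hzρ hπ hπ' hy hy' ?_ hc' ?_ ?_).symm
          · exact Submodule.sub_mem _ (Submodule.add_mem _ hl' (Submodule.smul_mem _ _ hvy)) hvy'
          · rw [hv']
            module
          · refine ((hv π' hπ').linearSpan_le (hrat π' hπ')).trans (sup_le le_sup_left ?_)
            rw [Submodule.span_singleton_le_iff_mem]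
            have : v π' = (v π' - y') + y' := by abel
            rw [this]
            exact Submodule.add_mem_sup hvy' (Submodule.mem_span_singleton_self _)
        refine ⟨π', hπ', l - (c / c') • l', ?_, c / c', (div_pos_of_neg_of_neg hc hc').le, ?_⟩
        · exact Submodule.sub_mem _ hl (Submodule.smul_mem _ _ hl')
        · rw [hv', hu, smul_add, smul_smul, div_mul_cancel₀ _ hc'.ne]
          abel
    · have hρk' : dim ρ = k := by omega
      have heq := linearSpan_eq_of_le (hlocal ρ hρ hzρ.1) hρk' hσk.le
      obtain ⟨ε, hε, hpush⟩ := hzρ.exists_add_smul_mem (heq ▸ huσ)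
      exact ⟨ε, hε, fun s hs hsε => mem_support.2 ⟨ρ, hρ, hpush s hs hsε⟩⟩
  have h1 : q + (1 : ℝ) • u ∈ support Y.cones := hseg (Set.right_mem_Icc.2 zero_le_one)
  simpa [u] using h1

end NormalVectors

/-! ### Local irreducibility and connectedness imply irreducibility -/

section Irreducibility

variable {V : Type*} [AddCommGroup V] [Module ℝ V] {Λ : Submodule ℤ V}

theorem facetsAt_finite {k : ℕ} {C : Set (PointedCone ℝ V)} (hC : C.Finite)
    (τ : PointedCone ℝ V) : (facetsAt k C τ).Finite :=
  hC.subset fun _ h => h.1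

/-- A cone `σ` containing `τ` and a cone `π` containing `ρ` that share a relative interior point
of `τ` and `ρ`, and a further direction spanning `σ` together with `τ`, meet in full dimension. -/
theorem dim_inf_eq_of_common_direction {k : ℕ} {τ ρ σ π : PointedCone ℝ V} {z y : V} {s : ℝ}
    (hzτ : InRelInt τ z) (hzρ : InRelInt ρ z) (hle : linearSpan τ ≤ linearSpan ρ)
    (hτσ : τ ≤ σ) (hρπ : ρ ≤ π) (hs : 0 < s) (hy : z + s • y ∈ σ ⊓ π)
    (hspan : linearSpan σ ≤ linearSpan τ ⊔ Submodule.span ℝ {y}) (hσ : dim σ = k) :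
    dim (σ ⊓ π) = k := by
  have hz : z ∈ linearSpan (σ ⊓ π) := mem_linearSpan ⟨hτσ hzτ.1, hρπ hzρ.1⟩
  have key : ∀ {r : V} {t : ℝ}, 0 < t → z + t • r ∈ σ ⊓ π → r ∈ linearSpan (σ ⊓ π) := by
    intro r t ht h
    have := Submodule.sub_mem _ (mem_linearSpan h) hz
    rw [add_sub_cancel_left] at this
    exact (Submodule.smul_mem_iff _ ht.ne').1 this
  have h1 : linearSpan τ ≤ linearSpan (σ ⊓ π) := by
    intro r hr
    obtain ⟨ε, hε, h⟩ := hzτ.exists_add_smul_mem hr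
    obtain ⟨δ, hδ, h'⟩ := hzρ.exists_add_smul_mem (hle hr)
    have hm : 0 < min ε δ := lt_min hε hδ
    exact key hm ⟨hτσ (h _ hm.le (min_le_left _ _)), hρπ (h' _ hm.le (min_le_right _ _))⟩
  have h2 : linearSpan σ ≤ linearSpan (σ ⊓ π) := by
    refine hspan.trans (sup_le h1 ?_)
    rw [Submodule.span_singleton_le_iff_mem]
    exact key hs hy
  rw [← hσ, dim, dim, le_antisymm h2 (linearSpan_mono inf_le_left)]

variable [FiniteDimensional ℝ V]

/-- If a tropical cycle `Y` inside a locally irreducible cycle `X` contains a generic point `z`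
of a cone `τ` of codimension one of `X`, then `Y` meets every facet of `X` at `τ` in full
dimension: the local weights of `Y` around `z` satisfy the balancing condition of `X` at `τ`, so
that they are proportional to those of `X`, which do not vanish. -/
theorem exists_dim_inf_eq_of_mem_support {k : ℕ} {X Y : WeightedFan V}
    (hX : IsTropicalCycle Λ k X) (hXirr : IsLocallyIrreducible Λ k X)
    (hY : IsTropicalCycle Λ k Y) (hYX : support Y.cones ⊆ support X.cones)
    {τ : PointedCone ℝ V} (hτ : τ ∈ X.cones) (hτk : dim τ + 1 = k) {z : V} (hz : InRelInt τ z)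
    (hgen : ∀ ρ ∈ Y.cones, z ∈ linearSpan ρ → (τ : Set V) ⊆ linearSpan ρ)
    (hzY : z ∈ support Y.cones) {σ : PointedCone ℝ V} (hσ : σ ∈ facetsAt k X.cones τ) :
    ∃ ρ ∈ Y.cones, dim (σ ⊓ ρ) = k := by
  classical
  obtain ⟨u, hu, -⟩ := hX.balanced τ hτ hτk
  have hXrat : ∀ π ∈ facetsAt k X.cones τ, IsRationalCone Λ π := fun π hπ =>
    hX.isRationalFan.rational π hπ.1
  have hdlt : ∀ π ∈ facetsAt k X.cones τ, dim τ < dim π := fun π hπ => by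
    rw [hπ.2.1]
    omega
  have huL : ∀ π ∈ facetsAt k X.cones τ, u π ∉ linearSpan τ := fun π hπ =>
    (hu π hπ).notMem (hXrat π hπ) (hdlt π hπ)
  have hXfin := facetsAt_finite (k := k) hX.isRationalFan.finite τ
  -- Every direction of `Y` at `z` points into a facet of `X` at `τ`.
  have hstar : ∀ π ∈ Y.cones, z ∈ π → ∀ y ∈ π, ∃ σ' ∈ facetsAt k X.cones τ,
      ∃ t : ℝ, 0 < t ∧ z + t • y ∈ σ' ∧ ∃ l ∈ linearSpan τ, ∃ c : ℝ, 0 ≤ c ∧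
        y = l + c • u σ' := by
    intro π hπ hzπ y hy
    obtain ⟨σ₁, hσ₁, hzσ₁, t, ht, hmem⟩ := hX.isRationalFan.exists_mem_of_germ one_pos
      (z := z) (u := y)
      fun s hs _ => hYX (mem_support.2 ⟨π, hπ, π.add_mem hzπ (π.smul_mem hs.le hy)⟩)
    obtain ⟨σ₂, hσ₂, hface, hσ₂k⟩ := (hX.isPureOfDim σ₁ hσ₁).2
    have hσ' : σ₂ ∈ facetsAt k X.cones τ :=
      ⟨hσ₂, hσ₂k, (hX.isRationalFan.isFaceOf_of_inRelInt hτ hσ₁ hz hzσ₁).trans hface⟩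
    have hmem₂ := hface.le hmem
    refine ⟨σ₂, hσ', t, ht, hmem₂, ?_⟩
    obtain ⟨l, hl, c, hc⟩ := (hu σ₂ hσ').exists_eq_add_smul (hXrat _ hσ') (mem_linearSpan hmem₂)
    have hc0 : 0 ≤ c := (hu σ₂ hσ').coeff_nonneg hσ'.2.2 (huL _ hσ') hl (hc ▸ hmem₂)
    refine ⟨t⁻¹ • (l - z), Submodule.smul_mem _ _ (Submodule.sub_mem _ hl (mem_linearSpan hz.1)),
      t⁻¹ * c, by positivity, ?_⟩
    have : y = t⁻¹ • (z + t • y - z) := by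
      rw [add_sub_cancel_left, smul_smul, inv_mul_cancel₀ ht.ne', one_smul]
    rw [this, hc]
    module
  obtain ⟨ρ, hρ, hzρ⟩ := hY.isRationalFan.exists_carrier hzY
  have hle : linearSpan τ ≤ linearSpan ρ :=
    Submodule.span_le.2 (hgen ρ hρ (mem_linearSpan hzρ.1))
  -- The span of a facet of `X` at `τ` is generated by `τ` and any direction into the facet.
  have hspan : ∀ σ' ∈ facetsAt k X.cones τ, ∀ y l : V, ∀ c : ℝ, 0 < c → l ∈ linearSpan τ →
      y = l + c • u σ' → linearSpan σ' ≤ linearSpan τ ⊔ Submodule.span ℝ {y} := by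
    intro σ' hσ' y l c hc hl hy
    refine ((hu σ' hσ').linearSpan_le (hXrat σ' hσ')).trans (sup_le le_sup_left ?_)
    rw [Submodule.span_singleton_le_iff_mem]
    have : u σ' = (-c⁻¹) • l + c⁻¹ • y := by
      rw [hy, smul_add, smul_smul, inv_mul_cancel₀ hc.ne']
      module
    rw [this]
    exact Submodule.add_mem_sup (Submodule.smul_mem _ _ hl)
      (Submodule.smul_mem _ _ (Submodule.mem_span_singleton_self y))
  have hpos : ∀ {σ' : PointedCone ℝ V} {y l : V} {c : ℝ}, 0 ≤ c → l ∈ linearSpan τ →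
      y = l + c • u σ' → y ∉ linearSpan τ → 0 < c := by
    intro σ' y l c hc hl hy hyL
    refine hc.lt_of_ne ?_
    rintro rfl
    exact hyL (by simpa [hy] using hl)
  by_cases hρτ : linearSpan ρ ≤ linearSpan τ
  · -- `z` lies on a cone of codimension one of `Y`, whose facets are transported to `X`.
    have hLeq : linearSpan ρ = linearSpan τ := le_antisymm hρτ hle
    have hρk : dim ρ + 1 = k := by
      rw [← hτk, dim, dim, hLeq]
    obtain ⟨v, hv, hbal⟩ := hY.balanced ρ hρ hρk
    have hYfin := facetsAt_finite (k := k) hY.isRationalFan.finite ρ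
    have hYrat : ∀ π ∈ facetsAt k Y.cones ρ, IsRationalCone Λ π := fun π hπ =>
      hY.isRationalFan.rational π hπ.1
    have hvL : ∀ π ∈ facetsAt k Y.cones ρ, v π ∉ linearSpan τ := fun π hπ => by
      rw [← hLeq]
      refine (hv π hπ).notMem (hYrat π hπ) ?_
      rw [hπ.2.1]
      omega
    have hdata : ∀ π ∈ facetsAt k Y.cones ρ, ∃ σ' ∈ facetsAt k X.cones τ, ∃ y ∈ π,
        ∃ t : ℝ, 0 < t ∧ z + t • y ∈ σ' ∧ v π - u σ' ∈ linearSpan τ ∧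
        linearSpan σ' ≤ linearSpan τ ⊔ Submodule.span ℝ {y} ∧
        linearSpan π ≤ linearSpan τ ⊔ Submodule.span ℝ {y} ∧
        v π - y ∈ linearSpan τ := by
      intro π hπ
      obtain ⟨y, hy, hvy⟩ := (hv π hπ).points_into
      rw [hLeq] at hvy
      have hyL : y ∉ linearSpan τ := fun h => hvL π hπ (by
        have := Submodule.add_mem _ hvy h
        simpa using this)
      obtain ⟨σ', hσ', t, ht, hmem, l, hl, c, hc, hyc⟩ := hstar π hπ.1 (hπ.2.2.le hzρ.1) y hy
      have hc0 := hpos hc hl hyc hyL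
      have hσy := hspan σ' hσ' y l c hc0 hl hyc
      have hπy : linearSpan π ≤ linearSpan τ ⊔ Submodule.span ℝ {y} := by
        refine ((hv π hπ).linearSpan_le (hYrat π hπ)).trans (sup_le (hLeq ▸ le_sup_left) ?_)
        rw [Submodule.span_singleton_le_iff_mem]
        have : v π = (v π - y) + y := by abel
        rw [this]
        exact Submodule.add_mem_sup hvy (Submodule.mem_span_singleton_self _)
      have hσπ : linearSpan σ' = linearSpan π := by
        refine linearSpan_eq_of_le (hσy.trans (sup_le ?_ ?_)) hσ'.2.1 hπ.2.1.le
        · exact hLeq ▸ linearSpan_mono hπ.2.2.le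
        · rw [Submodule.span_singleton_le_iff_mem]
          exact mem_linearSpan hy
      refine ⟨σ', hσ', y, hy, t, ht, hmem, ?_, hσy, hπy, hvy⟩
      refine sub_mem_of_generates (W := linearSpan σ') (hu σ' hσ').generates ?_
        (hu σ' hσ').mem_lattice (hv π hπ).mem_lattice (hu σ' hσ').mem_linearSpan ?_
        (huL σ' hσ') hc0 ?_
      · rw [hσπ, ← hLeq]
        exact (hv π hπ).generates
      · rw [hσπ]
        exact (hv π hπ).mem_linearSpan
      · have := Submodule.add_mem _ hvy hl
        convert this using 1
        rw [hyc]
        abel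
    choose! j hj y hy t ht hmem hvu hσy hπy hvy using hdata
    have hjinj : ∀ π ∈ facetsAt k Y.cones ρ, ∀ π' ∈ facetsAt k Y.cones ρ, j π = j π' →
        π = π' := by
      intro π hπ π' hπ' hjj
      refine eq_of_same_side (l := y π' - y π) (c := 1) hY.isRationalFan hzρ hπ hπ' (hy π hπ)
        (hy π' hπ') ?_ zero_le_one (by module) (by rw [hLeq]; exact hπy π' hπ')
      rw [hLeq]
      have h1 := Submodule.sub_mem _ (hvu π' hπ') (hvu π hπ)
      have h2 := Submodule.sub_mem _ (hvy π hπ) (hvy π' hπ')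
      have h3 := Submodule.add_mem _ h1 h2
      rw [hjj] at h3
      convert h3 using 1
      abel
    let FX := hXfin.toFinset
    let FY := hYfin.toFinset
    let a : PointedCone ℝ V → ℚ := fun σ' => ∑ π ∈ FY with j π = σ', Y.weight π
    have hbalX : IsBalancedAt Λ k X.cones a τ := by
      refine ⟨u, hu, ?_⟩
      rw [finsum_mem_eq_finite_toFinset_sum _ hXfin]
      rw [finsum_mem_eq_finite_toFinset_sum _ hYfin, hLeq] at hbal
      have h1 : ∑ π ∈ FY, ((Y.weight π : ℚ) : ℝ) • u (j π) ∈ linearSpan τ := by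
        have h2 : ∑ π ∈ FY, ((Y.weight π : ℚ) : ℝ) • (v π - u (j π)) ∈ linearSpan τ :=
          Submodule.sum_mem _ fun π hπ => Submodule.smul_mem _ _ (hvu π (hYfin.mem_toFinset.1 hπ))
        have h3 := Submodule.sub_mem _ hbal h2
        simpa [smul_sub, FY] using h3
      have h4 : ∑ π ∈ FY, ((Y.weight π : ℚ) : ℝ) • u (j π) =
          ∑ σ' ∈ FX, ((a σ' : ℚ) : ℝ) • u σ' := by
        rw [← Finset.sum_fiberwise_of_maps_to (s := FY) (t := FX) (g := j)
          fun π hπ => hXfin.mem_toFinset.2 (hj π (hYfin.mem_toFinset.1 hπ))]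
        refine Finset.sum_congr rfl fun σ' _ => ?_
        simp only [a, Rat.cast_sum, Finset.sum_smul]
        refine Finset.sum_congr rfl fun π hπ => ?_
        rw [(Finset.mem_filter.1 hπ).2]
      rw [← h4]
      exact h1
    obtain ⟨c, hc⟩ := hXirr τ hτ hτk a hbalX
    obtain ⟨π, hπY, hρπ, hπk⟩ := (hY.isPureOfDim ρ hρ).2
    have hπ : π ∈ facetsAt k Y.cones ρ := ⟨hπY, hπk, hρπ⟩
    have hc0 : c ≠ 0 := by
      rintro rfl
      have h1 := hc (j π) (hj π hπ)
      have h2 : a (j π) = Y.weight π := by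
        have : (FY.filter fun π' => j π' = j π) = {π} := by
          ext π'
          simp only [Finset.mem_filter, Finset.mem_singleton, FY, Set.Finite.mem_toFinset]
          constructor
          · rintro ⟨h, h'⟩
            exact hjinj π' h π hπ h'
          · rintro rfl
            exact ⟨hπ, rfl⟩
        simp only [a, this, Finset.sum_singleton]
      rw [h2, zero_mul] at h1
      exact hY.weight_ne_zero π hπY hπk h1
    have hasigma : a σ ≠ 0 := by
      rw [hc σ hσ]
      exact mul_ne_zero hc0 (hX.weight_ne_zero σ hσ.1 hσ.2.1)
    obtain ⟨π', hπ', -⟩ := Finset.exists_ne_zero_of_sum_ne_zero hasigma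
    obtain ⟨hπ'Y, rfl⟩ := Finset.mem_filter.1 hπ'
    have hπ'Y := hYfin.mem_toFinset.1 hπ'Y
    refine ⟨π', hπ'Y.1, ?_⟩
    refine dim_inf_eq_of_common_direction hz hzρ hle hσ.2.2.le hπ'Y.2.2.le (ht π' hπ'Y)
      ⟨hmem π' hπ'Y, ?_⟩ (hσy π' hπ'Y) hσ.2.1
    exact π'.add_mem (hπ'Y.2.2.le hzρ.1) (π'.smul_mem (ht π' hπ'Y).le (hy π' hπ'Y))
  · -- `z` lies in the relative interior of a facet of `Y`, which spreads over two facets of `X`.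
    obtain ⟨y, hyρ, hyL⟩ := SetLike.not_le_iff_exists.1 hρτ
    have hside : ∀ w ∈ linearSpan ρ, w ∉ linearSpan τ → ∃ σ' ∈ facetsAt k X.cones τ,
        dim (σ' ⊓ ρ) = k ∧ ∃ l ∈ linearSpan τ, ∃ c : ℝ, 0 < c ∧ w = l + c • u σ' := by
      intro w hwρ hwL
      obtain ⟨ε, hε, hpush⟩ := hzρ.exists_add_smul_mem hwρ
      have hw := hpush ε hε.le le_rfl
      have hwL' : z + ε • w ∉ linearSpan τ := fun h => hwL (by
        have := Submodule.sub_mem _ h (mem_linearSpan hz.1)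
        rw [add_sub_cancel_left] at this
        exact (Submodule.smul_mem_iff _ hε.ne').1 this)
      obtain ⟨σ', hσ', t, ht, hmem, l, hl, c, hc, hyc⟩ := hstar ρ hρ hzρ.1 _ hw
      have hc0 := hpos hc hl hyc hwL'
      refine ⟨σ', hσ', ?_, ε⁻¹ • (l - z), Submodule.smul_mem _ _
        (Submodule.sub_mem _ hl (mem_linearSpan hz.1)), ε⁻¹ * c, by positivity, ?_⟩
      · exact dim_inf_eq_of_common_direction hz hzρ hle hσ'.2.2.le le_rfl ht
          ⟨hmem, ρ.add_mem hzρ.1 (ρ.smul_mem ht.le hw)⟩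
          (hspan σ' hσ' _ l c hc0 hl hyc) hσ'.2.1
      · have : w = ε⁻¹ • (z + ε • w - z) := by
          rw [add_sub_cancel_left, smul_smul, inv_mul_cancel₀ hε.ne', one_smul]
        rw [this, hyc]
        module
    obtain ⟨σ₁, hσ₁, hd₁, l₁, hl₁, c₁, hc₁, hy₁⟩ := hside y hyρ hyL
    obtain ⟨σ₂, hσ₂, hd₂, l₂, hl₂, c₂, hc₂, hy₂⟩ := hside (-y) (Submodule.neg_mem _ hyρ)
      fun h => hyL (by simpa using Submodule.neg_mem _ h)
    have hsp : linearSpan σ₁ = linearSpan σ₂ := by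
      refine linearSpan_eq_of_le ((hspan σ₁ hσ₁ y l₁ c₁ hc₁ hl₁ hy₁).trans (sup_le ?_ ?_))
        hσ₁.2.1 hσ₂.2.1.le
      · exact linearSpan_mono hσ₂.2.2.le
      · rw [Submodule.span_singleton_le_iff_mem]
        have : y = -(l₂ + c₂ • u σ₂) := by rw [← hy₂, neg_neg]
        rw [this]
        exact Submodule.neg_mem _ (Submodule.add_mem _ (linearSpan_mono hσ₂.2.2.le hl₂)
          (Submodule.smul_mem _ _ (hu σ₂ hσ₂).mem_linearSpan))
    have hopp : u σ₁ + u σ₂ ∈ linearSpan τ := by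
      have h1 : -u σ₂ - u σ₁ ∈ linearSpan τ := by
        refine sub_mem_of_generates (W := linearSpan σ₁) (c := c₁ / c₂) (hu σ₁ hσ₁).generates ?_
          (hu σ₁ hσ₁).mem_lattice (Λ.neg_mem (hu σ₂ hσ₂).mem_lattice) (hu σ₁ hσ₁).mem_linearSpan
          ?_ (huL σ₁ hσ₁) (by positivity) ?_
        · intro x hx hx'
          rw [hsp] at hx'
          obtain ⟨m, hm⟩ := (hu σ₂ hσ₂).generates x hx hx'
          exact ⟨-m, by simpa using hm⟩
        · rw [hsp]
          exact Submodule.neg_mem _ (hu σ₂ hσ₂).mem_linearSpan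
        · have h2 := Submodule.smul_mem _ c₂⁻¹ (Submodule.add_mem _ hl₁ hl₂)
          have h3 : c₂ • u σ₂ = -(l₁ + c₁ • u σ₁) - l₂ := by
            rw [← hy₁, hy₂]
            abel
          have h4 : u σ₂ = c₂⁻¹ • (c₂ • u σ₂) := by
            rw [smul_smul, inv_mul_cancel₀ hc₂.ne', one_smul]
          convert h2 using 1
          rw [h4, h3, div_eq_inv_mul]
          module
      have := Submodule.neg_mem _ h1
      convert this using 1
      abel
    have hne : σ₁ ≠ σ₂ := by
      rintro rfl
      rw [← two_smul ℝ] at hopp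
      exact huL σ₁ hσ₁ ((Submodule.smul_mem_iff _ two_ne_zero).1 hopp)
    let a : PointedCone ℝ V → ℚ := fun σ' => if σ' = σ₁ ∨ σ' = σ₂ then 1 else 0
    have hbalX : IsBalancedAt Λ k X.cones a τ := by
      refine ⟨u, hu, ?_⟩
      rw [finsum_mem_eq_finite_toFinset_sum _ hXfin]
      have h1 : ∑ σ' ∈ hXfin.toFinset, ((a σ' : ℚ) : ℝ) • u σ' =
          ∑ σ' ∈ {σ₁, σ₂}, u σ' := by
        have hsub : ({σ₁, σ₂} : Finset (PointedCone ℝ V)) ⊆ hXfin.toFinset := by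
          intro σ' hσ'
          rw [hXfin.mem_toFinset]
          rcases Finset.mem_insert.1 hσ' with rfl | h
          · exact hσ₁
          · exact (Finset.mem_singleton.1 h) ▸ hσ₂
        rw [← Finset.sum_subset hsub]
        · refine Finset.sum_congr rfl fun σ' hσ' => ?_
          have : σ' = σ₁ ∨ σ' = σ₂ := by simpa using hσ'
          simp [a, this]
        · intro σ' _ hσ'
          have : ¬ (σ' = σ₁ ∨ σ' = σ₂) := by simpa using hσ'
          simp [a, this]
      rw [h1, Finset.sum_pair hne]
      exact hopp
    obtain ⟨c, hc⟩ := hXirr τ hτ hτk a hbalX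
    have hc0 : c ≠ 0 := by
      rintro rfl
      have := hc σ₁ hσ₁
      simp [a] at this
    have hasigma : a σ ≠ 0 := by
      rw [hc σ hσ]
      exact mul_ne_zero hc0 (hX.weight_ne_zero σ hσ.1 hσ.2.1)
    have : σ = σ₁ ∨ σ = σ₂ := by
      by_contra h
      simp [a, h] at hasigma
    rcases this with rfl | rfl
    · exact ⟨ρ, hρ, hd₁⟩
    · exact ⟨ρ, hρ, hd₂⟩

/-- A locally irreducible tropical cycle that is connected in codimension one is irreducible. -/
theorem isIrreducibleCycle_of_isLocallyIrreducible {k : ℕ} {X : WeightedFan V}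
    (hX : IsTropicalCycle Λ k X) (hne : X.cones.Nonempty)
    (hconn : IsConnectedInCodimOne k X.cones) (hirr : IsLocallyIrreducible Λ k X) :
    IsIrreducibleCycle Λ k X := by
  refine ⟨hX, hne, fun Y hY hYne hss => ?_⟩
  have hYX := hss.subset
  obtain ⟨p, hpX, hpY⟩ := Set.exists_of_ssubset hss
  -- A facet of `X` that is not contained in `Y`.
  obtain ⟨σ₀, hσ₀, hpσ₀⟩ := mem_support.1 hpX
  obtain ⟨σ₁, hσ₁, hface, hσ₁k⟩ := (hX.isPureOfDim σ₀ hσ₀).2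
  have hbad : ¬ (σ₁ : Set V) ⊆ support Y.cones := fun h => hpY (h (hface.le hpσ₀))
  -- A facet of `X` that is contained in `Y`.
  obtain ⟨ρ', hρ'⟩ := hYne
  obtain ⟨ρ, hρ, -, hρk⟩ := (hY.isPureOfDim ρ' hρ').2
  have hstart : ∃ σ ∈ X.cones, dim σ = k ∧ dim (σ ⊓ ρ) = k := by
    by_contra! hcon
    obtain ⟨x, hx, hxn⟩ := exists_mem_forall_notMem ρ
      (S := (fun σ => linearSpan (σ ⊓ ρ)) '' X.cones) (hX.isRationalFan.finite.image _) (by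
        rintro W ⟨σ, hσ, rfl⟩ hsub
        have h1 : linearSpan ρ = linearSpan (σ ⊓ ρ) :=
          le_antisymm (Submodule.span_le.2 hsub) (linearSpan_mono inf_le_right)
        have h2 : dim (σ ⊓ ρ) = k := by
          rw [← hρk, dim, dim, h1]
        have h3 : k ≤ dim σ := by
          rw [← h2]
          exact Submodule.finrank_mono (linearSpan_mono inf_le_left)
        exact hcon σ hσ (le_antisymm (hX.isPureOfDim σ hσ).1 h3) h2)
    obtain ⟨σ, hσ, hxσ⟩ := mem_support.1 (hYX (mem_support.2 ⟨ρ, hρ, hx⟩))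
    exact hxn _ ⟨σ, hσ, rfl⟩ (mem_linearSpan ⟨hxσ, hx⟩)
  obtain ⟨σ, hσ, hσk, hσρ⟩ := hstart
  have hgood : (σ : Set V) ⊆ support Y.cones :=
    subset_support_of_dim_inf_eq hX.isRationalFan hX.isPureOfDim hY hYX hσ hσk hρ hσρ
  have hchain := hconn σ hσ σ₁ hσ₁ hσk hσ₁k
  have hall : (σ₁ : Set V) ⊆ support Y.cones ∧ σ₁ ∈ X.cones := by
    clear hbad hface hσ₁k hσ₁
    induction hchain with
    | refl => exact ⟨hgood, hσ⟩
    | @tail σ' σ'' _ hstep ih =>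
      obtain ⟨hσ'Y, hσ'⟩ := ih
      obtain ⟨hσ'', hσ''k, hτk⟩ := hstep
      have hf := hX.isRationalFan.inf_isFaceOf σ' hσ' σ'' hσ''
      have hτ : σ' ⊓ σ'' ∈ X.cones := hX.isRationalFan.face_mem σ' hσ' _ hf.1
      obtain ⟨z, hz, hzS⟩ := hX.isRationalFan.exists_inRelInt hτ
        (S := linearSpan '' {ρ | ρ ∈ Y.cones ∧ ¬ ((σ' ⊓ σ'' : PointedCone ℝ V) : Set V) ⊆
          linearSpan ρ})
        ((hY.isRationalFan.finite.subset fun ρ hρ => hρ.1).image _)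
        (by
          rintro W ⟨ρ, hρ, rfl⟩
          exact hρ.2)
      obtain ⟨ρ₁, hρ₁, hdim⟩ := exists_dim_inf_eq_of_mem_support hX hirr hY hYX hτ hτk hz
        (fun ρ hρ hzρ => by
          by_contra hn
          exact hzS _ ⟨ρ, ⟨hρ, hn⟩, rfl⟩ hzρ)
        (hσ'Y hz.1.1) ⟨hσ'', hσ''k, hf.2⟩
      exact ⟨subset_support_of_dim_inf_eq hX.isRationalFan hX.isPureOfDim hY hYX hσ'' hσ''k
        hρ₁ hdim, hσ''⟩
  exact hbad hall.1

end Irreducibility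

/-! ### Laminar families of clusters -/

section Laminar

variable {α : Type*} [Fintype α] [DecidableEq α]

/-- A laminar family: a set of proper subsets (clusters) of `α` with at least two elements, any two
of which are nested or disjoint. -/
structure IsLaminar (F : Finset (Finset α)) : Prop where
  two_le_card : ∀ K ∈ F, 2 ≤ K.card
  ne_univ : ∀ K ∈ F, K ≠ Finset.univ
  nested_or_disjoint : ∀ K ∈ F, ∀ M ∈ F, K ⊆ M ∨ M ⊆ K ∨ Disjoint K M

/-- No cluster contains exactly two of the three elements `x`, `y`, `z`. -/
structure IsTriple (F : Finset (Finset α)) (x y z : α) : Prop where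
  ne₁₂ : x ≠ y
  ne₁₃ : x ≠ z
  ne₂₃ : y ≠ z
  mem₃ : ∀ K ∈ F, x ∈ K → y ∈ K → z ∈ K
  mem₂ : ∀ K ∈ F, x ∈ K → z ∈ K → y ∈ K
  mem₁ : ∀ K ∈ F, y ∈ K → z ∈ K → x ∈ K

/-- No cluster contains two elements of `Q`: in the rooted tree of the clusters, the elements of `Q`
lie in different branches at the root. -/
def IsSeparated (F : Finset (Finset α)) (Q : Finset α) : Prop :=
  ∀ x ∈ Q, ∀ y ∈ Q, x ≠ y → ∀ K ∈ F, x ∈ K → y ∉ K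

/-- The root of the tree of the clusters has at least three branches. -/
def HasThreeBranches (F : Finset (Finset α)) : Prop :=
  ∃ Q : Finset α, 3 ≤ Q.card ∧ IsSeparated F Q

/-- The union of `{x}` and all clusters that contain `x` but not `y`. -/
def block (F : Finset (Finset α)) (x y : α) : Finset α :=
  Finset.univ.filter fun w => w = x ∨ ∃ K ∈ F, x ∈ K ∧ w ∈ K ∧ y ∉ K

/-- The cluster obtained by joining the branches of `x` and `y` below the vertex at which they
separate. -/
def merge (F : Finset (Finset α)) (x y : α) : Finset α := block F x y ∪ block F y x

variable {F F' : Finset (Finset α)} {x y z w : α}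

omit [Fintype α] [DecidableEq α] in
theorem IsSeparated.mono {Q Q' : Finset α} (h : IsSeparated F' Q') (hF : F ⊆ F') (hQ : Q ⊆ Q') :
    IsSeparated F Q :=
  fun x hx y hy hne K hK => h x (hQ hx) y (hQ hy) hne K (hF hK)

omit [Fintype α] [DecidableEq α] in
theorem HasThreeBranches.mono (h : HasThreeBranches F') (hF : F ⊆ F') : HasThreeBranches F := by
  obtain ⟨Q, hQ, h⟩ := h
  exact ⟨Q, hQ, h.mono hF subset_rfl⟩

omit [Fintype α] in
theorem IsSeparated.insert_left {Q : Finset α} (h : IsSeparated F Q)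
    (hx : ∀ y ∈ Q, x ≠ y → ∀ K ∈ F, x ∈ K → y ∉ K) : IsSeparated F (insert x Q) := by
  intro s hs t ht hne K hK hsK htK
  rcases Finset.mem_insert.1 hs with h1 | h1 <;> rcases Finset.mem_insert.1 ht with h2 | h2
  · exact hne (h1.trans h2.symm)
  · exact hx t h2 (h1 ▸ hne) K hK (h1 ▸ hsK) htK
  · exact hx s h1 (h2 ▸ hne.symm) K hK (h2 ▸ htK) hsK
  · exact h s h1 t h2 hne K hK hsK htK

omit [Fintype α] in
theorem IsSeparated.insert_right {Q K : Finset α} (h : IsSeparated F Q)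
    (hK : ∀ x ∈ Q, ∀ y ∈ Q, x ≠ y → x ∈ K → y ∉ K) : IsSeparated (insert K F) Q := by
  intro s hs t ht hne M hM
  rcases Finset.mem_insert.1 hM with rfl | hM
  · exact hK s hs t ht hne
  · exact h s hs t ht hne M hM

omit [Fintype α] in
/-- A cluster inside another one does not affect the root. -/
theorem IsSeparated.insert_of_subset {Q K M : Finset α} (h : IsSeparated F Q) (hM : M ∈ F)
    (hK : K ⊆ M) : IsSeparated (insert K F) Q :=
  h.insert_right fun x hx y hy hne hxK hyK => h x hx y hy hne M hM (hK hxK) (hK hyK)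

omit [Fintype α] [DecidableEq α] in
theorem IsSeparated.isTriple {Q : Finset α} (h : IsSeparated F Q) (hx : x ∈ Q) (hy : y ∈ Q)
    (hz : z ∈ Q) (hxy : x ≠ y) (hxz : x ≠ z) (hyz : y ≠ z) : IsTriple F x y z :=
  ⟨hxy, hxz, hyz, fun K hK h1 h2 => absurd h2 (h x hx y hy hxy K hK h1),
    fun K hK h1 h2 => absurd h2 (h x hx z hz hxz K hK h1),
    fun K hK h1 h2 => absurd h2 (h y hy z hz hyz K hK h1)⟩

omit [Fintype α] [DecidableEq α] in
theorem IsTriple.mono (h : IsTriple F' x y z) (hF : F ⊆ F') : IsTriple F x y z :=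
  ⟨h.ne₁₂, h.ne₁₃, h.ne₂₃, fun K hK => h.mem₃ K (hF hK), fun K hK => h.mem₂ K (hF hK),
    fun K hK => h.mem₁ K (hF hK)⟩

omit [Fintype α] in
theorem IsTriple.isSeparated (h : IsTriple F x y z)
    (hn : ∀ M ∈ F, x ∈ M → y ∈ M → z ∉ M) : IsSeparated F {x, y, z} := by
  have h12 : ∀ K ∈ F, x ∈ K → y ∉ K := fun K hK h1 h2 => hn K hK h1 h2 (h.mem₃ K hK h1 h2)
  have h13 : ∀ K ∈ F, x ∈ K → z ∉ K := fun K hK h1 h2 => hn K hK h1 (h.mem₂ K hK h1 h2) h2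
  have h23 : ∀ K ∈ F, y ∈ K → z ∉ K := fun K hK h1 h2 => hn K hK (h.mem₁ K hK h1 h2) h1 h2
  have h0 : IsSeparated F {z} := by
    intro s hs t ht hne
    rw [Finset.mem_singleton] at hs ht
    exact absurd (hs.trans ht.symm) hne
  refine (h0.insert_left ?_).insert_left ?_
  · intro t ht _ K hK h1
    rw [Finset.mem_singleton.1 ht]
    exact h23 K hK h1
  · intro t ht _ K hK h1
    rcases Finset.mem_insert.1 ht with rfl | ht
    · exact h12 K hK h1
    · rw [Finset.mem_singleton.1 ht]
      exact h13 K hK h1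

theorem mem_block : w ∈ block F x y ↔ w = x ∨ ∃ K ∈ F, x ∈ K ∧ w ∈ K ∧ y ∉ K := by
  simp [block]

theorem self_mem_block : x ∈ block F x y := mem_block.2 (Or.inl rfl)

theorem notMem_block (h : x ≠ y) : y ∉ block F x y := by
  rw [mem_block]
  rintro (rfl | ⟨K, _, _, h1, h2⟩)
  · exact h rfl
  · exact h2 h1

theorem subset_block {K : Finset α} (hK : K ∈ F) (hx : x ∈ K) (hy : y ∉ K) : K ⊆ block F x y :=
  fun _ hw => mem_block.2 (Or.inr ⟨K, hK, hx, hw, hy⟩)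

theorem block_mono (h : F ⊆ F') : block F x y ⊆ block F' x y := by
  intro w hw
  rcases mem_block.1 hw with rfl | ⟨K, hK, h1⟩
  · exact self_mem_block
  · exact mem_block.2 (Or.inr ⟨K, h hK, h1⟩)

theorem left_mem_merge : x ∈ merge F x y := Finset.mem_union_left _ self_mem_block

theorem right_mem_merge : y ∈ merge F x y := Finset.mem_union_right _ self_mem_block

theorem IsTriple.notMem_merge (h : IsTriple F x y z) : z ∉ merge F x y := by
  simp only [merge, Finset.mem_union, mem_block, not_or, not_exists, not_and]
  refine ⟨⟨h.ne₁₃.symm, fun K hK hx hz hy => hy (h.mem₂ K hK hx hz)⟩,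
    ⟨h.ne₂₃.symm, fun K hK hy hz hx => hx (h.mem₁ K hK hy hz)⟩⟩

namespace IsLaminar

omit [DecidableEq α] in
theorem nested (hF : IsLaminar F) {K M : Finset α} (hK : K ∈ F) (hM : M ∈ F)
    (hxK : x ∈ K) (hxM : x ∈ M) : K ⊆ M ∨ M ⊆ K := by
  rcases hF.nested_or_disjoint K hK M hM with h | h | h
  · exact Or.inl h
  · exact Or.inr h
  · exact absurd hxM (Finset.disjoint_left.1 h hxK)

omit [DecidableEq α] in
theorem subset_of_mem_of_notMem (hF : IsLaminar F) {K M : Finset α} (hK : K ∈ F) (hM : M ∈ F)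
    (hxK : x ∈ K) (hxM : x ∈ M) (hyK : y ∉ K) (hyM : y ∈ M) : K ⊆ M :=
  (hF.nested hK hM hxK hxM).resolve_right fun h => hyK (h hyM)

omit [DecidableEq α] in
theorem mono (hF : IsLaminar F') (h : F ⊆ F') : IsLaminar F :=
  ⟨fun K hK => hF.two_le_card K (h hK), fun K hK => hF.ne_univ K (h hK),
    fun K hK M hM => hF.nested_or_disjoint K (h hK) M (h hM)⟩

omit [DecidableEq α] in
theorem nonempty (hF : IsLaminar F) {K : Finset α} (hK : K ∈ F) : K.Nonempty := by
  have := hF.two_le_card K hK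
  exact Finset.card_pos.1 (by omega)

theorem block_eq_singleton_or_mem (hF : IsLaminar F) : block F x y = {x} ∨ block F x y ∈ F := by
  by_cases h : (F.filter fun K => x ∈ K ∧ y ∉ K).Nonempty
  · right
    obtain ⟨K, hK, hmax⟩ := Finset.exists_max_image _ Finset.card h
    obtain ⟨hKF, hxK, hyK⟩ := Finset.mem_filter.1 hK
    have : block F x y = K := by
      refine Finset.Subset.antisymm (fun w hw => ?_) (subset_block hKF hxK hyK)
      rcases mem_block.1 hw with rfl | ⟨M, hM, hxM, hwM, hyM⟩
      · exact hxK
      · rcases hF.nested hM hKF hxM hxK with h | h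
        · exact h hwM
        · have := Finset.eq_of_subset_of_card_le h
            (hmax M (Finset.mem_filter.2 ⟨hM, hxM, hyM⟩))
          exact this ▸ hwM
    rwa [this]
  · left
    ext w
    rw [mem_block, Finset.mem_singleton]
    refine ⟨?_, Or.inl⟩
    rintro (rfl | ⟨K, hK, hx, _, hy⟩)
    · rfl
    · exact absurd ⟨K, Finset.mem_filter.2 ⟨hK, hx, hy⟩⟩ h

/-- For every set `M` with at least two elements and every `j` there is a `k ∈ M` other than `j`
such that every cluster containing both `j` and `k` contains `M`. -/
theorem exists_partner (hF : IsLaminar F) {M : Finset α} (hM : 2 ≤ M.card) (j : α) :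
    ∃ k ∈ M, j ≠ k ∧ ∀ K ∈ F, j ∈ K → k ∈ K → M ⊆ K := by
  by_cases h : (F.filter fun K => j ∈ K ∧ ¬ M ⊆ K).Nonempty
  · obtain ⟨K, hK, hmax⟩ := Finset.exists_max_image _ Finset.card h
    obtain ⟨hKF, hjK, hMK⟩ := Finset.mem_filter.1 hK
    obtain ⟨k, hkM, hkK⟩ := Finset.not_subset.1 hMK
    refine ⟨k, hkM, fun h => hkK (h ▸ hjK), fun K' hK' hjK' hkK' => ?_⟩
    by_contra hn
    have h1 := hF.subset_of_mem_of_notMem hKF hK' hjK hjK' hkK hkK'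
    have h2 := Finset.eq_of_subset_of_card_le h1
      (hmax K' (Finset.mem_filter.2 ⟨hK', hjK', hn⟩))
    exact hkK (h2 ▸ hkK')
  · obtain ⟨k, hk, hne⟩ := Finset.exists_mem_ne (by omega : 1 < M.card) j
    refine ⟨k, hk, hne.symm, fun K hK hjK _ => ?_⟩
    by_contra hn
    exact h ⟨K, Finset.mem_filter.2 ⟨hK, hjK, hn⟩⟩

theorem merge_subset (hF : IsLaminar F) {M : Finset α} (hM : M ∈ F) (hx : x ∈ M) (hy : y ∈ M) :
    merge F x y ⊆ M := by
  intro w hw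
  simp only [merge, Finset.mem_union, mem_block] at hw
  rcases hw with (rfl | ⟨K, hK, h1, h2, h3⟩) | (rfl | ⟨K, hK, h1, h2, h3⟩)
  · exact hx
  · exact hF.subset_of_mem_of_notMem hK hM h1 hx h3 hy h2
  · exact hy
  · exact hF.subset_of_mem_of_notMem hK hM h1 hy h3 hx h2

/-- Two branches at a vertex with at least three branches can be joined. -/
theorem insert_merge (hF : IsLaminar F) (h : IsTriple F x y z) :
    IsLaminar (insert (merge F x y) F) := by
  have key : ∀ M ∈ F, merge F x y ⊆ M ∨ M ⊆ merge F x y ∨ Disjoint (merge F x y) M := by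
    intro M hM
    by_cases hx : x ∈ M
    · by_cases hy : y ∈ M
      · exact Or.inl (hF.merge_subset hM hx hy)
      · exact Or.inr (Or.inl ((subset_block hM hx hy).trans Finset.subset_union_left))
    · by_cases hy : y ∈ M
      · exact Or.inr (Or.inl ((subset_block hM hy hx).trans Finset.subset_union_right))
      · right
        by_cases hd : Disjoint (merge F x y) M
        · exact Or.inr hd
        · left
          obtain ⟨w, hw, hwM⟩ := Finset.not_disjoint_iff.1 hd
          simp only [merge, Finset.mem_union, mem_block] at hw
          rcases hw with (rfl | ⟨K, hK, h1, h2, h3⟩) | (rfl | ⟨K, hK, h1, h2, h3⟩)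
          · exact absurd hwM hx
          · exact (hF.subset_of_mem_of_notMem hM hK hwM h2 hx h1).trans
              ((subset_block hK h1 h3).trans Finset.subset_union_left)
          · exact absurd hwM hy
          · exact (hF.subset_of_mem_of_notMem hM hK hwM h2 hy h1).trans
              ((subset_block hK h1 h3).trans Finset.subset_union_right)
  refine ⟨fun K hK => ?_, fun K hK => ?_, fun K hK M hM => ?_⟩
  · rcases Finset.mem_insert.1 hK with rfl | hK
    · exact Finset.one_lt_card.2 ⟨x, left_mem_merge, y, right_mem_merge, h.ne₁₂⟩
    · exact hF.two_le_card K hK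
  · rcases Finset.mem_insert.1 hK with rfl | hK
    · intro hu
      exact h.notMem_merge (hu ▸ Finset.mem_univ z)
    · exact hF.ne_univ K hK
  · rcases Finset.mem_insert.1 hK with rfl | hK <;> rcases Finset.mem_insert.1 hM with rfl | hM
    · exact Or.inl subset_rfl
    · exact key M hM
    · rcases key K hK with h | h | h
      · exact Or.inr (Or.inl h)
      · exact Or.inl h
      · exact Or.inr (Or.inr h.symm)
    · exact hF.nested_or_disjoint K hK M hM

end IsLaminar

theorem IsTriple.merge_notMem (h : IsTriple F x y z) : merge F x y ∉ F := fun hm =>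
  h.notMem_merge (h.mem₃ _ hm left_mem_merge right_mem_merge)

theorem IsSeparated.insert_merge {Q : Finset α} (hQ : IsSeparated F Q) (hx : x ∈ Q) (hy : y ∈ Q)
    (hxy : x ≠ y) : IsSeparated (insert (merge F x y) F) (Q.erase y) := by
  refine (hQ.mono subset_rfl (Finset.erase_subset _ _)).insert_right ?_
  intro s hs t ht hne hsm htm
  obtain ⟨hsy, hsQ⟩ := Finset.mem_erase.1 hs
  obtain ⟨hty, htQ⟩ := Finset.mem_erase.1 ht
  by_cases hsx : x = s
  · by_cases htx : x = t
    · exact hne (hsx.symm.trans htx)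
    · exact (hQ.isTriple hx hy htQ hxy htx hty.symm).notMem_merge htm
  · exact (hQ.isTriple hx hy hsQ hxy hsx hsy.symm).notMem_merge hsm

/-- For a numbering of `α`, every cluster and `univ` is the smallest one among those containing some
`x` together with an element of smaller number; conversely, if `x` and `x'` have the same smallest
such cluster, they form a triple together with a suitable element of that cluster. -/
theorem IsLaminar.exists_counting_map (hF : IsLaminar F) (hα : 2 ≤ Fintype.card α) :
    ∃ (D : Finset α) (ν : α → Finset α), D.card + 1 = Fintype.card α ∧
      (∀ x ∈ D, ν x ∈ insert Finset.univ F) ∧ insert Finset.univ F ⊆ D.image ν ∧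
      ∀ x ∈ D, ∀ x' ∈ D, x ≠ x' → ν x = ν x' → ∃ y, IsTriple F y x x' := by
  classical
  let e := Fintype.equivFin α
  have : NeZero (Fintype.card α) := ⟨by omega⟩
  let F₁ : Finset (Finset α) := insert Finset.univ F
  let D : Finset α := Finset.univ.erase (e.symm 0)
  have hD : ∀ {x}, x ∈ D ↔ ∃ y, e y < e x := by
    intro x
    simp only [D, Finset.mem_erase, Finset.mem_univ, and_true]
    constructor
    · intro hx
      refine ⟨e.symm 0, ?_⟩
      rw [Equiv.apply_symm_apply, Fin.pos_iff_ne_zero]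
      intro h
      exact hx (by rw [← h, Equiv.symm_apply_apply])
    · rintro ⟨y, hy⟩ rfl
      simp at hy
  have hnest : ∀ K ∈ F₁, ∀ M ∈ F₁, ∀ x, x ∈ K → x ∈ M → K ⊆ M ∨ M ⊆ K := by
    intro K hK M hM x hxK hxM
    rcases Finset.mem_insert.1 hK with rfl | hK
    · exact Or.inr (Finset.subset_univ _)
    rcases Finset.mem_insert.1 hM with rfl | hM
    · exact Or.inl (Finset.subset_univ _)
    exact hF.nested hK hM hxK hxM
  have hex : ∀ x ∈ D, ∃ K ∈ F₁, (x ∈ K ∧ ∃ y ∈ K, e y < e x) ∧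
      ∀ M ∈ F₁, x ∈ M → (∃ y ∈ M, e y < e x) → K ⊆ M := by
    intro x hx
    obtain ⟨y, hy⟩ := hD.1 hx
    have hne : (F₁.filter fun K => x ∈ K ∧ ∃ y ∈ K, e y < e x).Nonempty :=
      ⟨Finset.univ, Finset.mem_filter.2 ⟨Finset.mem_insert_self _ _, Finset.mem_univ _, y,
        Finset.mem_univ _, hy⟩⟩
    obtain ⟨K, hK, hmin⟩ := Finset.exists_min_image _ Finset.card hne
    obtain ⟨hKF, hxK, hyK⟩ := Finset.mem_filter.1 hK
    refine ⟨K, hKF, ⟨hxK, hyK⟩, fun M hM hxM hyM => ?_⟩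
    rcases hnest K hKF M hM x hxK hxM with h | h
    · exact h
    · exact (Finset.eq_of_subset_of_card_le h
        (hmin M (Finset.mem_filter.2 ⟨hM, hxM, hyM⟩))).ge
  choose! ν hν hνmem hνmin using hex
  refine ⟨D, ν, ?_, hν, ?_, ?_⟩
  · rw [Finset.card_erase_of_mem (Finset.mem_univ _), Finset.card_univ]
    omega
  · intro M hM
    have hM2 : 2 ≤ M.card := by
      rcases Finset.mem_insert.1 hM with rfl | hM
      · simpa using hα
      · exact hF.two_le_card M hM
    -- `x` is the first element of `M` outside the branch of the first element `y` of `M`.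
    obtain ⟨y, hy, hymin⟩ := Finset.exists_min_image M e (Finset.card_pos.1 (by omega))
    obtain ⟨k, hk, hyk, hkM⟩ := hF.exists_partner hM2 y
    have hne : (M.filter fun x => y ≠ x ∧ ∀ K ∈ F, y ∈ K → x ∈ K → M ⊆ K).Nonempty :=
      ⟨k, Finset.mem_filter.2 ⟨hk, hyk, hkM⟩⟩
    obtain ⟨x, hx, hxmin⟩ := Finset.exists_min_image _ e hne
    obtain ⟨hxM, hyx, hxK⟩ := Finset.mem_filter.1 hx
    have hlt : e y < e x := lt_of_le_of_ne (hymin x hxM) fun h => hyx (e.injective h)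
    have hxD : x ∈ D := hD.2 ⟨y, hlt⟩
    refine Finset.mem_image.2 ⟨x, hxD, ?_⟩
    have hsub : ν x ⊆ M := hνmin x hxD M hM hxM ⟨y, hy, hlt⟩
    obtain ⟨hxν, u, huν, hux⟩ := hνmem x hxD
    refine Finset.Subset.antisymm hsub ?_
    rcases Finset.mem_insert.1 (hν x hxD) with h | hνF
    · rw [h]
      exact Finset.subset_univ M
    by_cases huy : u = y
    · exact hxK _ hνF (huy ▸ huν) hxν
    · have hu : ¬ ∀ K ∈ F, y ∈ K → u ∈ K → M ⊆ K := fun h =>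
        absurd (hxmin u (Finset.mem_filter.2 ⟨hsub huν, Ne.symm huy, h⟩)) (not_le.2 hux)
      push Not at hu
      obtain ⟨K, hK, hyK, huK, hMK⟩ := hu
      rcases hF.nested hK hνF huK huν with h | h
      · exact hxK _ hνF (h hyK) hxν
      · exact absurd (hxK K hK hyK (h hxν)) hMK
  · -- An element of the common cluster of smaller number completes `x` and `x'` to a triple.
    have key : ∀ x ∈ D, ∀ x' ∈ D, e x < e x' → ν x = ν x' →
        ∃ y, IsTriple F y x x' := by
      intro x hx x' hx' hlt heq
      obtain ⟨hxν, u, huν, hux⟩ := hνmem x hx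
      obtain ⟨hx'ν, -⟩ := hνmem x' hx'
      refine ⟨u, ?_, ?_, ?_, ?_, ?_, ?_⟩
      · rintro rfl
        exact lt_irrefl _ hux
      · rintro rfl
        exact lt_asymm hux hlt
      · rintro rfl
        exact lt_irrefl _ hlt
      · intro K hK huK hxK
        have := hνmin x hx K (Finset.mem_insert_of_mem hK) hxK ⟨u, huK, hux⟩
        exact this (heq ▸ hx'ν)
      · intro K hK huK hxK
        have := hνmin x' hx' K (Finset.mem_insert_of_mem hK) hxK ⟨u, huK, hux.trans hlt⟩
        exact this (heq ▸ hxν)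
      · intro K hK hxK hx'K
        have := hνmin x' hx' K (Finset.mem_insert_of_mem hK) hx'K ⟨x, hxK, hlt⟩
        exact this (heq ▸ huν)
    intro x hx x' hx' hne heq
    rcases lt_or_gt_of_ne fun h => hne (e.injective h) with h | h
    · exact key x hx x' hx' h heq
    · obtain ⟨y, hy⟩ := key x' hx' x hx h heq.symm
      exact ⟨y, hy.ne₁₃, hy.ne₁₂, hy.ne₂₃.symm, hy.mem₂, hy.mem₃,
        fun K hK h1 h2 => hy.mem₁ K hK h2 h1⟩

namespace IsLaminar

theorem card_add_two_le (hF : IsLaminar F) (hα : 2 ≤ Fintype.card α) :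
    F.card + 2 ≤ Fintype.card α := by
  obtain ⟨D, ν, hD, -, himage, -⟩ := hF.exists_counting_map hα
  have h1 := (Finset.card_le_card himage).trans Finset.card_image_le
  rw [Finset.card_insert_of_notMem fun h => hF.ne_univ _ h rfl] at h1
  omega

theorem exists_isTriple (hF : IsLaminar F) (h : F.card + 2 < Fintype.card α) :
    ∃ x y z, IsTriple F x y z := by
  obtain ⟨D, ν, hD, hν, -, htriple⟩ := hF.exists_counting_map (by omega)
  have hlt : (insert Finset.univ F).card < D.card := by
    have := Finset.card_insert_le Finset.univ F
    omega
  obtain ⟨x, hx, x', hx', hne, heq⟩ := Finset.exists_ne_map_eq_of_card_lt_of_maps_to hlt hν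
  obtain ⟨y, hy⟩ := htriple x hx x' hx' hne heq
  exact ⟨y, x, x', hy⟩

theorem exists_superset (hF : IsLaminar F) (hα : 2 ≤ Fintype.card α) :
    ∃ F', F ⊆ F' ∧ IsLaminar F' ∧ F'.card + 2 = Fintype.card α := by
  induction h : Fintype.card α - F.card using Nat.strong_induction_on generalizing F with
  | _ m ih =>
    have hle := hF.card_add_two_le hα
    rcases hle.eq_or_lt with heq | hlt
    · exact ⟨F, subset_rfl, hF, heq⟩
    · obtain ⟨x, y, z, ht⟩ := hF.exists_isTriple hlt
      have hcard := Finset.card_insert_of_notMem ht.merge_notMem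
      obtain ⟨F', hsub, hF', hc⟩ := ih _ (by omega) (hF.insert_merge ht) rfl
      exact ⟨F', (Finset.subset_insert _ _).trans hsub, hF', hc⟩

/-- Each branch at the root beyond the second one costs a cluster. -/
theorem card_add_card_le (hF : IsLaminar F) {Q : Finset α} (hQ : IsSeparated F Q)
    (hα : 2 ≤ Fintype.card α) : F.card + Q.card ≤ Fintype.card α := by
  induction h : Q.card generalizing F Q with
  | zero =>
    have := hF.card_add_two_le hα
    omega
  | succ m ih =>
    by_cases hm : m ≤ 1
    · have := hF.card_add_two_le hα
      omega
    obtain ⟨x, y, z, hx, hy, hz, hxy, hxz, hyz⟩ := Finset.two_lt_card_iff.1 (by omega : 2 < Q.card)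
    have ht := hQ.isTriple hx hy hz hxy hxz hyz
    have h1 := ih (hF.insert_merge ht) (hQ.insert_merge hx hy hxy) (by
      rw [Finset.card_erase_of_mem hy]
      omega)
    rw [Finset.card_insert_of_notMem ht.merge_notMem] at h1
    omega

/-- A vertex with three branches other than the root costs a further cluster. -/
theorem card_add_card_lt (hF : IsLaminar F) {Q : Finset α} (hQ : IsSeparated F Q)
    (h : IsTriple F x y z) {M : Finset α} (hM : M ∈ F) (hx : x ∈ M) (hy : y ∈ M) :
    F.card + Q.card < Fintype.card α := by
  have h1 := (hF.insert_merge h).card_add_card_le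
    (hQ.insert_of_subset hM (hF.merge_subset hM hx hy))
    (Fintype.one_lt_card_iff.2 ⟨x, y, h.ne₁₂⟩)
  rw [Finset.card_insert_of_notMem h.merge_notMem] at h1
  omega

/-- Two elements of a block are contained in a common cluster. -/
theorem exists_mem_of_mem_block (hF : IsLaminar F) {s t : α} (hs : s ∈ block F x y)
    (ht : t ∈ block F x y) (hne : s ≠ t) : ∃ M ∈ F, s ∈ M ∧ t ∈ M := by
  rcases hF.block_eq_singleton_or_mem (x := x) (y := y) with h | h
  · rw [h, Finset.mem_singleton] at hs ht
    exact absurd (hs.trans ht.symm) hne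
  · exact ⟨_, h, hs, ht⟩

/-- If a laminar family with at least three branches at the root is not maximal among these, it has
an inner vertex other than the root with three branches, or there are four branches at the root. -/
theorem exists_isTriple_or_isSeparated (hF : IsLaminar F) (hr : HasThreeBranches F)
    (h : F.card + 3 < Fintype.card α) :
    (∃ x y z, IsTriple F x y z ∧ ∃ M ∈ F, x ∈ M ∧ y ∈ M ∧ z ∈ M) ∨
    ∃ Q : Finset α, Q.card = 4 ∧ IsSeparated F Q := by
  obtain ⟨Q₀, hQ₀, hsep⟩ := hr
  obtain ⟨a, b, c, ha, hb, hc, hab, hac, hbc⟩ :=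
    Finset.two_lt_card_iff.1 (by omega : 2 < Q₀.card)
  have habc := hsep.isTriple ha hb hc hab hac hbc
  obtain ⟨x, y, z, hxyz⟩ := (hF.insert_merge habc).exists_isTriple (by
    rw [Finset.card_insert_of_notMem habc.merge_notMem]
    omega)
  have ht := hxyz.mono (Finset.subset_insert _ F)
  by_cases hM : ∃ M ∈ F, x ∈ M ∧ y ∈ M ∧ z ∈ M
  · exact Or.inl ⟨x, y, z, ht, hM⟩
  right
  have hroot : IsSeparated F {x, y, z} :=
    ht.isSeparated fun M hM' h1 h2 h3 => hM ⟨M, hM', h1, h2, h3⟩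
  have hblock : ∀ {s t : α}, s ∈ ({x, y, z} : Finset α) → t ∈ ({x, y, z} : Finset α) → s ≠ t →
      ∀ {u v : α}, s ∈ block F u v → t ∉ block F u v := by
    intro s t hs ht hne u v hsu htu
    obtain ⟨M, hM, h1, h2⟩ := hF.exists_mem_of_mem_block hsu htu hne
    exact hroot s hs t ht hne M hM h1 h2
  -- The joined branch of `a` and `b` contains at most one of `x`, `y`, `z`.
  have hJall : ¬ (x ∈ merge F a b ∧ y ∈ merge F a b ∧ z ∈ merge F a b) := by
    simp only [merge, Finset.mem_union]
    have h12 := @hblock x y (by simp) (by simp) ht.ne₁₂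
    have h13 := @hblock x z (by simp) (by simp) ht.ne₁₃
    have h23 := @hblock y z (by simp) (by simp) ht.ne₂₃
    rintro ⟨hx | hx, hy | hy, hz | hz⟩
    · exact h12 hx hy
    · exact h12 hx hy
    · exact h13 hx hz
    · exact h23 hy hz
    · exact h23 hy hz
    · exact h13 hx hz
    · exact h12 hx hy
    · exact h12 hx hy
  have hroot' : IsSeparated (insert (merge F a b) F) {x, y, z} := by
    refine hxyz.isSeparated fun M hMF h1 h2 h3 => ?_
    rcases Finset.mem_insert.1 hMF with rfl | hMF
    · exact hJall ⟨h1, h2, h3⟩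
    · exact hM ⟨M, hMF, h1, h2, h3⟩
  -- Replace the element of `x`, `y`, `z` in the joined branch, if there is one, by `a` and `b`.
  let T := ({x, y, z} : Finset α).filter (· ∉ merge F a b)
  have hT : 2 ≤ T.card := by
    have h3 : ({x, y, z} : Finset α).card = 3 :=
      Finset.card_eq_three.2 ⟨x, y, z, ht.ne₁₂, ht.ne₁₃, ht.ne₂₃, rfl⟩
    have h1 : (({x, y, z} : Finset α).filter (· ∈ merge F a b)).card ≤ 1 := by
      refine Finset.card_le_one.2 fun s hs t ht' => ?_
      by_contra hne
      obtain ⟨hs, hsJ⟩ := Finset.mem_filter.1 hs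
      obtain ⟨ht', htJ⟩ := Finset.mem_filter.1 ht'
      exact hroot' s hs t ht' hne _ (Finset.mem_insert_self _ _) hsJ htJ
    have h2 := Finset.card_filter_add_card_filter_not (s := ({x, y, z} : Finset α))
      (· ∈ merge F a b)
    change 2 ≤ (({x, y, z} : Finset α).filter (· ∉ merge F a b)).card
    omega
  have hTm : ∀ t ∈ T, t ∉ merge F a b := fun t ht => (Finset.mem_filter.1 ht).2
  have haT : a ∉ insert b T := by
    rw [Finset.mem_insert, not_or]
    exact ⟨hab, fun h => hTm a h left_mem_merge⟩
  have hbT : b ∉ T := fun h => hTm b h right_mem_merge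
  have hsepT : IsSeparated F (insert a (insert b T)) := by
    refine ((hroot.mono subset_rfl (Finset.filter_subset _ _)).insert_left ?_).insert_left ?_
    · intro t ht _ K hK hbK htK
      refine hTm t ht (Finset.mem_union_right _ (subset_block hK hbK ?_ htK))
      exact hsep b hb a ha hab.symm K hK hbK
    · intro t ht hat K hK haK htK
      rcases Finset.mem_insert.1 ht with rfl | ht
      · exact hsep a ha t hb hab K hK haK htK
      · refine hTm t ht (Finset.mem_union_left _ (subset_block hK haK ?_ htK))
        exact hsep a ha b hb hab K hK haK
  have hcard : 4 ≤ (insert a (insert b T)).card := by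
    rw [Finset.card_insert_of_notMem haT, Finset.card_insert_of_notMem hbT]
    omega
  obtain ⟨Q, hQ, hQ4⟩ := Finset.exists_subset_card_eq hcard
  exact ⟨Q, hQ4, hsepT.mono subset_rfl hQ⟩

end IsLaminar

/-- A maximal laminar family with at least three branches at the root. -/
structure IsFacetFamily (F : Finset (Finset α)) : Prop where
  isLaminar : IsLaminar F
  hasThreeBranches : HasThreeBranches F
  card_add_three : F.card + 3 = Fintype.card α

omit [DecidableEq α] in
theorem HasThreeBranches.two_le_card (h : HasThreeBranches F) : 2 ≤ Fintype.card α := by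
  obtain ⟨Q, hQ, -⟩ := h
  have := Finset.card_le_univ Q
  omega

theorem IsLaminar.card_add_three_le (hF : IsLaminar F) (hr : HasThreeBranches F) :
    F.card + 3 ≤ Fintype.card α := by
  obtain ⟨Q, hQ, hs⟩ := id hr
  have := hF.card_add_card_le hs hr.two_le_card
  omega

theorem IsFacetFamily.not_isTriple (hF : IsFacetFamily F) {M : Finset α} (hM : M ∈ F) (hx : x ∈ M)
    (hy : y ∈ M) : ¬ IsTriple F x y z := by
  intro h
  obtain ⟨Q, hQ, hs⟩ := hF.hasThreeBranches
  have := hF.isLaminar.card_add_card_lt hs h hM hx hy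
  have := hF.card_add_three
  omega

theorem IsFacetFamily.card_le_three (hF : IsFacetFamily F) {Q : Finset α} (hQ : IsSeparated F Q) :
    Q.card ≤ 3 := by
  have := hF.isLaminar.card_add_card_le hQ hF.hasThreeBranches.two_le_card
  have := hF.card_add_three
  omega

theorem IsLaminar.exists_facetFamily (hF : IsLaminar F) (hr : HasThreeBranches F) :
    ∃ F', F ⊆ F' ∧ IsFacetFamily F' := by
  induction h : Fintype.card α - F.card using Nat.strong_induction_on generalizing F with
  | _ m ih =>
    rcases (hF.card_add_three_le hr).eq_or_lt with heq | hlt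
    · exact ⟨F, subset_rfl, hF, hr, heq⟩
    · suffices ∃ K, K ∉ F ∧ IsLaminar (insert K F) ∧ HasThreeBranches (insert K F) by
        obtain ⟨K, hK, h1, h2⟩ := this
        have hcard := Finset.card_insert_of_notMem hK
        obtain ⟨F', hsub, hF'⟩ := ih _ (by omega) h1 h2 rfl
        exact ⟨F', (Finset.subset_insert _ _).trans hsub, hF'⟩
      rcases hF.exists_isTriple_or_isSeparated hr hlt with
        ⟨x, y, z, ht, M, hM, hx, hy, -⟩ | ⟨Q, hQ, hs⟩
      · obtain ⟨Q, hQ, hs⟩ := hr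
        exact ⟨_, ht.merge_notMem, hF.insert_merge ht, Q, hQ,
          hs.insert_of_subset hM (hF.merge_subset hM hx hy)⟩
      · obtain ⟨x, y, z, hx, hy, hz, hxy, hxz, hyz⟩ :=
          Finset.two_lt_card_iff.1 (by omega : 2 < Q.card)
        have ht := hs.isTriple hx hy hz hxy hxz hyz
        refine ⟨_, ht.merge_notMem, hF.insert_merge ht, _, ?_, hs.insert_merge hx hy hxy⟩
        rw [Finset.card_erase_of_mem hy]
        omega

end Laminar

/-! ### The facets at a laminar family of codimension one -/

section LocalModel

variable {α : Type*} [Fintype α] [DecidableEq α] {F : Finset (Finset α)} {Q K : Finset α} {x y z : α}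

/-- Every cluster that contains two elements of `Q` contains all of `Q`: the elements of `Q` lie in
different branches at one vertex of the tree of the clusters. -/
def IsStar (F : Finset (Finset α)) (Q : Finset α) : Prop :=
  ∀ K ∈ F, ∀ x ∈ Q, ∀ y ∈ Q, x ≠ y → x ∈ K → y ∈ K → Q ⊆ K

omit [Fintype α] in
theorem IsTriple.isStar (h : IsTriple F x y z) : IsStar F {x, y, z} := by
  intro K hK s hs t ht hne hsK htK u hu
  have h1 := h.mem₁ K hK
  have h2 := h.mem₂ K hK
  have h3 := h.mem₃ K hK
  simp only [Finset.mem_insert, Finset.mem_singleton] at hs ht hu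
  rcases hs with rfl | rfl | rfl <;> rcases ht with rfl | rfl | rfl <;>
    rcases hu with rfl | rfl | rfl <;> tauto

omit [Fintype α] [DecidableEq α] in
theorem IsSeparated.isStar (h : IsSeparated F Q) : IsStar F Q :=
  fun K hK x hx y hy hne hxK hyK => absurd hyK (h x hx y hy hne K hK hxK)

omit [Fintype α] [DecidableEq α] in
theorem IsStar.isTriple (h : IsStar F Q) (hx : x ∈ Q) (hy : y ∈ Q) (hz : z ∈ Q) (hxy : x ≠ y)
    (hxz : x ≠ z) (hyz : y ≠ z) : IsTriple F x y z :=
  ⟨hxy, hxz, hyz, fun K hK h1 h2 => h K hK x hx y hy hxy h1 h2 hz,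
    fun K hK h1 h2 => h K hK x hx z hz hxz h1 h2 hy,
    fun K hK h1 h2 => h K hK y hy z hz hyz h1 h2 hx⟩

theorem IsStar.block_eq (h : IsStar F Q) (hx : x ∈ Q) (hy : y ∈ Q) (hz : z ∈ Q) (hxy : x ≠ y)
    (hxz : x ≠ z) : block F x y = block F x z := by
  ext w
  rw [mem_block, mem_block]
  refine or_congr Iff.rfl (exists_congr fun K => and_congr_right fun hK =>
    and_congr_right fun hxK => and_congr_right fun _ => not_congr ⟨fun h1 => ?_, fun h1 => ?_⟩)
  · exact h K hK x hx y hy hxy hxK h1 hz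
  · exact h K hK x hx z hz hxz hxK h1 hy

theorem IsLaminar.disjoint_block (hF : IsLaminar F) (h : x ≠ y) :
    Disjoint (block F x y) (block F y x) := by
  rw [Finset.disjoint_left]
  intro w hx hy
  rcases mem_block.1 hx with rfl | ⟨K, hK, hxK, hwK, hyK⟩
  · exact notMem_block h.symm hy
  rcases mem_block.1 hy with rfl | ⟨M, hM, hyM, hwM, hxM⟩
  · exact notMem_block h hx
  · rcases hF.nested hK hM hwK hwM with h | h
    · exact hxM (h hxK)
    · exact hyK (h hyM)

/-- A cluster `K` completing `F` to a facet that contains `x` and `y`, but not every element of the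
star `Q`, is the union of the branches of `x` and `y`. -/
theorem IsFacetFamily.eq_merge (hF : IsFacetFamily (insert K F)) (hQ : IsStar F Q) (hx : x ∈ Q)
    (hy : y ∈ Q) (hz : z ∈ Q) (hxy : x ≠ y) (hxK : x ∈ K) (hyK : y ∈ K) (hzK : z ∉ K) :
    K = merge F x y := by
  have hlam := hF.isLaminar
  have hK := Finset.mem_insert_self K F
  have hblock : ∀ {s t : α}, s ≠ t → s ∈ K → t ∈ K → block F s t ⊆ K := by
    intro s t hst hs ht w hw
    rcases mem_block.1 hw with rfl | ⟨M, hM, hsM, hwM, htM⟩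
    · exact hs
    · exact hlam.subset_of_mem_of_notMem (Finset.mem_insert_of_mem hM) hK hsM hs htM ht hwM
  refine Finset.Subset.antisymm (fun w hw => ?_)
    (Finset.union_subset (hblock hxy hxK hyK) (hblock hxy.symm hyK hxK))
  by_contra hwm
  have hwx : w ∉ block F x y := fun h => hwm (Finset.mem_union_left _ h)
  have hwy : w ∉ block F y x := fun h => hwm (Finset.mem_union_right _ h)
  refine hF.not_isTriple (z := w) hK hxK hyK ⟨hxy, ?_, ?_, ?_, ?_, ?_⟩
  · rintro rfl
    exact hwx self_mem_block
  · rintro rfl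
    exact hwy self_mem_block
  · intro M hM hxM hyM
    rcases Finset.mem_insert.1 hM with rfl | hMF
    · exact hw
    · have hzM := hQ M hMF x hx y hy hxy hxM hyM hz
      exact hlam.subset_of_mem_of_notMem hK hM hxK hxM hzK hzM hw
  · intro M hM hxM hwM
    rcases Finset.mem_insert.1 hM with rfl | hMF
    · exact hyK
    · by_contra hyM
      exact hwx (subset_block hMF hxM hyM hwM)
  · intro M hM hyM hwM
    rcases Finset.mem_insert.1 hM with rfl | hMF
    · exact hxK
    · by_contra hxM
      exact hwy (subset_block hMF hyM hxM hwM)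

/-- The facets containing a laminar family of codimension one: there are three or four branches at
one vertex, represented by the elements of `Q`, and the facets arise from joining two of these
branches. -/
structure IsLocalModel (F : Finset (Finset α)) (Q : Finset α) (B : α → Finset α) : Prop where
  isStar : IsStar F Q
  three_le_card : 3 ≤ Q.card
  self_mem : ∀ x ∈ Q, x ∈ B x
  eq_singleton_or_mem : ∀ x ∈ Q, B x = {x} ∨ B x ∈ F
  disjoint : ∀ x ∈ Q, ∀ y ∈ Q, x ≠ y → Disjoint (B x) (B y)
  biUnion_mem : Q.biUnion B ∈ insert Finset.univ F
  facet_iff : ∀ K, (K ∉ F ∧ IsFacetFamily (insert K F)) ↔ ∃ x ∈ Q, ∃ y ∈ Q, x ≠ y ∧ K = B x ∪ B y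

/-- A star whose branches cover a vertex and every further cluster of which separates it gives a
local model: the branch of `x` is its block with respect to any other element of the star. -/
theorem IsStar.isLocalModel (hQ : IsStar F Q) (hF : IsLaminar F)
    (hcard : F.card + 4 = Fintype.card α) (h3 : 3 ≤ Q.card)
    (hthree : ∀ x ∈ Q, ∀ y ∈ Q, x ≠ y → HasThreeBranches (insert (merge F x y) F))
    (hmeet : ∀ K ∉ F, IsFacetFamily (insert K F) →
      ∃ x ∈ Q, ∃ y ∈ Q, ∃ z ∈ Q, x ≠ y ∧ x ∈ K ∧ y ∈ K ∧ z ∉ K)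
    (hunion : ∃ I ∈ insert Finset.univ F, Q ⊆ I ∧ (∀ M ∈ F, Q ⊆ M → I ⊆ M) ∧
      ∀ w ∈ I, ∃ x ∈ Q, ∃ y ∈ Q, x ≠ y ∧ w ∈ block F x y) :
    ∃ B, IsLocalModel F Q B := by
  have hother : ∀ x, ∃ y ∈ Q, y ≠ x := fun x => Finset.exists_mem_ne (by omega) x
  choose o ho hox using hother
  have hB : ∀ x ∈ Q, ∀ y ∈ Q, x ≠ y → block F x (o x) = block F x y := fun x hx y hy hxy =>
    hQ.block_eq hx (ho x) hy (hox x).symm hxy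
  have hmerge : ∀ x ∈ Q, ∀ y ∈ Q, x ≠ y →
      block F x (o x) ∪ block F y (o y) = merge F x y := fun x hx y hy hxy => by
    rw [hB x hx y hy hxy, hB y hy x hx hxy.symm]
    rfl
  have hthird : ∀ x y : α, ∃ z ∈ Q, z ≠ x ∧ z ≠ y := by
    intro x y
    have h1 : 0 < (Q \ {x, y}).card := by
      have h2 := Finset.le_card_sdiff {x, y} Q
      have h4 := Finset.card_le_two (a := x) (b := y)
      omega
    obtain ⟨z, hz⟩ := Finset.card_pos.1 h1
    simp only [Finset.mem_sdiff, Finset.mem_insert, Finset.mem_singleton, not_or] at hz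
    exact ⟨z, hz.1, hz.2⟩
  refine ⟨fun x => block F x (o x), hQ, h3, fun _ _ => self_mem_block,
    fun _ _ => hF.block_eq_singleton_or_mem, ?_, ?_, ?_⟩
  · intro x hx y hy hxy
    simp only [hB x hx y hy hxy, hB y hy x hx hxy.symm]
    exact hF.disjoint_block hxy
  · obtain ⟨I, hI, hQI, hmin, hcov⟩ := hunion
    have : Q.biUnion (fun x => block F x (o x)) = I := by
      refine Finset.Subset.antisymm (fun w hw => ?_) (fun w hw => ?_)
      · obtain ⟨x, hx, hw⟩ := Finset.mem_biUnion.1 hw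
        rcases Finset.mem_insert.1 hI with rfl | hIF
        · exact Finset.mem_univ _
        · exact hF.merge_subset hIF (hQI hx) (hQI (ho x)) (Finset.mem_union_left _ hw)
      · obtain ⟨x, hx, y, hy, hxy, hw⟩ := hcov w hw
        exact Finset.mem_biUnion.2 ⟨x, hx, by rwa [hB x hx y hy hxy]⟩
    rwa [this]
  · intro K
    constructor
    · rintro ⟨hK, hfacet⟩
      obtain ⟨x, hx, y, hy, z, hz, hxy, hxK, hyK, hzK⟩ := hmeet K hK hfacet
      refine ⟨x, hx, y, hy, hxy, ?_⟩
      rw [hmerge x hx y hy hxy]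
      exact hfacet.eq_merge hQ hx hy hz hxy hxK hyK hzK
    · rintro ⟨x, hx, y, hy, hxy, rfl⟩
      rw [hmerge x hx y hy hxy]
      obtain ⟨z, hz, hzx, hzy⟩ := hthird x y
      have ht := hQ.isTriple hx hy hz hxy hzx.symm hzy.symm
      refine ⟨ht.merge_notMem, hF.insert_merge ht, hthree x hx y hy hxy, ?_⟩
      rw [Finset.card_insert_of_notMem ht.merge_notMem]
      omega

theorem IsLaminar.exists_isLocalModel (hF : IsLaminar F) (hr : HasThreeBranches F)
    (hcard : F.card + 4 = Fintype.card α) : ∃ Q B, IsLocalModel F Q B := by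
  rcases hF.exists_isTriple_or_isSeparated hr (by omega) with
    ⟨x, y, z, ht, M, hM, hxM, hyM, hzM⟩ | ⟨Q, hQ4, hs⟩
  · -- Three branches at a vertex other than the root.
    obtain ⟨Q₀, hQ₀, hs⟩ := hr
    have hstar := ht.isStar
    have hQM : ({x, y, z} : Finset α) ⊆ M := by
      intro w hw
      simp only [Finset.mem_insert, Finset.mem_singleton] at hw
      rcases hw with rfl | rfl | rfl <;> assumption
    have h3 : ({x, y, z} : Finset α).card = 3 :=
      Finset.card_eq_three.2 ⟨x, y, z, ht.ne₁₂, ht.ne₁₃, ht.ne₂₃, rfl⟩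
    have hthree : ∀ s ∈ ({x, y, z} : Finset α), ∀ t ∈ ({x, y, z} : Finset α), s ≠ t →
        HasThreeBranches (insert (merge F s t) F) := fun s hs' t ht' _ =>
      ⟨Q₀, hQ₀, hs.insert_of_subset hM (hF.merge_subset hM (hQM hs') (hQM ht'))⟩
    refine ⟨{x, y, z}, hstar.isLocalModel hF hcard h3.ge hthree ?_ ?_⟩
    · intro K hK hfacet
      by_contra! hcon
      have hcon' : ∀ s ∈ ({x, y, z} : Finset α), ∀ t ∈ ({x, y, z} : Finset α), s ≠ t → s ∈ K →
          t ∈ K → ({x, y, z} : Finset α) ⊆ K :=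
        fun s hs t ht hne hsK htK u hu => hcon s hs t ht u hu hne hsK htK
      have hstar' : IsStar (insert K F) {x, y, z} := by
        intro N hN
        rcases Finset.mem_insert.1 hN with rfl | hN
        · exact hcon'
        · exact hstar N hN
      exact hfacet.not_isTriple (Finset.mem_insert_of_mem hM) hxM hyM
        (hstar'.isTriple (by simp) (by simp) (by simp) ht.ne₁₂ ht.ne₁₃ ht.ne₂₃)
    · obtain ⟨I, hI, hImin⟩ := Finset.exists_min_image
        (F.filter fun N => ({x, y, z} : Finset α) ⊆ N) Finset.card
        ⟨M, Finset.mem_filter.2 ⟨hM, hQM⟩⟩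
      obtain ⟨hIF, hQI⟩ := Finset.mem_filter.1 hI
      have hxI : x ∈ I := hQI (by simp)
      have hzI : z ∈ I := hQI (by simp)
      have hleast : ∀ N ∈ F, ({x, y, z} : Finset α) ⊆ N → I ⊆ N := by
        intro N hN hQN
        rcases hF.nested hIF hN hxI (hQN (by simp)) with h | h
        · exact h
        · exact (Finset.eq_of_subset_of_card_le h
            (hImin N (Finset.mem_filter.2 ⟨hN, hQN⟩))).ge
      refine ⟨I, Finset.mem_insert_of_mem hIF, hQI, hleast, fun w hw => ?_⟩
      by_contra! hcon
      have hx' := hcon x (by simp) z (by simp) ht.ne₁₃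
      have hxy' := hcon x (by simp) y (by simp) ht.ne₁₂
      have hyx' := hcon y (by simp) x (by simp) ht.ne₁₂.symm
      have hz' := hcon z (by simp) x (by simp) ht.ne₁₃.symm
      -- Otherwise there would still be three branches after joining those of `x` and `y`.
      have hfacet : IsFacetFamily (insert (merge F x y) F) := by
        refine ⟨hF.insert_merge ht, hthree x (by simp) y (by simp) ht.ne₁₂, ?_⟩
        rw [Finset.card_insert_of_notMem ht.merge_notMem]
        omega
      have hwm : w ∉ merge F x y := by
        simp only [merge, Finset.mem_union, not_or]
        exact ⟨hxy', hyx'⟩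
      refine hfacet.not_isTriple (z := w) (Finset.mem_insert_of_mem hIF) hxI hzI
        ⟨ht.ne₁₃, ?_, ?_, ?_, ?_, ?_⟩
      · rintro rfl
        exact hx' self_mem_block
      · rintro rfl
        exact hz' self_mem_block
      all_goals
        intro N hN h1 h2
        rcases Finset.mem_insert.1 hN with rfl | hN
      · exact absurd h2 ht.notMem_merge
      · exact hleast N hN (hstar N hN x (by simp) z (by simp) ht.ne₁₃ h1 h2) hw
      · exact absurd h2 hwm
      · by_contra hzN
        exact hx' (subset_block hN h1 hzN h2)
      · exact absurd h2 hwm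
      · by_contra hxN
        exact hz' (subset_block hN h1 hxN h2)
  · -- Four branches at the root.
    refine ⟨Q, hs.isStar.isLocalModel hF hcard (by omega) ?_ ?_ ?_⟩
    · intro x hx y hy hxy
      refine ⟨_, ?_, hs.insert_merge hx hy hxy⟩
      rw [Finset.card_erase_of_mem hy]
      omega
    · intro K hK hfacet
      by_contra! hcon
      have hcon' : ∀ s ∈ Q, ∀ t ∈ Q, s ≠ t → s ∈ K → t ∈ K → Q ⊆ K :=
        fun s hs t ht hne hsK htK u hu => hcon s hs t ht u hu hne hsK htK
      have hnot : ¬ IsSeparated (insert K F) Q := fun h => by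
        have := hfacet.card_le_three h
        omega
      have hQK : Q ⊆ K := by
        by_contra hn
        exact hnot (hs.insert_right fun s hs t ht hne hsK htK => hn (hcon' s hs t ht hne hsK htK))
      obtain ⟨x, y, z, hx, hy, hz, hxy, hxz, hyz⟩ :=
        Finset.two_lt_card_iff.1 (by omega : 2 < Q.card)
      have hstar' : IsStar (insert K F) Q := by
        intro N hN
        rcases Finset.mem_insert.1 hN with rfl | hN
        · exact hcon'
        · exact hs.isStar N hN
      exact hfacet.not_isTriple (Finset.mem_insert_self K F) (hQK hx) (hQK hy)
        (hstar'.isTriple hx hy hz hxy hxz hyz)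
    · obtain ⟨x₀, y₀, z₀, hx₀, hy₀, hz₀, hxy₀, -, -⟩ :=
        Finset.two_lt_card_iff.1 (by omega : 2 < Q.card)
      have hnone : ∀ M ∈ F, ¬ Q ⊆ M := fun M hM h =>
        hs x₀ hx₀ y₀ hy₀ hxy₀ M hM (h hx₀) (h hy₀)
      refine ⟨Finset.univ, Finset.mem_insert_self _ _, Finset.subset_univ _,
        fun M hM h => absurd h (hnone M hM), fun w _ => ?_⟩
      by_contra! hcon
      have hwQ : w ∉ Q := by
        intro hw
        obtain ⟨y, hy, hyw⟩ := Finset.exists_mem_ne (by omega : 1 < Q.card) w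
        exact hcon w hw y hy hyw.symm self_mem_block
      have hs' : IsSeparated F (insert w Q) := by
        refine hs.insert_left fun y hy _ K hK hwK hyK => ?_
        obtain ⟨u, hu, huy⟩ := Finset.exists_mem_ne (by omega : 1 < Q.card) y
        exact hcon y hy u hu huy.symm (subset_block hK hyK (hs y hy u hu huy.symm K hK hyK) hwK)
      have := hF.card_add_card_le hs' hr.two_le_card
      rw [Finset.card_insert_of_notMem hwQ] at this
      omega

end LocalModel

/-! ### Connectedness in codimension one -/

section Connected

variable {α : Type*} [Fintype α] [DecidableEq α] {F F' : Finset (Finset α)}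

/-- Two facets are adjacent if they have all but one of their clusters in common. -/
def IsAdjacent (F F' : Finset (Finset α)) : Prop :=
  IsFacetFamily F' ∧ (F ∩ F').card + 1 = F.card

theorem IsFacetFamily.isAdjacent (hF : IsFacetFamily F) {K N : Finset α} (hK : K ∈ F)
    (hN : N ∉ F.erase K) (hNK : N ≠ K) (hlam : IsLaminar (insert N (F.erase K)))
    (hr : HasThreeBranches (insert N (F.erase K))) : IsAdjacent F (insert N (F.erase K)) := by
  have h1 := Finset.card_erase_add_one hK
  have hNF : N ∉ F := fun h => hN (Finset.mem_erase.2 ⟨hNK, h⟩)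
  refine ⟨⟨hlam, hr, ?_⟩, ?_⟩
  · rw [Finset.card_insert_of_notMem hN, h1]
    exact hF.card_add_three
  · rw [Finset.inter_insert_of_notMem hNF, Finset.inter_eq_right.2 (Finset.erase_subset _ _), h1]

/-- The clusters of `F` that strictly contain the branch `J₁` of `j` or the branch `J₂` of `k`, but
do not contain both `j` and `k`. -/
def separating (F : Finset (Finset α)) (j k : α) (J₁ J₂ : Finset α) : Finset (Finset α) :=
  F.filter fun K => (J₁ ⊂ K ∧ k ∉ K) ∨ (J₂ ⊂ K ∧ j ∉ K)

omit [Fintype α] in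
theorem separating_comm (j k : α) (J₁ J₂ : Finset α) :
    separating F j k J₁ J₂ = separating F k j J₂ J₁ := by
  ext K
  simp only [separating, Finset.mem_filter, or_comm]

/-- A separating cluster `K` of maximal size can be exchanged for a cluster containing `j` and
`k`. -/
theorem IsFacetFamily.exists_exchange (hF : IsFacetFamily F) {j k : α} {J₁ J₂ K : Finset α}
    (hj : j ∈ J₁) (hK : K ∈ F) (hJK : J₁ ⊂ K) (hkK : k ∉ K)
    (hmax : ∀ M ∈ separating F j k J₁ J₂, M.card ≤ K.card) :
    ∃ N, j ∈ N ∧ k ∈ N ∧ N ∉ F.erase K ∧ IsAdjacent F (insert N (F.erase K)) := by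
  have hlam := hF.isLaminar
  have hjK : j ∈ K := hJK.1 hj
  have hjk : j ≠ k := fun h => hkK (h ▸ hjK)
  obtain ⟨t, htK, hjt, htM⟩ := hlam.exists_partner (hlam.two_le_card K hK) j
  have hF₀ : F.erase K ⊆ F := Finset.erase_subset _ _
  -- A cluster that strictly contains `K` contains `k`, by maximality.
  have hbig : ∀ M ∈ F.erase K, K ⊆ M → k ∈ M := by
    intro M hM hKM
    obtain ⟨hMK, hMF⟩ := Finset.mem_erase.1 hM
    by_contra hkM
    have hsep : M ∈ separating F j k J₁ J₂ :=
      Finset.mem_filter.2 ⟨hMF, Or.inl ⟨hJK.trans_subset hKM, hkM⟩⟩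
    exact hMK (Finset.eq_of_subset_of_card_le hKM (hmax M hsep)).symm
  have htriple : IsTriple (F.erase K) j k t := by
    refine ⟨hjk, hjt, ?_, ?_, ?_, ?_⟩
    · rintro rfl
      exact hkK htK
    · intro M hM hjM hkM
      exact hlam.subset_of_mem_of_notMem hK (hF₀ hM) hjK hjM hkK hkM htK
    · intro M hM hjM htM'
      exact hbig M hM (htM M (hF₀ hM) hjM htM')
    · intro M hM hkM htM'
      exact hlam.subset_of_mem_of_notMem hK (hF₀ hM) htK htM' hkK hkM hjK
  have hlam₀ := hlam.mono hF₀
  have hr₀ := hF.hasThreeBranches.mono hF₀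
  refine ⟨merge (F.erase K) j k, left_mem_merge, right_mem_merge, htriple.merge_notMem,
    hF.isAdjacent hK htriple.merge_notMem ?_ (hlam₀.insert_merge htriple) ?_⟩
  · intro h
    exact hkK (h ▸ right_mem_merge)
  by_cases hM : ∃ M ∈ F.erase K, j ∈ M ∧ k ∈ M
  · obtain ⟨M, hM, hjM, hkM⟩ := hM
    obtain ⟨Q, hQ, hs⟩ := hr₀
    exact ⟨Q, hQ, hs.insert_of_subset hM (hlam₀.merge_subset hM hjM hkM)⟩
  · -- `K` is a branch at the root; it is replaced by a union of branches at the root.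
    have hsep : IsSeparated (F.erase K) {j, k, t} :=
      htriple.isSeparated fun M hM' h1 h2 _ => hM ⟨M, hM', h1, h2⟩
    obtain ⟨Q, hQ, hs⟩ := hF.hasThreeBranches
    obtain ⟨e, he, heK, hek⟩ : ∃ e ∈ Q, e ∉ K ∧ e ∉ block F k j := by
      have h1 : (Q.filter (· ∈ K)).card ≤ 1 := Finset.card_le_one.2 fun a ha b hb => by
        by_contra hne
        obtain ⟨ha, haK⟩ := Finset.mem_filter.1 ha
        obtain ⟨hb, hbK⟩ := Finset.mem_filter.1 hb
        exact hs a ha b hb hne K hK haK hbK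
      have h2 : (Q.filter (· ∈ block F k j)).card ≤ 1 := Finset.card_le_one.2 fun a ha b hb => by
        by_contra hne
        obtain ⟨ha, haB⟩ := Finset.mem_filter.1 ha
        obtain ⟨hb, hbB⟩ := Finset.mem_filter.1 hb
        obtain ⟨M, hM, haM, hbM⟩ := hlam.exists_mem_of_mem_block haB hbB hne
        exact hs a ha b hb hne M hM haM hbM
      by_contra! hcon
      have h3 : Q ⊆ Q.filter (· ∈ K) ∪ Q.filter (· ∈ block F k j) := by
        intro e he
        by_cases heK : e ∈ K
        · exact Finset.mem_union_left _ (Finset.mem_filter.2 ⟨he, heK⟩)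
        · exact Finset.mem_union_right _ (Finset.mem_filter.2 ⟨he, hcon e he heK⟩)
      have h4 := (Finset.card_le_card h3).trans (Finset.card_union_le _ _)
      omega
    have hej : e ≠ j := fun h => heK (h ▸ hjK)
    have het : e ≠ t := fun h => heK (h ▸ htK)
    -- A cluster meeting `K` and containing `e` would contain `j`, `t` and `k`.
    have hKe : ∀ M ∈ F.erase K, ∀ s ∈ K, s ∈ M → e ∉ M := by
      intro M hM' s hsK hsM heM
      have h1 := hlam.subset_of_mem_of_notMem hK (hF₀ hM') hsK hsM heK heM
      exact hM ⟨M, hM', h1 hjK, hbig M hM' h1⟩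
    have hem : e ∉ merge (F.erase K) j k := by
      simp only [merge, Finset.mem_union, not_or]
      constructor
      · rw [mem_block]
        rintro (h | ⟨M, hM', hjM, heM, -⟩)
        · exact hej h
        · exact hKe M hM' j hjK hjM heM
      · exact fun h => hek (block_mono hF₀ h)
    refine ⟨{j, t, e}, (Finset.card_eq_three.2 ⟨j, t, e, hjt, hej.symm, het.symm, rfl⟩).ge, ?_⟩
    have h0 : IsTriple (insert (merge (F.erase K) j k) (F.erase K)) j t e := by
      refine ⟨hjt, hej.symm, het.symm, ?_, ?_, ?_⟩ <;> intro M hM' h1 h2 <;>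
        rcases Finset.mem_insert.1 hM' with rfl | hM'
      · exact absurd h2 htriple.notMem_merge
      · exact absurd h2 (hsep j (by simp) t (by simp) hjt M hM' h1)
      · exact absurd h2 hem
      · exact absurd h2 (hKe M hM' j hjK h1)
      · exact absurd h2 hem
      · exact absurd h2 (hKe M hM' t htK h1)
    refine h0.isSeparated fun M hM' h1 h2 h3 => ?_
    rcases Finset.mem_insert.1 hM' with rfl | hM'
    · exact hem h3
    · exact hKe M hM' j hjK h1 h3

/-- If no cluster of `F` separates the branches `J₁` and `J₂`, their union either belongs to `F` or
can be exchanged for a cluster of `F` outside `F'`. -/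
theorem IsFacetFamily.exists_insert_union (hF : IsFacetFamily F) (hF' : IsFacetFamily F') {j k : α}
    {J₁ J₂ : Finset α} (hj : j ∈ J₁) (hk : k ∈ J₂) (hjk : j ≠ k) (hk₁ : k ∉ J₁) (hj₂ : j ∉ J₂)
    (hJ₁ : J₁ = {j} ∨ J₁ ∈ F) (hJ₂ : J₂ = {k} ∨ J₂ ∈ F) (hJ : J₁ ∪ J₂ ∈ F') (hJF : J₁ ∪ J₂ ∉ F)
    (hsep : separating F j k J₁ J₂ = ∅) :
    ∃ E ∈ F, E ∉ F' ∧ IsAdjacent F (insert (J₁ ∪ J₂) (F.erase E)) := by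
  have hlam := hF.isLaminar
  have hsub : ∀ {j k : α} {J₁ J₂ : Finset α}, j ∈ J₁ → (J₁ = {j} ∨ J₁ ∈ F) →
      separating F j k J₁ J₂ = ∅ → ∀ M ∈ F, j ∈ M → k ∉ M → M ⊆ J₁ := by
    intro j k J₁ J₂ hj hJ₁ hsep M hM hjM hkM
    have hnot : ¬ J₁ ⊂ M := fun h => by
      have : M ∈ separating F j k J₁ J₂ := Finset.mem_filter.2 ⟨hM, Or.inl ⟨h, hkM⟩⟩
      rw [hsep] at this
      exact absurd this (Finset.notMem_empty _)
    have hle : J₁ ⊆ M ∨ M ⊆ J₁ := by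
      rcases hJ₁ with rfl | hJ₁
      · exact Or.inl (Finset.singleton_subset_iff.2 hjM)
      · exact hlam.nested hJ₁ hM hj hjM
    rcases hle with h | h
    · rcases h.eq_or_ssubset with h | h
      · exact h.ge
      · exact absurd h hnot
    · exact h
  have h₁ := hsub hj hJ₁ hsep
  have h₂ := hsub hk hJ₂ (separating_comm (F := F) j k J₁ J₂ ▸ hsep)
  have hblock : ∀ {j k : α} {J : Finset α}, j ∈ J → k ∉ J →
      (∀ M ∈ F, j ∈ M → k ∉ M → M ⊆ J) → ∀ F₀ ⊆ F, (J = {j} ∨ J ∈ F₀) → block F₀ j k = J := by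
    intro j k J hj hk hM F₀ hF₀ hJ₀
    refine Finset.Subset.antisymm (fun w hw => ?_) ?_
    · rcases mem_block.1 hw with rfl | ⟨M, hMF, hjM, hwM, hkM⟩
      · exact hj
      · exact hM M (hF₀ hMF) hjM hkM hwM
    · rcases hJ₀ with rfl | hJ₀
      · exact Finset.singleton_subset_iff.2 self_mem_block
      · exact subset_block hJ₀ hj hk
  have hmerge : ∀ F₀ ⊆ F, (J₁ = {j} ∨ J₁ ∈ F₀) → (J₂ = {k} ∨ J₂ ∈ F₀) →
      merge F₀ j k = J₁ ∪ J₂ := by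
    intro F₀ hF₀ h1 h2
    rw [merge, hblock hj hk₁ h₁ F₀ hF₀ h1, hblock hk hj₂ h₂ F₀ hF₀ h2]
  -- An element outside the union forms a triple with `j` and `k`, if it is compatible with `{j, k}`.
  have htriple : ∀ e, e ∉ J₁ ∪ J₂ → (∀ M ∈ F, j ∈ M → k ∈ M → e ∈ M) → IsTriple F j k e := by
    intro e he hM
    rw [Finset.mem_union, not_or] at he
    refine ⟨hjk, ?_, ?_, hM, ?_, ?_⟩
    · rintro rfl
      exact he.1 hj
    · rintro rfl
      exact he.2 hk
    · intro M hMF hjM heM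
      by_contra hkM
      exact he.1 (h₁ M hMF hjM hkM heM)
    · intro M hMF hkM heM
      by_contra hjM
      exact he.2 (h₂ M hMF hkM hjM heM)
  -- No cluster contains both `j` and `k`.
  have hnone : ∀ M ∈ F, j ∈ M → k ∉ M := by
    intro M₀ hM₀ hjM₀ hkM₀
    obtain ⟨M, hM, hmin⟩ := Finset.exists_min_image (F.filter fun M => j ∈ M ∧ k ∈ M) Finset.card
      ⟨M₀, Finset.mem_filter.2 ⟨hM₀, hjM₀, hkM₀⟩⟩
    obtain ⟨hMF, hjM, hkM⟩ := Finset.mem_filter.1 hM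
    have hJM : J₁ ∪ J₂ ⊆ M := by
      rw [← hmerge F subset_rfl hJ₁ hJ₂]
      exact hlam.merge_subset hMF hjM hkM
    obtain ⟨e, heM, heJ⟩ := Finset.not_subset.1 fun h : M ⊆ J₁ ∪ J₂ =>
      hJF (Finset.Subset.antisymm hJM h ▸ hMF)
    refine hF.not_isTriple hMF hjM hkM (htriple e heJ fun N hN hjN hkN => ?_)
    rcases hlam.nested hMF hN hjM hjN with h | h
    · exact h heM
    · exact (Finset.eq_of_subset_of_card_le h
        (hmin N (Finset.mem_filter.2 ⟨hN, hjN, hkN⟩))) ▸ heM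
  have htriple' : ∀ e, e ∉ J₁ ∪ J₂ → IsTriple F j k e := fun e he =>
    htriple e he fun M hM h1 h2 => absurd h2 (hnone M hM h1)
  have hjkM : ∀ e, e ∉ J₁ ∪ J₂ → ∀ M ∈ F, (j ∈ M ∨ k ∈ M) → e ∉ M := by
    intro e he M hM hjkM heM
    rcases hjkM with h | h
    · exact hnone M hM h ((htriple' e he).mem₂ M hM h heM)
    · exact hnone M hM ((htriple' e he).mem₁ M hM h heM) h
  -- Two branches of `F'` at the root other than the one containing `J₁ ∪ J₂`.
  obtain ⟨Q, hQ, hs⟩ := hF'.hasThreeBranches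
  have hcard : 1 < (Q.filter (· ∉ J₁ ∪ J₂)).card := by
    have h1 : (Q.filter (· ∈ J₁ ∪ J₂)).card ≤ 1 := Finset.card_le_one.2 fun a ha b hb => by
      by_contra hne
      obtain ⟨ha, haK⟩ := Finset.mem_filter.1 ha
      obtain ⟨hb, hbK⟩ := Finset.mem_filter.1 hb
      exact hs a ha b hb hne _ hJ haK hbK
    have h2 := Finset.card_filter_add_card_filter_not (s := Q) (· ∈ J₁ ∪ J₂)
    omega
  obtain ⟨e, he, e', he', hee'⟩ := Finset.one_lt_card.1 hcard
  obtain ⟨heQ, heJ⟩ := Finset.mem_filter.1 he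
  obtain ⟨he'Q, he'J⟩ := Finset.mem_filter.1 he'
  -- They are contained in a common cluster of `F`, which has only three branches at its root.
  have hE : ∃ E ∈ F, e ∈ E ∧ e' ∈ E := by
    by_contra! hcon
    have hs4 : IsSeparated F (insert e' {j, k, e}) := by
      refine IsSeparated.insert_left ((htriple' e heJ).isSeparated fun M hM h1 h2 _ =>
        hnone M hM h1 h2) fun y hy _ M hM h1 h2 => ?_
      simp only [Finset.mem_insert, Finset.mem_singleton] at hy
      rcases hy with rfl | rfl | rfl
      · exact hjkM e' he'J M hM (Or.inl h2) h1
      · exact hjkM e' he'J M hM (Or.inr h2) h1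
      · exact hcon M hM h2 h1
    have h3 := hF.card_le_three hs4
    have hej : e ≠ j ∧ e ≠ k := ⟨(htriple' e heJ).ne₁₃.symm, (htriple' e heJ).ne₂₃.symm⟩
    have he'j : e' ≠ j ∧ e' ≠ k := ⟨(htriple' e' he'J).ne₁₃.symm, (htriple' e' he'J).ne₂₃.symm⟩
    rw [Finset.card_insert_of_notMem (by simp [he'j, hee'.symm]),
      Finset.card_eq_three.2 ⟨j, k, e, hjk, hej.1.symm, hej.2.symm, rfl⟩] at h3
    omega
  obtain ⟨E₀, hE₀, heE₀, he'E₀⟩ := hE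
  obtain ⟨E, hE, hEmax⟩ := Finset.exists_max_image (F.filter fun M => e ∈ M ∧ e' ∈ M) Finset.card
    ⟨E₀, Finset.mem_filter.2 ⟨hE₀, heE₀, he'E₀⟩⟩
  obtain ⟨hEF, heE, he'E⟩ := Finset.mem_filter.1 hE
  have hjE : j ∉ E := fun h => hjkM e heJ E hEF (Or.inl h) heE
  have hkE : k ∉ E := fun h => hjkM e heJ E hEF (Or.inr h) heE
  obtain ⟨f, hfE, hef, hfM⟩ := hlam.exists_partner (hlam.two_le_card E hEF) e
  have hfJ : f ∉ J₁ ∪ J₂ := by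
    have key : ∀ {s : α} {J : Finset α}, s ∈ J → s ∉ E → (J = {s} ∨ J ∈ F) → e ∉ J → f ∉ J := by
      intro s J hsJ hsE hJ heJ hfJ
      rcases hJ with rfl | hJ
      · exact hsE (Finset.mem_singleton.1 hfJ ▸ hfE)
      · exact hsE (hlam.subset_of_mem_of_notMem hJ hEF hfJ hfE heJ heE hsJ)
    rw [Finset.mem_union, not_or] at heJ ⊢
    exact ⟨key hj hjE hJ₁ heJ.1, key hk hkE hJ₂ heJ.2⟩
  have hF₀ : F.erase E ⊆ F := Finset.erase_subset _ _
  have hm := hmerge (F.erase E) hF₀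
    (hJ₁.imp_right fun h => Finset.mem_erase.2 ⟨fun h' => hjE (h' ▸ hj), h⟩)
    (hJ₂.imp_right fun h => Finset.mem_erase.2 ⟨fun h' => hkE (h' ▸ hk), h⟩)
  have ht₀ := (htriple' e heJ).mono hF₀
  refine ⟨E, hEF, fun h => hs e heQ e' he'Q hee' E h heE he'E, ?_⟩
  rw [← hm]
  refine hF.isAdjacent hEF ht₀.merge_notMem ?_ ((hlam.mono hF₀).insert_merge ht₀) ?_
  · intro h
    exact hjE (h ▸ left_mem_merge)
  have hef₀ : ∀ M ∈ F.erase E, e ∈ M → f ∉ M := by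
    intro M hM heM hfM'
    obtain ⟨hME, hMF⟩ := Finset.mem_erase.1 hM
    have h1 := hfM M hMF heM hfM'
    exact hME (Finset.eq_of_subset_of_card_le h1
      (hEmax M (Finset.mem_filter.2 ⟨hMF, heM, h1 he'E⟩))).symm
  have hje : j ≠ e := (htriple' e heJ).ne₁₃
  have hjf : j ≠ f := (htriple' f hfJ).ne₁₃
  refine ⟨{j, e, f}, (Finset.card_eq_three.2 ⟨j, e, f, hje, hjf, hef, rfl⟩).ge, ?_⟩
  rw [hm]
  have h0 : IsTriple (insert (J₁ ∪ J₂) (F.erase E)) j e f := by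
    refine ⟨hje, hjf, hef, ?_, ?_, ?_⟩ <;> intro M hM' h1 h2 <;>
      rcases Finset.mem_insert.1 hM' with rfl | hM'
    · exact absurd h2 heJ
    · exact absurd h2 (hjkM e heJ M (hF₀ hM') (Or.inl h1))
    · exact absurd h2 hfJ
    · exact absurd h2 (hjkM f hfJ M (hF₀ hM') (Or.inl h1))
    · exact absurd h2 hfJ
    · exact absurd h2 (hef₀ M hM' h1)
  refine h0.isSeparated fun M hM' h1 h2 h3 => ?_
  rcases Finset.mem_insert.1 hM' with rfl | hM'
  · exact heJ h2
  · exact hef₀ M hM' h2 h3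

/-- A cluster of `F'` both of whose branches belong to `F` can be brought into `F` by exchanging
clusters outside `F'`. -/
theorem IsFacetFamily.exists_chain_mem (hF : IsFacetFamily F) (hF' : IsFacetFamily F') {j k : α}
    {J₁ J₂ : Finset α} (hj : j ∈ J₁) (hk : k ∈ J₂) (hjk : j ≠ k) (hk₁ : k ∉ J₁) (hj₂ : j ∉ J₂)
    (hJ₁ : J₁ = {j} ∨ J₁ ∈ F ∩ F') (hJ₂ : J₂ = {k} ∨ J₂ ∈ F ∩ F') (hJ : J₁ ∪ J₂ ∈ F')
    (hb₁ : ∀ M ∈ F', j ∈ M → k ∉ M → M ⊆ J₁) (hb₂ : ∀ M ∈ F', k ∈ M → j ∉ M → M ⊆ J₂) :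
    ∃ F'', Relation.ReflTransGen IsAdjacent F F'' ∧ IsFacetFamily F'' ∧ F ∩ F' ⊆ F'' ∧
      J₁ ∪ J₂ ∈ F'' := by
  induction h : (separating F j k J₁ J₂).card using Nat.strong_induction_on generalizing F with
  | _ m ih =>
    by_cases hJF : J₁ ∪ J₂ ∈ F
    · exact ⟨F, .refl, hF, Finset.inter_subset_left, hJF⟩
    have hJ₁F := hJ₁.imp_right fun h => (Finset.mem_inter.1 h).1
    have hJ₂F := hJ₂.imp_right fun h => (Finset.mem_inter.1 h).1
    have hkeep : ∀ {K N : Finset α}, K ∉ F' → F ∩ F' ⊆ insert N (F.erase K) := by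
      intro K N hK M hM
      obtain ⟨h1, h2⟩ := Finset.mem_inter.1 hM
      exact Finset.mem_insert_of_mem (Finset.mem_erase.2 ⟨fun h => hK (h ▸ h2), h1⟩)
    rcases (separating F j k J₁ J₂).eq_empty_or_nonempty with hsep | hne
    · obtain ⟨E, hE, hEF', hadj⟩ := hF.exists_insert_union hF' hj hk hjk hk₁ hj₂ hJ₁F hJ₂F hJ hJF
        hsep
      exact ⟨_, .single hadj, hadj.1, hkeep hEF', Finset.mem_insert_self _ _⟩
    · obtain ⟨K, hKs, hmax⟩ := Finset.exists_max_image _ Finset.card hne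
      obtain ⟨hKF, hK⟩ := Finset.mem_filter.1 hKs
      have hKF' : K ∉ F' := by
        intro hK'
        rcases hK with ⟨h1, h2⟩ | ⟨h1, h2⟩
        · exact h1.2 (hb₁ K hK' (h1.1 hj) h2)
        · exact h1.2 (hb₂ K hK' (h1.1 hk) h2)
      obtain ⟨N, hjN, hkN, hN, hadj⟩ : ∃ N, j ∈ N ∧ k ∈ N ∧ N ∉ F.erase K ∧
          IsAdjacent F (insert N (F.erase K)) := by
        rcases hK with ⟨h1, h2⟩ | ⟨h1, h2⟩
        · exact hF.exists_exchange hj hKF h1 h2 hmax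
        · obtain ⟨N, hkN, hjN, h3⟩ := hF.exists_exchange (J₂ := J₁) hk hKF h1 h2
            (by rwa [separating_comm])
          exact ⟨N, hjN, hkN, h3⟩
      have hlt : (separating (insert N (F.erase K)) j k J₁ J₂).card < m := by
        rw [← h]
        refine Finset.card_lt_card (Finset.ssubset_iff_subset_ne.2 ⟨fun M hM => ?_, fun heq => ?_⟩)
        · obtain ⟨hM, hM'⟩ := Finset.mem_filter.1 hM
          rcases Finset.mem_insert.1 hM with rfl | hM
          · rcases hM' with ⟨_, h⟩ | ⟨_, h⟩
            · exact absurd hkN h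
            · exact absurd hjN h
          · exact Finset.mem_filter.2 ⟨Finset.mem_of_mem_erase hM, hM'⟩
        · rw [← heq] at hKs
          obtain ⟨hM, hM'⟩ := Finset.mem_filter.1 hKs
          rcases Finset.mem_insert.1 hM with rfl | hM
          · rcases hM' with ⟨_, h⟩ | ⟨_, h⟩
            · exact h hkN
            · exact h hjN
          · exact Finset.notMem_erase K F hM
      have hstep := hkeep (N := N) hKF'
      have hint : F ∩ F' ⊆ insert N (F.erase K) ∩ F' :=
        Finset.subset_inter hstep Finset.inter_subset_right
      obtain ⟨F'', h1, h2, h3, h4⟩ := ih _ hlt hadj.1 (hJ₁.imp_right fun h => hint h)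
        (hJ₂.imp_right fun h => hint h) rfl
      exact ⟨F'', .head hadj h1, h2, hint.trans h3, h4⟩

/-- Any two facets are connected by a chain of adjacent facets: the clusters of `F'` are brought
into `F` one by one, the small ones first. -/
theorem IsFacetFamily.reflTransGen (hF : IsFacetFamily F) (hF' : IsFacetFamily F') :
    Relation.ReflTransGen IsAdjacent F F' := by
  induction h : (F' \ F).card using Nat.strong_induction_on generalizing F with
  | _ m ih =>
    rcases (F' \ F).eq_empty_or_nonempty with hemp | hne
    · have hsub := Finset.sdiff_eq_empty_iff_subset.1 hemp
      have hcard : F.card ≤ F'.card := by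
        have h1 := hF.card_add_three
        have h2 := hF'.card_add_three
        omega
      rw [Finset.eq_of_subset_of_card_le hsub hcard]
    · obtain ⟨J, hJ, hmin⟩ := Finset.exists_min_image _ Finset.card hne
      obtain ⟨hJF', hJF⟩ := Finset.mem_sdiff.1 hJ
      have hlam := hF'.isLaminar
      obtain ⟨j, hj⟩ := hlam.nonempty hJF'
      obtain ⟨k, hk, hjk, hkM⟩ := hlam.exists_partner (hlam.two_le_card J hJF') j
      have hsub : merge F' j k ⊆ J := hlam.merge_subset hJF' hj hk
      -- By maximality of `F'`, the cluster `J` has exactly two branches.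
      have hJeq : merge F' j k = J := by
        refine Finset.Subset.antisymm hsub fun w hw => ?_
        by_contra hwm
        have hwj : w ∉ block F' j k := fun h => hwm (Finset.mem_union_left _ h)
        have hwk : w ∉ block F' k j := fun h => hwm (Finset.mem_union_right _ h)
        refine hF'.not_isTriple (z := w) hJF' hj hk ⟨hjk, ?_, ?_, ?_, ?_, ?_⟩
        · rintro rfl
          exact hwj self_mem_block
        · rintro rfl
          exact hwk self_mem_block
        · exact fun M hM h1 h2 => hkM M hM h1 h2 hw
        · intro M hM h1 h2
          by_contra h3
          exact hwj (subset_block hM h1 h3 h2)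
        · intro M hM h1 h2
          by_contra h3
          exact hwk (subset_block hM h1 h3 h2)
      have hsmall : ∀ {s t : α}, s ≠ t → t ∈ J → block F' s t ⊆ J →
          block F' s t = {s} ∨ block F' s t ∈ F ∩ F' := by
        intro s t hst ht hsubJ
        refine hlam.block_eq_singleton_or_mem.imp_right fun hb => Finset.mem_inter.2 ⟨?_, hb⟩
        by_contra hbF
        have h1 := hmin _ (Finset.mem_sdiff.2 ⟨hb, hbF⟩)
        have h2 := Finset.eq_of_subset_of_card_le hsubJ h1
        exact notMem_block hst (h2 ▸ ht)
      obtain ⟨F'', hchain, hF'', hsub'', hJ''⟩ := hF.exists_chain_mem hF'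
        (J₁ := block F' j k) (J₂ := block F' k j) self_mem_block self_mem_block hjk
        (notMem_block hjk) (notMem_block hjk.symm)
        (hsmall hjk hk (Finset.subset_union_left.trans hsub))
        (hsmall hjk.symm hj (Finset.subset_union_right.trans hsub))
        (by rw [← merge, hJeq]; exact hJF') (fun M hM h1 h2 => subset_block hM h1 h2)
        (fun M hM h1 h2 => subset_block hM h1 h2)
      rw [← merge, hJeq] at hJ''
      refine hchain.trans (ih _ ?_ hF'' rfl)
      rw [← h]
      refine Finset.card_lt_card (Finset.ssubset_iff_subset_ne.2 ⟨fun M hM => ?_, fun heq => ?_⟩)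
      · obtain ⟨h1, h2⟩ := Finset.mem_sdiff.1 hM
        exact Finset.mem_sdiff.2 ⟨h1, fun h3 => h2 (hsub'' (Finset.mem_inter.2 ⟨h3, h1⟩))⟩
      · rw [← heq] at hJ
        exact (Finset.mem_sdiff.1 hJ).2 hJ''

end Connected

/-! ### Simplicial cones with a dual system of linear forms -/

section Simplicial

variable {V ι : Type*} [AddCommGroup V] [Module ℝ V] [DecidableEq ι] {v : ι → V}
  {f : ι → V →ₗ[ℝ] ℝ} {F F' : Finset ι}

/-- The linear forms `f` take the vectors `v K`, `K ∈ F`, to the standard basis. -/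
def IsDualSystem (v : ι → V) (f : ι → V →ₗ[ℝ] ℝ) (F : Finset ι) : Prop :=
  ∀ M ∈ F, ∀ K ∈ F, f M (v K) = if K = M then 1 else 0

omit [DecidableEq ι] [Module ℝ V] in
theorem mem_span_image_iff {R : Type*} [Semiring R] [Module R V] {x : V} :
    x ∈ Submodule.span R (v '' F) ↔ ∃ c : ι → R, x = ∑ K ∈ F, c K • v K := by
  classical
  constructor
  · intro hx
    obtain ⟨c, rfl⟩ := (Submodule.mem_span_image_finset_iff_exists_fun R).1 hx
    refine ⟨fun K => if h : K ∈ F then c ⟨K, h⟩ else 0, ?_⟩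
    rw [← Finset.sum_coe_sort F]
    exact Finset.sum_congr rfl fun K _ => by simp
  · rintro ⟨c, rfl⟩
    exact Submodule.sum_mem _ fun K hK =>
      Submodule.smul_mem _ _ (Submodule.subset_span ⟨K, hK, rfl⟩)

omit [DecidableEq ι] in
theorem mem_hull_image_iff {x : V} :
    x ∈ PointedCone.hull ℝ (v '' F) ↔
      ∃ c : ι → ℝ, (∀ K, 0 ≤ c K) ∧ x = ∑ K ∈ F, c K • v K := by
  rw [PointedCone.hull, mem_span_image_iff]
  constructor
  · rintro ⟨c, rfl⟩
    exact ⟨fun K => c K, fun K => (c K).2, rfl⟩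
  · rintro ⟨c, hc, rfl⟩
    exact ⟨fun K => ⟨c K, hc K⟩, rfl⟩

omit [DecidableEq ι] in
/-- Every face of a cone generated by the vectors `v K` is generated by some of them. -/
theorem exists_subset_of_isFaceOf_hull {τ : PointedCone ℝ V}
    (hτ : τ.IsFaceOf (PointedCone.hull ℝ (v '' F))) :
    ∃ F' ⊆ F, τ = PointedCone.hull ℝ (v '' F') := by
  classical
  refine ⟨F.filter fun K => v K ∈ τ, Finset.filter_subset _ _, le_antisymm (fun x hx => ?_) ?_⟩
  · obtain ⟨c, hc, rfl⟩ := mem_hull_image_iff.1 (hτ.le hx)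
    refine Submodule.sum_mem _ fun K hK => ?_
    rcases (hc K).eq_or_lt with h0 | hpos
    · rw [← h0, zero_smul]
      exact Submodule.zero_mem _
    · refine PointedCone.smul_mem _ hpos.le (Submodule.subset_span ⟨K, ?_, rfl⟩)
      have hgen : ∀ K : F, v K ∈ PointedCone.hull ℝ (v '' F) := fun K =>
        Submodule.subset_span ⟨K, K.2, rfl⟩
      rw [← Finset.sum_coe_sort] at hx
      have := hτ.mem_of_sum_smul_mem (f := fun K : F => v K) (c := fun K : F => c K) hgen
        (fun K => hc K) hx ⟨K, hK⟩ hpos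
      simpa [hK] using this
  · rw [PointedCone.hull, Submodule.span_le]
    rintro _ ⟨K, hK, rfl⟩
    exact (Finset.mem_filter.1 (Finset.mem_coe.1 hK)).2

namespace IsDualSystem

theorem apply_sum (h : IsDualSystem v f F) {M : ι} (hM : M ∈ F) (c : ι → ℝ) :
    f M (∑ K ∈ F, c K • v K) = c M := by
  rw [map_sum, Finset.sum_eq_single M]
  · rw [map_smul, h M hM M hM]
    simp
  · intro K hK hne
    rw [map_smul, h M hM K hK, if_neg hne, smul_zero]
  · exact fun hn => absurd hM hn

theorem eq_sum_of_mem_span (h : IsDualSystem v f F) {x : V}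
    (hx : x ∈ Submodule.span ℝ (v '' F)) : x = ∑ K ∈ F, f K x • v K := by
  obtain ⟨c, rfl⟩ := mem_span_image_iff.1 hx
  exact Finset.sum_congr rfl fun K hK => by rw [h.apply_sum hK]

theorem linearIndepOn (h : IsDualSystem v f F) : LinearIndepOn ℝ v (F : Set ι) := by
  rw [linearIndepOn_finset_iff]
  intro c hc K hK
  rw [← h.apply_sum hK c, hc, map_zero]

theorem dim_hull (h : IsDualSystem v f F) : dim (PointedCone.hull ℝ (v '' F)) = F.card := by
  have h1 := h.linearIndepOn
  rw [dim, linearSpan_hull, ← Set.finrank]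
  have h2 := finrank_span_eq_card (R := ℝ) h1.linearIndependent
  rw [Set.image_eq_range]
  simpa [Set.finrank] using h2

theorem isFaceOf_hull (h : IsDualSystem v f F) (hF : F' ⊆ F) :
    (PointedCone.hull ℝ (v '' F')).IsFaceOf (PointedCone.hull ℝ (v '' F)) := by
  refine PointedCone.IsFaceOf.of_mem_of_add_mem_left
    (Submodule.span_mono (Set.image_mono (by exact_mod_cast hF))) ?_
  intro x y hx hy hxy
  obtain ⟨a, ha, rfl⟩ := mem_hull_image_iff.1 hx
  obtain ⟨b, hb, rfl⟩ := mem_hull_image_iff.1 hy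
  obtain ⟨c, hc, hsum⟩ := mem_hull_image_iff.1 hxy
  have hzero : ∀ K ∈ F, K ∉ F' → a K = 0 := by
    intro K hK hK'
    have h1 := congrArg (f K) hsum
    rw [map_add, h.apply_sum hK, h.apply_sum hK, map_sum, Finset.sum_eq_zero] at h1
    · linarith [ha K, hb K]
    · intro M hM
      rw [map_smul, h K hK M (hF hM), if_neg fun e : M = K => hK' (e ▸ hM), smul_zero]
  refine mem_hull_image_iff.2 ⟨a, ha, (Finset.sum_subset hF fun K hK hK' => ?_).symm⟩
  rw [hzero K hK hK', zero_smul]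

/-- If the dual linear forms are integral on the lattice, the additional generator of a simplicial
cone is a primitive normal vector relative to the opposite facet. -/
theorem isPrimitiveNormal {Λ : Submodule ℤ V} (h : IsDualSystem v f F) {K : ι} (hK : K ∈ F)
    (hΛ : ∀ x ∈ Λ, ∃ m : ℤ, f K x = m) (hv : v K ∈ Λ) :
    IsPrimitiveNormal Λ (PointedCone.hull ℝ (v '' (F.erase K : Finset ι)))
      (PointedCone.hull ℝ (v '' F)) (v K) := by
  have hmem : v K ∈ PointedCone.hull ℝ (v '' F) := Submodule.subset_span ⟨K, hK, rfl⟩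
  refine ⟨hv, mem_linearSpan hmem, fun x hx hxs => ?_, v K, hmem, by simp⟩
  obtain ⟨m, hm⟩ := hΛ x hx
  refine ⟨m, ?_⟩
  rw [linearSpan_hull] at hxs ⊢
  have h1 := h.eq_sum_of_mem_span hxs
  rw [← Finset.add_sum_erase F _ hK, hm, Int.cast_smul_eq_zsmul] at h1
  have h2 : x - m • v K = ∑ M ∈ F.erase K, f M x • v M := by
    rw [sub_eq_iff_eq_add']
    exact h1
  rw [h2]
  exact Submodule.sum_mem _ fun M hM =>
    Submodule.smul_mem _ _ (Submodule.subset_span ⟨M, hM, rfl⟩)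

end IsDualSystem

end Simplicial

/-! ### Vectors of clusters and Gromov products -/

section GromovProduct

variable {n : ℕ}

/-- The entry of a vector of `ℝ^(n choose 2)` at `{a, b}`, as a linear form; it is `0` if
`a = b`. -/
def pairEval (a b : Fin n) : (Pairs n → ℝ) →ₗ[ℝ] ℝ :=
  if h : a < b then LinearMap.proj ⟨(a, b), h⟩
  else if h : b < a then LinearMap.proj ⟨(b, a), h⟩ else 0

theorem pairEval_phi {a b : Fin n} (h : a ≠ b) (x : Fin n → ℝ) :
    pairEval a b (phi n x) = x a + x b := by
  rcases lt_or_gt_of_ne h with h | h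
  · simp [pairEval, h, phi]
  · simp [pairEval, h, not_lt.2 h.le, phi, add_comm]

open Classical in
theorem pairEval_splitDist (a b : Fin n) (I : Set (Fin n)) :
    pairEval a b (splitDist I) = if (a ∈ I ↔ b ∈ I) then 0 else 1 := by
  rcases lt_trichotomy a b with h | h | h
  · simp [pairEval, h, splitDist]
  · subst h
    simp [pairEval]
  · simp [pairEval, h, not_lt.2 h.le, splitDist, iff_comm]

/-- The ends other than the end `i`. -/
abbrev Others (i : Fin n) : Type := {j : Fin n // j ≠ i}

variable {i : Fin n}

/-- The vector `v_I` of a set `I` of ends not containing the end `i`. -/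
def clusterVec (I : Finset (Others i)) : Ambient n :=
  splitVec (Subtype.val '' (I : Set (Others i)))

theorem val_mem_image {I : Finset (Others i)} {a : Others i} :
    (a : Fin n) ∈ Subtype.val '' (I : Set (Others i)) ↔ a ∈ I := by
  rw [Subtype.val_injective.mem_set_image, Finset.mem_coe]

theorem base_notMem_image {I : Finset (Others i)} :
    i ∉ Subtype.val '' (I : Set (Others i)) := by
  rintro ⟨a, -, h⟩
  exact a.2 h

/-- The difference of the Gromov products at `i`, `(d(i,a) + d(i,b) - d(a,b)) / 2`, of two pairs of
ends is well-defined on the ambient space. The Gromov product of `v_I` is `1` on the pairs contained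
in `I`, and `0` otherwise. -/
theorem exists_gromovDiff {a b c d : Others i} (hab : a ≠ b) (hcd : c ≠ d) :
    ∃ g : Ambient n →ₗ[ℝ] ℝ, ∀ I : Finset (Others i), g (clusterVec I) =
      (if a ∈ I ∧ b ∈ I then 1 else 0) - (if c ∈ I ∧ d ∈ I then 1 else 0) := by
  classical
  let gr : Others i → Others i → ((Pairs n → ℝ) →ₗ[ℝ] ℝ) := fun a b =>
    (1 / 2 : ℝ) • (pairEval i a + pairEval i b - pairEval (a : Fin n) b)
  have hphi : ∀ a b : Others i, a ≠ b → ∀ x, gr a b (phi n x) = x i := by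
    intro a b hab x
    have hab' : (a : Fin n) ≠ b := fun h => hab (Subtype.ext h)
    simp only [gr, LinearMap.smul_apply, LinearMap.sub_apply, LinearMap.add_apply,
      pairEval_phi a.2.symm, pairEval_phi b.2.symm, pairEval_phi hab', smul_eq_mul]
    ring
  have hsplit : ∀ (a b : Others i) (I : Finset (Others i)),
      gr a b (splitDist (Subtype.val '' (I : Set (Others i)))) =
        if a ∈ I ∧ b ∈ I then 1 else 0 := by
    intro a b I
    simp only [gr, LinearMap.smul_apply, LinearMap.sub_apply, LinearMap.add_apply,
      pairEval_splitDist, val_mem_image, base_notMem_image, smul_eq_mul]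
    by_cases ha : a ∈ I <;> by_cases hb : b ∈ I <;> (simp [ha, hb]; try norm_num)
  refine ⟨(LinearMap.range (phi n)).liftQ (gr a b - gr c d) ?_, fun I => ?_⟩
  · rintro _ ⟨x, rfl⟩
    rw [LinearMap.mem_ker, LinearMap.sub_apply, hphi a b hab, hphi c d hcd, sub_self]
  · rw [clusterVec, splitVec, Submodule.mkQ_apply, Submodule.liftQ_apply, LinearMap.sub_apply,
      hsplit, hsplit]

theorem splitVec_compl (I : Set (Fin n)) : splitVec Iᶜ = splitVec I := by
  have : splitDist Iᶜ = splitDist I := by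
    funext p
    have h : (p.1.1 ∈ Iᶜ ↔ p.1.2 ∈ Iᶜ) ↔ (p.1.1 ∈ I ↔ p.1.2 ∈ I) := not_iff_not
    unfold splitDist
    by_cases h' : p.1.1 ∈ I ↔ p.1.2 ∈ I
    · rw [if_pos h', if_pos (h.2 h')]
    · rw [if_neg h', if_neg fun e => h' (h.1 e)]
  rw [splitVec, this, splitVec]

theorem ncard_image (I : Finset (Others i)) :
    (Subtype.val '' (I : Set (Others i))).ncard = I.card := by
  rw [Set.ncard_image_of_injective _ Subtype.val_injective, Set.ncard_coe_finset]

theorem exists_eq_image {I : Set (Fin n)} (hi : i ∉ I) :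
    ∃ K : Finset (Others i), I = Subtype.val '' (K : Set (Others i)) := by
  classical
  refine ⟨Finset.univ.filter fun a => (a : Fin n) ∈ I, ?_⟩
  ext a
  simp only [Finset.coe_filter, Finset.mem_univ, true_and, Set.mem_image, Set.mem_ofPred_eq,
    Subtype.exists, exists_and_left, exists_prop, exists_eq_right_right]
  exact ⟨fun h => ⟨h, fun h' => hi (h' ▸ h)⟩, fun h => h.1⟩

theorem compl_ncard_image (K : Finset (Others i)) :
    2 ≤ (Subtype.val '' (K : Set (Others i)))ᶜ.ncard ↔ K ≠ Finset.univ := by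
  constructor
  · rintro h rfl
    have : (Subtype.val '' ((Finset.univ : Finset (Others i)) : Set (Others i)))ᶜ = {i} := by
      ext a
      simp
    rw [this, Set.ncard_singleton] at h
    omega
  · intro h
    obtain ⟨a, ha⟩ : ∃ a, a ∉ K := by
      by_contra! h'
      exact h (Finset.eq_univ_iff_forall.2 h')
    exact (Set.one_lt_ncard (Set.toFinite _)).2
      ⟨i, base_notMem_image, a, fun h => ha (val_mem_image.1 h), a.2.symm⟩

theorem clusterVec_mem_lattice {K : Finset (Others i)} (h2 : 2 ≤ K.card)
    (hK : K ≠ Finset.univ) : clusterVec K ∈ lattice n :=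
  Submodule.subset_span ⟨_, by rwa [ncard_image], (compl_ncard_image K).2 hK, rfl⟩

/-- Integrality on the lattice can be tested on the vectors of sets not containing the end `i`. -/
theorem exists_int_of_mem_lattice {g : Ambient n →ₗ[ℝ] ℝ}
    (hg : ∀ I : Finset (Others i), ∃ m : ℤ, g (clusterVec I) = m) {x : Ambient n}
    (hx : x ∈ lattice n) : ∃ m : ℤ, g x = m := by
  induction hx using Submodule.span_induction with
  | mem x h =>
    obtain ⟨I, -, -, rfl⟩ := h
    by_cases hi : i ∈ I
    · obtain ⟨K, hK⟩ := exists_eq_image (i := i) (I := Iᶜ) (by simpa using hi)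
      rw [← splitVec_compl, hK]
      exact hg K
    · obtain ⟨K, hK⟩ := exists_eq_image hi
      rw [hK]
      exact hg K
  | zero => exact ⟨0, by simp⟩
  | add x y _ _ hx hy =>
    obtain ⟨a, ha⟩ := hx
    obtain ⟨b, hb⟩ := hy
    exact ⟨a + b, by rw [map_add, ha, hb, Int.cast_add]⟩
  | smul r x _ hx =>
    obtain ⟨a, ha⟩ := hx
    exact ⟨r * a, by rw [map_zsmul, ha, zsmul_eq_mul, Int.cast_mul]⟩

end GromovProduct

/-! ### Cones of laminar families -/

section ClusterCone

variable {n : ℕ} {i : Fin n} {F F' : Finset (Finset (Others i))}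

/-- The cone of a family of clusters. -/
def clusterCone (F : Finset (Finset (Others i))) : PointedCone ℝ (Ambient n) :=
  PointedCone.hull ℝ (clusterVec '' (F : Set (Finset (Others i))))

/-- The clusters of a laminar family containing `M`, respectively strictly containing `M`, are those
containing a certain pair. -/
theorem IsLaminar.exists_pairs {α : Type*} [Fintype α] [DecidableEq α] {F : Finset (Finset α)}
    (hF : IsLaminar F) {M : Finset α} (hM : M ∈ F) :
    ∃ a b c d : α, a ≠ b ∧ c ≠ d ∧ (∀ K ∈ F, (a ∈ K ∧ b ∈ K) ↔ M ⊆ K) ∧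
      ∀ K ∈ F, (c ∈ K ∧ d ∈ K) ↔ M ⊂ K := by
  obtain ⟨a, ha⟩ := hF.nonempty hM
  obtain ⟨b, hb, hab, h1⟩ := hF.exists_partner (hF.two_le_card M hM) a
  have hparent : ∃ P, M ⊂ P ∧ ∀ K ∈ F, M ⊂ K → P ⊆ K := by
    by_cases hne : (F.filter fun K => M ⊂ K).Nonempty
    · obtain ⟨P, hP, hmin⟩ := Finset.exists_min_image _ Finset.card hne
      obtain ⟨hPF, hMP⟩ := Finset.mem_filter.1 hP
      refine ⟨P, hMP, fun K hK hMK => ?_⟩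
      rcases hF.nested hPF hK (hMP.1 ha) (hMK.1 ha) with h | h
      · exact h
      · exact (Finset.eq_of_subset_of_card_le h
          (hmin K (Finset.mem_filter.2 ⟨hK, hMK⟩))).ge
    · exact ⟨Finset.univ, Finset.ssubset_univ_iff.2 (hF.ne_univ M hM), fun K hK hMK =>
        absurd ⟨K, Finset.mem_filter.2 ⟨hK, hMK⟩⟩ hne⟩
  obtain ⟨P, hMP, hP⟩ := hparent
  have hP2 : 2 ≤ P.card := (hF.two_le_card M hM).trans (Finset.card_le_card hMP.1)
  have hc := hMP.1 ha
  obtain ⟨d, hd, hcd, h2⟩ := hF.exists_partner hP2 a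
  refine ⟨a, b, a, d, hab, hcd, fun K hK => ⟨fun h => h1 K hK h.1 h.2, fun h => ⟨h ha, h hb⟩⟩,
    fun K hK => ⟨fun h => hMP.trans_subset (h2 K hK h.1 h.2), fun h => ?_⟩⟩
  exact ⟨hP K hK h hc, hP K hK h hd⟩

/-- The generators of the cone of a laminar family have a dual system that is integral on the
lattice. -/
theorem IsLaminar.exists_dualSystem (hF : IsLaminar F) :
    ∃ f : Finset (Others i) → Ambient n →ₗ[ℝ] ℝ, IsDualSystem clusterVec f F ∧
      ∀ M ∈ F, ∀ x ∈ lattice n, ∃ m : ℤ, f M x = m := by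
  have h : ∀ M ∈ F, ∃ g : Ambient n →ₗ[ℝ] ℝ,
      (∀ K ∈ F, g (clusterVec K) = if K = M then 1 else 0) ∧
      ∀ x ∈ lattice n, ∃ m : ℤ, g x = m := by
    intro M hM
    obtain ⟨a, b, c, d, hab, hcd, h1, h2⟩ := hF.exists_pairs hM
    obtain ⟨g, hg⟩ := exists_gromovDiff hab hcd
    refine ⟨g, fun K hK => ?_, fun x hx => exists_int_of_mem_lattice (i := i) (fun I => ?_) hx⟩
    · simp only [hg, h1 K hK, h2 K hK]
      by_cases hKM : K = M
      · subst hKM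
        simp
      · by_cases hsub : M ⊆ K
        · have hss : M ⊂ K := Finset.ssubset_iff_subset_ne.2 ⟨hsub, fun h => hKM h.symm⟩
          simp [hsub, hss, hKM]
        · have hss : ¬ M ⊂ K := fun h => hsub h.1
          simp [hsub, hss, hKM]
    · exact ⟨(if a ∈ I ∧ b ∈ I then 1 else 0) - (if c ∈ I ∧ d ∈ I then 1 else 0), by
        rw [hg]
        push_cast
        rfl⟩
  choose! f hf hf' using h
  exact ⟨f, hf, hf'⟩

theorem IsLaminar.dim_clusterCone (hF : IsLaminar F) : dim (clusterCone F) = F.card := by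
  obtain ⟨f, hf, -⟩ := hF.exists_dualSystem
  exact hf.dim_hull

theorem IsLaminar.isFaceOf_clusterCone (hF : IsLaminar F) (h : F' ⊆ F) :
    (clusterCone F').IsFaceOf (clusterCone F) := by
  obtain ⟨f, hf, -⟩ := hF.exists_dualSystem
  exact hf.isFaceOf_hull h

theorem IsLaminar.isRationalCone (hF : IsLaminar F) :
    IsRationalCone (lattice n) (clusterCone F) := by
  classical
  refine ⟨F.image clusterVec, ?_, by rw [Finset.coe_image]; rfl⟩
  intro x hx
  obtain ⟨K, hK, rfl⟩ := Finset.mem_image.1 (Finset.mem_coe.1 hx)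
  exact clusterVec_mem_lattice (hF.two_le_card K hK) (hF.ne_univ K hK)

theorem IsLaminar.isPrimitiveNormal {K : Finset (Others i)} (hF : IsLaminar (insert K F))
    (hK : K ∉ F) :
    IsPrimitiveNormal (lattice n) (clusterCone F) (clusterCone (insert K F)) (clusterVec K) := by
  obtain ⟨f, hf, hf'⟩ := hF.exists_dualSystem
  have hKm := Finset.mem_insert_self K F
  have := hf.isPrimitiveNormal hKm (hf' K hKm)
    (clusterVec_mem_lattice (hF.two_le_card K hKm) (hF.ne_univ K hKm))
  rwa [Finset.erase_insert hK] at this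

/-- A point of the cone of a laminar family determines the clusters on which its coefficients are
positive: they are the proper subsets `M` such that, within `M`, the Gromov products are larger than
those between `M` and its complement. -/
theorem IsLaminar.mem_of_pos (hF : IsLaminar F) (hF' : IsLaminar F') {a b : Finset (Others i) → ℝ}
    (ha : ∀ K, 0 ≤ a K) (hb : ∀ K, 0 ≤ b K)
    (h : ∑ K ∈ F, a K • clusterVec K = ∑ K ∈ F', b K • clusterVec K) {M : Finset (Others i)}
    (hM : M ∈ F) (haM : 0 < a M) : M ∈ F' := by
  by_contra hMF'
  obtain ⟨j, hj⟩ := hF.nonempty hM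
  obtain ⟨k, hk, hjk, hkM⟩ := hF'.exists_partner (hF.two_le_card M hM) j
  obtain ⟨l, hlM, hl⟩ : ∃ l, l ∉ M ∧ ∀ K ∈ F', M ⊆ K → l ∈ K := by
    by_cases hne : (F'.filter fun K => M ⊆ K).Nonempty
    · obtain ⟨P, hP, hmin⟩ := Finset.exists_min_image _ Finset.card hne
      obtain ⟨hPF, hMP⟩ := Finset.mem_filter.1 hP
      obtain ⟨l, hlP, hlM⟩ := Finset.not_subset.1 fun h' : P ⊆ M =>
        hMF' (Finset.Subset.antisymm hMP h' ▸ hPF)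
      refine ⟨l, hlM, fun K hK hMK => ?_⟩
      rcases hF'.nested hPF hK (hMP hj) (hMK hj) with h' | h'
      · exact h' hlP
      · exact (Finset.eq_of_subset_of_card_le h'
          (hmin K (Finset.mem_filter.2 ⟨hK, hMK⟩))) ▸ hlP
    · obtain ⟨l, hl⟩ : ∃ l, l ∉ M := by
        by_contra! h'
        exact hF.ne_univ M hM (Finset.eq_univ_iff_forall.2 h')
      exact ⟨l, hl, fun K hK hMK => absurd ⟨K, Finset.mem_filter.2 ⟨hK, hMK⟩⟩ hne⟩
  have hjl : j ≠ l := fun h' => hlM (h' ▸ hj)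
  obtain ⟨g, hg⟩ := exists_gromovDiff hjk hjl
  have hpos : 0 < g (∑ K ∈ F, a K • clusterVec K) := by
    rw [map_sum]
    refine Finset.sum_pos' (fun K hK => ?_) ⟨M, hM, ?_⟩
    · rw [map_smul, hg, smul_eq_mul]
      refine mul_nonneg (ha K) (sub_nonneg.2 ?_)
      by_cases hjlK : j ∈ K ∧ l ∈ K
      · have := hF.subset_of_mem_of_notMem hM hK hj hjlK.1 hlM hjlK.2
        rw [if_pos hjlK, if_pos ⟨hjlK.1, this hk⟩]
      · rw [if_neg hjlK]
        split_ifs <;> norm_num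
    · rw [map_smul, hg, if_pos ⟨hj, hk⟩, if_neg fun h' => hlM h'.2]
      simpa using haM
  have hneg : g (∑ K ∈ F', b K • clusterVec K) ≤ 0 := by
    rw [map_sum]
    refine Finset.sum_nonpos fun K hK => ?_
    rw [map_smul, hg, smul_eq_mul]
    refine mul_nonpos_of_nonneg_of_nonpos (hb K) (sub_nonpos.2 ?_)
    by_cases hjkK : j ∈ K ∧ k ∈ K
    · have := hl K hK (hkM K hK hjkK.1 hjkK.2)
      rw [if_pos hjkK, if_pos ⟨hjkK.1, this⟩]
    · rw [if_neg hjkK]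
      split_ifs <;> norm_num
  rw [h] at hpos
  linarith

/-- The cones of laminar families intersect in the cone of the common clusters. -/
theorem IsLaminar.inf_clusterCone (hF : IsLaminar F) (hF' : IsLaminar F') :
    clusterCone F ⊓ clusterCone F' = clusterCone (F ∩ F') := by
  refine le_antisymm ?_ (le_inf ?_ ?_)
  · rintro x ⟨hx, hx'⟩
    obtain ⟨a, ha, rfl⟩ := mem_hull_image_iff.1 hx
    obtain ⟨b, hb, hsum⟩ := mem_hull_image_iff.1 hx'
    refine mem_hull_image_iff.2 ⟨a, ha, ?_⟩
    refine (Finset.sum_subset Finset.inter_subset_left fun K hK hK' => ?_).symm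
    have h0 : a K = 0 := by
      by_contra hne
      exact hK' (Finset.mem_inter.2 ⟨hK, hF.mem_of_pos hF' ha hb hsum hK
        ((ha K).lt_of_ne (Ne.symm hne))⟩)
    rw [h0, zero_smul]
  · exact (hF.isFaceOf_clusterCone Finset.inter_subset_left).le
  · exact (hF'.isFaceOf_clusterCone Finset.inter_subset_right).le

theorem IsLaminar.subset_of_clusterCone_le (hF : IsLaminar F) (hF' : IsLaminar F')
    (h : clusterCone F ≤ clusterCone F') : F ⊆ F' := by
  classical
  intro M hM
  have hx : clusterVec M ∈ clusterCone F' := h (Submodule.subset_span ⟨M, hM, rfl⟩)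
  obtain ⟨b, hb, hsum⟩ := mem_hull_image_iff.1 hx
  refine hF.mem_of_pos hF' (a := fun K => if K = M then 1 else 0) (b := b)
    (fun K => by split_ifs <;> norm_num) hb ?_ hM (by simp)
  rw [← hsum, Finset.sum_eq_single M]
  · simp
  · intro K _ hne
    simp [hne]
  · exact fun hn => absurd hM hn

theorem IsLaminar.clusterCone_injective (hF : IsLaminar F) (hF' : IsLaminar F')
    (h : clusterCone F = clusterCone F') : F = F' :=
  Finset.Subset.antisymm (hF.subset_of_clusterCone_le hF' h.le)
    (hF'.subset_of_clusterCone_le hF h.ge)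

end ClusterCone

/-! ### The clusters of a tree -/

section Branches

variable {W : Type*} {G : SimpleGraph W} {u w u' w' y z : W}

/-- The vertices on the same side as `u` after removing the edge `{u, w}`. -/
def branch (G : SimpleGraph W) (u w : W) : Set W :=
  {x | (G.deleteEdges {s(u, w)}).Reachable u x}

theorem self_mem_branch : u ∈ branch G u w := SimpleGraph.Reachable.refl _

theorem mem_branch_of_adj (hy : y ∈ branch G u w) (h : G.Adj y z) (hne : s(y, z) ≠ s(u, w)) :
    z ∈ branch G u w := by
  refine SimpleGraph.Reachable.trans hy (SimpleGraph.Adj.reachable ?_)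
  rw [SimpleGraph.deleteEdges_adj]
  exact ⟨h, hne⟩

/-- A branch is connected in the complement of any edge that it does not contain. -/
theorem reachable_of_mem_branch (h : ¬ (u' ∈ branch G u w ∧ w' ∈ branch G u w))
    (hy : y ∈ branch G u w) (hz : z ∈ branch G u w) :
    (G.deleteEdges {s(u', w')}).Reachable y z := by
  have key : ∀ x ∈ branch G u w, (G.deleteEdges {s(u', w')}).Reachable u x := by
    intro x hx
    have hx' := (SimpleGraph.reachable_iff_reflTransGen u x).1 hx
    clear hx
    induction hx' with
    | refl => exact SimpleGraph.Reachable.refl _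
    | @tail a b hab hadj ih =>
      have ha : a ∈ branch G u w := (SimpleGraph.reachable_iff_reflTransGen u a).2 hab
      rw [SimpleGraph.deleteEdges_adj] at hadj
      have hb : b ∈ branch G u w := mem_branch_of_adj ha hadj.1 hadj.2
      refine ih.trans (SimpleGraph.Adj.reachable ?_)
      rw [SimpleGraph.deleteEdges_adj]
      refine ⟨hadj.1, fun he => h ?_⟩
      rw [Set.mem_singleton_iff, Sym2.eq_iff] at he
      rcases he with ⟨rfl, rfl⟩ | ⟨rfl, rfl⟩
      · exact ⟨ha, hb⟩
      · exact ⟨hb, ha⟩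
  exact (key y hy).symm.trans (key z hz)

theorem branch_subset (h : ¬ (u' ∈ branch G u w ∧ w' ∈ branch G u w)) (hy : y ∈ branch G u w)
    (hy' : y ∈ branch G u' w') : branch G u w ⊆ branch G u' w' := fun _ hz =>
  SimpleGraph.Reachable.trans hy' (reachable_of_mem_branch h hy hz)

theorem notMem_branch (hG : G.IsAcyclic) (h : G.Adj u w) : w ∉ branch G u w :=
  SimpleGraph.isBridge_iff.1 (SimpleGraph.isAcyclic_iff_forall_adj_isBridge.1 hG h)

theorem mem_branch_iff (hG : G.IsTree) (h : G.Adj u w) : y ∈ branch G w u ↔ y ∉ branch G u w := by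
  constructor
  · intro h1 h2
    refine notMem_branch hG.isAcyclic h (SimpleGraph.Reachable.trans h2 ?_)
    rw [branch, Set.mem_ofPred_eq, Sym2.eq_swap] at h1
    exact h1.symm
  · have hor : y ∈ branch G u w ∨ y ∈ branch G w u := by
      have hr := (SimpleGraph.reachable_iff_reflTransGen u y).1 (hG.connected u y)
      induction hr with
      | refl => exact Or.inl self_mem_branch
      | @tail a b _ hadj ih =>
        by_cases he : s(a, b) = s(u, w)
        · rw [Sym2.eq_iff] at he
          rcases he with ⟨rfl, rfl⟩ | ⟨rfl, rfl⟩
          · exact Or.inr self_mem_branch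
          · exact Or.inl self_mem_branch
        · rcases ih with ih | ih
          · exact Or.inl (mem_branch_of_adj ih hadj he)
          · exact Or.inr (mem_branch_of_adj ih hadj (by rwa [Sym2.eq_swap (a := w)]))
    tauto

/-- Branches that do not contain the root `r` are nested or disjoint. -/
theorem branch_subset_or_subset {r : W} (hG : G.IsTree) (h : G.Adj u w)
    (hr : r ∉ branch G u w) (hr' : r ∉ branch G u' w') (hy : y ∈ branch G u w)
    (hy' : y ∈ branch G u' w') :
    branch G u w ⊆ branch G u' w' ∨ branch G u' w' ⊆ branch G u w := by
  by_cases h1 : u' ∈ branch G u w ∧ w' ∈ branch G u w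
  · right
    by_cases h2 : u ∈ branch G u' w' ∧ w ∈ branch G u' w'
    · -- Then the branch of the root at the first edge lies in the second branch.
      exfalso
      have hr'' := (mem_branch_iff hG h).2 hr
      have h3 : ¬ (u' ∈ branch G w u ∧ w' ∈ branch G w u) := fun h4 =>
        (mem_branch_iff hG h).1 h4.1 h1.1
      exact hr' (branch_subset h3 self_mem_branch h2.2 hr'')
    · exact branch_subset h2 hy' hy
  · exact Or.inl (branch_subset h1 hy hy')

theorem branch_ssubset (hG : G.IsTree) (h : G.Adj u w) {x : W} (hx : G.Adj u x) (hxw : x ≠ w) :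
    branch G x u ⊂ branch G u w := by
  have hxm : x ∈ branch G u w := mem_branch_of_adj self_mem_branch hx (by
    rw [Ne, Sym2.eq_iff]
    rintro (⟨-, h1⟩ | ⟨h1, -⟩)
    · exact hxw h1
    · exact h.ne h1)
  have hu : u ∉ branch G x u := notMem_branch hG.isAcyclic hx.symm
  refine ⟨branch_subset (fun h1 => hu h1.1) self_mem_branch hxm, fun h1 => hu (h1 self_mem_branch)⟩

end Branches

namespace CombType

variable {n : ℕ} (T : CombType n)

theorem side_eq (u w : Fin T.size) : T.side u w = {j | T.mark j ∈ branch T.graph u w} := rfl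

/-- Every branch of the tree carries at least two ends. -/
theorem two_le_ncard_side {u w : Fin T.size} (h : T.graph.Adj u w) : 2 ≤ (T.side u w).ncard := by
  induction hm : (branch T.graph u w).ncard using Nat.strong_induction_on generalizing u w with
  | _ m ih =>
    by_cases hN : ∃ x, T.graph.Adj u x ∧ x ≠ w
    · obtain ⟨x, hx, hxw⟩ := hN
      have hss := branch_ssubset T.isTree h hx hxw
      have h1 := ih _ (hm ▸ Set.ncard_lt_ncard hss (Set.toFinite _)) hx.symm rfl
      refine h1.trans (Set.ncard_le_ncard ?_ (Set.toFinite _))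
      exact fun j hj => hss.1 hj
    · push Not at hN
      have h1 : T.graph.neighborSet u ⊆ {w} := fun x hx => hN x hx
      have h2 := Set.ncard_le_ncard h1 (Set.toFinite _)
      rw [Set.ncard_singleton] at h2
      have h3 := T.three_le_valence u
      have h4 : {j | T.mark j = u} ⊆ T.side u w := by
        intro j hj
        have hj' : T.mark j = u := hj
        rw [side_eq, Set.mem_ofPred_eq, hj']
        exact self_mem_branch
      have h5 := Set.ncard_le_ncard h4 (Set.toFinite _)
      omega

variable (i : Fin n)

open Classical in
/-- The clusters of a tree: the sets of ends on the branches that do not contain the `i`-th end. -/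
def clusters : Finset (Finset (Others i)) :=
  Finset.univ.filter fun K => ∃ u w, T.graph.Adj u w ∧ T.mark i ∉ branch T.graph u w ∧
    ∀ a : Others i, a ∈ K ↔ T.mark a ∈ branch T.graph u w

variable {T i}

theorem mem_clusters {K : Finset (Others i)} :
    K ∈ T.clusters i ↔ ∃ u w, T.graph.Adj u w ∧ T.mark i ∉ branch T.graph u w ∧
      ∀ a : Others i, a ∈ K ↔ T.mark a ∈ branch T.graph u w := by
  simp [clusters]

theorem side_eq_image {u w : Fin T.size} (hi : T.mark i ∉ branch T.graph u w)
    {K : Finset (Others i)} (hK : ∀ a : Others i, a ∈ K ↔ T.mark a ∈ branch T.graph u w) :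
    T.side u w = Subtype.val '' (K : Set (Others i)) := by
  ext j
  rw [side_eq, Set.mem_ofPred_eq]
  constructor
  · intro hj
    have hji : j ≠ i := fun h => hi (h ▸ hj)
    exact ⟨⟨j, hji⟩, Finset.mem_coe.2 ((hK ⟨j, hji⟩).2 hj), rfl⟩
  · rintro ⟨a, ha, rfl⟩
    exact (hK a).1 (Finset.mem_coe.1 ha)

theorem side_compl {u w : Fin T.size} (h : T.graph.Adj u w) : (T.side u w)ᶜ = T.side w u := by
  ext j
  rw [side_eq, side_eq, Set.mem_compl_iff, Set.mem_ofPred_eq, Set.mem_ofPred_eq,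
    mem_branch_iff T.isTree h]

theorem isLaminar_clusters : IsLaminar (T.clusters i) := by
  refine ⟨fun K hK => ?_, fun K hK => ?_, fun K hK M hM => ?_⟩
  · obtain ⟨u, w, h, hi, hKm⟩ := mem_clusters.1 hK
    rw [← ncard_image, ← side_eq_image hi hKm]
    exact T.two_le_ncard_side h
  · obtain ⟨u, w, h, hi, hKm⟩ := mem_clusters.1 hK
    rw [← compl_ncard_image, ← side_eq_image hi hKm, side_compl h]
    exact T.two_le_ncard_side h.symm
  · obtain ⟨u, w, h, hi, hKm⟩ := mem_clusters.1 hK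
    obtain ⟨u', w', -, hi', hMm⟩ := mem_clusters.1 hM
    by_cases hd : Disjoint K M
    · exact Or.inr (Or.inr hd)
    obtain ⟨a, haK, haM⟩ := Finset.not_disjoint_iff.1 hd
    rcases branch_subset_or_subset T.isTree h hi hi' ((hKm a).1 haK) ((hMm a).1 haM) with hs | hs
    · exact Or.inl fun b hb => (hMm b).2 (hs ((hKm b).1 hb))
    · exact Or.inr (Or.inl fun b hb => (hKm b).2 (hs ((hMm b).1 hb)))

theorem exists_mem_clusters {u w : Fin T.size} (h : T.graph.Adj u w)
    (hi : T.mark i ∉ branch T.graph u w) :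
    ∃ K ∈ T.clusters i, T.side u w = Subtype.val '' (K : Set (Others i)) := by
  classical
  have hK : ∀ a : Others i, a ∈ (Finset.univ.filter fun a : Others i =>
      T.mark a ∈ branch T.graph u w) ↔ T.mark a ∈ branch T.graph u w := by simp
  exact ⟨_, mem_clusters.2 ⟨u, w, h, hi, hK⟩, side_eq_image hi hK⟩

theorem cone_eq_clusterCone : T.cone = clusterCone (T.clusters i) := by
  unfold cone clusterCone
  congr 1
  ext x
  constructor
  · rintro ⟨u, w, h, rfl⟩
    by_cases hi : T.mark i ∈ branch T.graph u w
    · obtain ⟨K, hK, hs⟩ := exists_mem_clusters h.symm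
        (fun h1 => (mem_branch_iff T.isTree h).1 h1 hi)
      refine ⟨K, hK, ?_⟩
      rw [clusterVec, ← hs, ← side_compl h, splitVec_compl]
    · obtain ⟨K, hK, hs⟩ := exists_mem_clusters h hi
      exact ⟨K, hK, by rw [clusterVec, ← hs]⟩
  · rintro ⟨K, hK, rfl⟩
    obtain ⟨u, w, h, hi, hKm⟩ := mem_clusters.1 (Finset.mem_coe.1 hK)
    exact ⟨u, w, h, by rw [clusterVec, side_eq_image hi hKm]⟩

/-- If the `i`-th end is at a vertex of valence at least four, there are three other ends in
different branches at this vertex. -/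
theorem hasThreeBranches_clusters (hT : 4 ≤ T.valence (T.mark i)) :
    HasThreeBranches (T.clusters i) := by
  classical
  set r := T.mark i with hr
  -- An end in the branch of every neighbour of the vertex.
  have hend : ∀ x, T.graph.Adj r x → ∃ a : Others i, T.mark a ∈ branch T.graph x r := by
    intro x hx
    have h1 := T.two_le_ncard_side hx.symm
    obtain ⟨j, hj⟩ := Set.nonempty_of_ncard_ne_zero (by omega : (T.side x r).ncard ≠ 0)
    refine ⟨⟨j, ?_⟩, hj⟩
    rintro rfl
    exact notMem_branch T.isTree.isAcyclic hx.symm hj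
  have : Nonempty (Others i) := by
    by_contra hne
    have h1 : T.graph.neighborSet r = ∅ :=
      Set.eq_empty_of_forall_notMem fun x hx => hne ⟨(hend x hx).choose⟩
    have h2 : {j | T.mark j = r} ⊆ {i} := fun j _ => by
      by_contra hj
      exact hne ⟨⟨j, hj⟩⟩
    have h3 := Set.ncard_le_ncard h2 (Set.toFinite _)
    rw [valence, h1, Set.ncard_empty] at hT
    rw [Set.ncard_singleton] at h3
    omega
  choose! b hb using hend
  -- Different branches are disjoint.
  have hdisj : ∀ x x' y, T.graph.Adj r x → T.graph.Adj r x' → y ∈ branch T.graph x r →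
      y ∈ branch T.graph x' r → x = x' := by
    intro x x' y hx hx' hy hy'
    by_contra hne
    have hr' : r ∉ branch T.graph x' r := notMem_branch T.isTree.isAcyclic hx'.symm
    have h1 := branch_subset (fun h => hr' h.2) hy' hy self_mem_branch
    refine notMem_branch T.isTree.isAcyclic hx.symm (mem_branch_of_adj h1 hx'.symm ?_)
    rw [Ne, Sym2.eq_iff]
    rintro (⟨h2, -⟩ | ⟨-, h2⟩)
    · exact hne h2.symm
    · exact hx.ne h2
  let Q₁ : Finset (Others i) := (Finset.univ.filter fun x => T.graph.Adj r x).image b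
  let Q₂ : Finset (Others i) := Finset.univ.filter fun a => T.mark a = r
  have hQ₂r : ∀ a ∈ Q₂, T.mark a = r := fun a ha => (Finset.mem_filter.1 ha).2
  have hQ₁ : Q₁.card = (T.graph.neighborSet r).ncard := by
    rw [Finset.card_image_of_injOn, ← Set.ncard_coe_finset]
    · congr 1
      ext x
      simp
    · intro x hx x' hx' h
      simp only [Finset.coe_filter, Finset.mem_univ, true_and, Set.mem_ofPred_eq] at hx hx'
      exact hdisj x x' _ hx hx' (hb x hx) (h ▸ hb x' hx')
  have hQ₂ : Q₂.card + 1 = {j | T.mark j = r}.ncard := by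
    have h1 : {j | T.mark j = r} = insert i (Subtype.val '' (Q₂ : Set (Others i))) := by
      ext j
      simp only [Set.mem_ofPred_eq, Set.mem_insert_iff]
      constructor
      · intro hj
        by_cases hji : j = i
        · exact Or.inl hji
        · exact Or.inr ⟨⟨j, hji⟩, Finset.mem_coe.2 (Finset.mem_filter.2 ⟨Finset.mem_univ _, hj⟩),
            rfl⟩
      · rintro (rfl | ⟨a, ha, rfl⟩)
        · rfl
        · exact hQ₂r a (Finset.mem_coe.1 ha)
    rw [h1, Set.ncard_insert_of_notMem base_notMem_image (Set.toFinite _), ncard_image]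
  have hdis : Disjoint Q₁ Q₂ := by
    rw [Finset.disjoint_left]
    intro a ha ha'
    obtain ⟨x, hx, rfl⟩ := Finset.mem_image.1 ha
    have hx' := (Finset.mem_filter.1 hx).2
    have h1 := hb x hx'
    rw [hQ₂r _ ha'] at h1
    exact notMem_branch T.isTree.isAcyclic hx'.symm h1
  refine ⟨Q₁ ∪ Q₂, ?_, ?_⟩
  · rw [Finset.card_union_of_disjoint hdis]
    unfold valence at hT
    omega
  · intro a ha a' ha' hne K hK haK haK'
    obtain ⟨u, w, h, hi, hKm⟩ := mem_clusters.1 hK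
    have haB := (hKm a).1 haK
    have haB' := (hKm a').1 haK'
    have hcase : ∀ c ∈ Q₁ ∪ Q₂, T.mark c ∈ branch T.graph u w →
        ∃ x, T.graph.Adj r x ∧ c = b x := by
      intro c hc hcB
      rcases Finset.mem_union.1 hc with hc | hc
      · obtain ⟨x, hx, rfl⟩ := Finset.mem_image.1 hc
        exact ⟨x, (Finset.mem_filter.1 hx).2, rfl⟩
      · rw [hQ₂r c hc] at hcB
        exact absurd hcB hi
    obtain ⟨x, hx, rfl⟩ := hcase a ha haB
    obtain ⟨x', hx', rfl⟩ := hcase a' ha' haB'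
    have hsub := branch_subset (u' := x) (w' := r) (fun h => hi h.2) haB (hb x hx)
    have := hdisj x x' _ hx hx' (hsub haB') (hb x' hx')
    exact hne (by rw [this])

end CombType

/-! ### The tree of a laminar family -/

section TreeOfClusters

variable {n : ℕ}

/-- A tree with marked ends on an arbitrary finite type of vertices gives a combinatorial type. -/
theorem exists_combType {W : Type*} [Fintype W] {G : SimpleGraph W} (hG : G.IsTree)
    (mark : Fin n → W)
    (h3 : ∀ u, 3 ≤ (G.neighborSet u).ncard + {j | mark j = u}.ncard) :
    ∃ T : CombType n,
      T.cone = PointedCone.hull ℝ {x | ∃ u w, G.Adj u w ∧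
        x = splitVec {j | mark j ∈ branch G u w}} ∧
      ∀ j, T.valence (T.mark j) =
        (G.neighborSet (mark j)).ncard + {k | mark k = mark j}.ncard := by
  let e := (Fintype.equivFin W).symm
  let G' : SimpleGraph (Fin (Fintype.card W)) := G.comap e
  let φ : G' ≃g G := SimpleGraph.Iso.comap e G
  have hnb : ∀ u, (G'.neighborSet u).ncard = (G.neighborSet (e u)).ncard := by
    intro u
    have : G.neighborSet (e u) = e '' G'.neighborSet u := by
      ext x
      constructor
      · intro hx
        exact ⟨e.symm x, by simpa [G'] using hx, by simp⟩
      · rintro ⟨y, hy, rfl⟩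
        exact hy
    rw [this, Set.ncard_image_of_injective _ e.injective]
  have hends : ∀ u, {j | e.symm (mark j) = u} = {j | mark j = e u} := by
    intro u
    ext j
    exact Equiv.symm_apply_eq e
  have hbranch : ∀ u w x, x ∈ branch G' u w ↔ e x ∈ branch G (e u) (e w) := by
    intro u w x
    have hdel : G'.deleteEdges {s(u, w)} = (G.deleteEdges {s(e u, e w)}).comap e := by
      ext a b
      simp [G', SimpleGraph.deleteEdges_adj]
    unfold branch
    rw [Set.mem_ofPred_eq, Set.mem_ofPred_eq, hdel]
    exact (SimpleGraph.Iso.reachable_iff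
      (φ := SimpleGraph.Iso.comap e (G.deleteEdges {s(e u, e w)}))).symm
  let T : CombType n :=
    { size := Fintype.card W
      graph := G'
      isTree := φ.isTree_iff.2 hG
      mark := fun j => e.symm (mark j)
      three_le_valence := fun u => by
        rw [hnb, hends]
        exact h3 (e u) }
  refine ⟨T, ?_, fun j => ?_⟩
  · unfold CombType.cone
    congr 1
    ext x
    have hside : ∀ u w, T.side u w = {j | mark j ∈ branch G (e u) (e w)} := by
      intro u w
      ext j
      rw [CombType.side_eq, Set.mem_ofPred_eq, Set.mem_ofPred_eq]
      change e.symm (mark j) ∈ branch G' u w ↔ _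
      rw [hbranch, Equiv.apply_symm_apply]
    constructor
    · rintro ⟨u, w, h, rfl⟩
      exact ⟨e u, e w, h, by rw [hside]⟩
    · rintro ⟨u, w, h, rfl⟩
      refine ⟨e.symm u, e.symm w, by simpa [T, G'] using h, ?_⟩
      rw [hside, Equiv.apply_symm_apply, Equiv.apply_symm_apply]
  · change (G'.neighborSet (e.symm (mark j))).ncard + {k | e.symm (mark k) = e.symm (mark j)}.ncard
      = _
    rw [hnb, hends, Equiv.apply_symm_apply]

end TreeOfClusters

section ClusterTree

variable {α : Type*} [Fintype α] [DecidableEq α] {F : Finset (Finset α)}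

/-- The vertices of the tree of a laminar family: its members and the whole set. -/
abbrev ClusterVertex (F : Finset (Finset α)) : Type _ := {K : Finset α // K ∈ insert Finset.univ F}

/-- `M` is the smallest vertex that properly contains `K`. -/
def IsParent (K M : ClusterVertex F) : Prop :=
  K.1 ⊂ M.1 ∧ ∀ N : ClusterVertex F, K.1 ⊂ N.1 → M.1 ⊆ N.1

variable (F) in
/-- The tree of a laminar family, in which every vertex is joined to its parent. -/
def clusterTree : SimpleGraph (ClusterVertex F) where
  Adj K M := IsParent K M ∨ IsParent M K
  symm := ⟨fun _ _ h => h.symm⟩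
  loopless := ⟨fun K h => by
    rcases h with h | h
    · exact h.1.ne rfl
    · exact h.1.ne rfl⟩

/-- The whole set as a vertex. -/
def topVertex : ClusterVertex F := ⟨Finset.univ, Finset.mem_insert_self _ _⟩

theorem IsParent.unique {K M M' : ClusterVertex F} (h : IsParent K M) (h' : IsParent K M') :
    M = M' :=
  Subtype.ext ((h.2 M' h'.1).antisymm (h'.2 M h.1))

namespace IsLaminar

theorem subset_or_subset (hF : IsLaminar F) {K M : ClusterVertex F} {a : α} (hK : a ∈ K.1)
    (hM : a ∈ M.1) : K.1 ⊆ M.1 ∨ M.1 ⊆ K.1 := by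
  rcases Finset.mem_insert.1 K.2 with h | h
  · exact Or.inr ((Finset.subset_univ _).trans h.ge)
  rcases Finset.mem_insert.1 M.2 with h' | h'
  · exact Or.inl ((Finset.subset_univ _).trans h'.ge)
  exact hF.nested h h' hK hM

/-- A nonempty set of vertices that all contain a given point has a least element. -/
theorem exists_least (hF : IsLaminar F) (p : ClusterVertex F → Prop) {a : α}
    (ha : ∀ N, p N → a ∈ N.1) (hp : ∃ N, p N) : ∃ M, p M ∧ ∀ N, p N → M.1 ⊆ N.1 := by
  classical
  obtain ⟨M, hM, hmin⟩ := Finset.exists_min_image (Finset.univ.filter p) (fun N => N.1.card)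
    (hp.imp fun N hN => Finset.mem_filter.2 ⟨Finset.mem_univ N, hN⟩)
  have hM' := (Finset.mem_filter.1 hM).2
  refine ⟨M, hM', fun N hN => ?_⟩
  rcases hF.subset_or_subset (ha M hM') (ha N hN) with h | h
  · exact h
  · exact (Finset.eq_of_subset_of_card_le h (hmin N (Finset.mem_filter.2 ⟨Finset.mem_univ _, hN⟩))).ge

theorem two_le_card_vertex (hF : IsLaminar F) (hα : 2 ≤ Fintype.card α) (K : ClusterVertex F) :
    2 ≤ K.1.card := by
  rcases Finset.mem_insert.1 K.2 with h | h
  · rw [h, Finset.card_univ]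
    exact hα
  · exact hF.two_le_card K.1 h

theorem exists_isParent (hF : IsLaminar F) (hα : 2 ≤ Fintype.card α) {K : ClusterVertex F}
    (hK : K ≠ topVertex) : ∃ M, IsParent K M := by
  obtain ⟨a, ha⟩ := Finset.card_pos.1 (show 0 < K.1.card by
    have := hF.two_le_card_vertex hα K
    omega)
  exact hF.exists_least (fun N => K.1 ⊂ N.1) (fun N hN => hN.1 ha)
    ⟨topVertex, Finset.ssubset_univ_iff.2 fun h => hK (Subtype.ext h)⟩

/-- Removing the edge from `K` to its parent separates the vertices contained in `K` from the
others. -/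
theorem mem_branch_clusterTree (hF : IsLaminar F) (hα : 2 ≤ Fintype.card α)
    {K P N : ClusterVertex F} (h : IsParent K P) :
    N ∈ branch (clusterTree F) K P ↔ N.1 ⊆ K.1 := by
  constructor
  · intro hN
    have hN' := (SimpleGraph.reachable_iff_reflTransGen K N).1 hN
    clear hN
    induction hN' with
    | refl => exact Finset.Subset.refl _
    | @tail a b _ hadj ih =>
      rw [SimpleGraph.deleteEdges_adj] at hadj
      obtain ⟨hab | hba, hne⟩ := hadj
      · rcases ih.eq_or_ssubset with he | hs
        · have ha : a = K := Subtype.ext he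
          subst ha
          exact absurd (by rw [hab.unique h]; rfl) hne
        · exact hab.2 K hs
      · exact hba.1.1.trans ih
  · induction hm : Fintype.card α - N.1.card using Nat.strong_induction_on generalizing N with
    | _ m ih =>
      intro hN
      rcases hN.eq_or_ssubset with he | hs
      · have hNK : N = K := Subtype.ext he
        rw [hNK]
        exact self_mem_branch
      · obtain ⟨M, hM⟩ := hF.exists_isParent hα (K := N) (fun he => by
          rw [he] at hs
          exact hs.2 (Finset.subset_univ _))
        have hlt := Finset.card_lt_card hM.1
        have hle := Finset.card_le_univ M.1
        refine mem_branch_of_adj (ih _ (by omega) rfl (hM.2 K hs)) (Or.inr hM) ?_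
        rw [Ne, Sym2.eq_iff]
        rintro (⟨-, rfl⟩ | ⟨-, rfl⟩)
        · exact h.1.2 hN
        · exact hs.ne rfl

theorem isTree_clusterTree (hF : IsLaminar F) (hα : 2 ≤ Fintype.card α) :
    (clusterTree F).IsTree := by
  have htop : ∀ N : ClusterVertex F, (clusterTree F).Reachable N topVertex := by
    intro N
    induction hm : Fintype.card α - N.1.card using Nat.strong_induction_on generalizing N with
    | _ m ih =>
      by_cases hN : N = topVertex
      · rw [hN]
      · obtain ⟨M, hM⟩ := hF.exists_isParent hα hN
        have hlt := Finset.card_lt_card hM.1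
        have hle := Finset.card_le_univ M.1
        exact (SimpleGraph.Adj.reachable (Or.inl hM)).trans (ih _ (by omega) M rfl)
  have : Nonempty (ClusterVertex F) := ⟨topVertex⟩
  refine ⟨⟨fun K M => (htop K).trans (htop M).symm⟩, ?_⟩
  rw [SimpleGraph.isAcyclic_iff_forall_adj_isBridge]
  intro K M h
  rw [SimpleGraph.isBridge_iff]
  rcases h with h | h
  · exact fun hr => h.1.2 ((hF.mem_branch_clusterTree hα h).1 hr)
  · intro hr
    rw [Sym2.eq_swap] at hr
    exact h.1.2 ((hF.mem_branch_clusterTree hα h).1 hr.symm)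

theorem exists_vertexOf (hF : IsLaminar F) (a : α) :
    ∃ M : ClusterVertex F, a ∈ M.1 ∧ ∀ N : ClusterVertex F, a ∈ N.1 → M.1 ⊆ N.1 :=
  hF.exists_least (fun N => a ∈ N.1) (fun _ h => h) ⟨topVertex, Finset.mem_univ a⟩

/-- The smallest vertex that contains `a`. -/
def vertexOf (hF : IsLaminar F) (a : α) : ClusterVertex F := (hF.exists_vertexOf a).choose

theorem mem_vertexOf (hF : IsLaminar F) (a : α) : a ∈ (hF.vertexOf a).1 :=
  (hF.exists_vertexOf a).choose_spec.1

theorem vertexOf_subset_iff (hF : IsLaminar F) {a : α} {N : ClusterVertex F} :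
    (hF.vertexOf a).1 ⊆ N.1 ↔ a ∈ N.1 :=
  ⟨fun h => h (hF.mem_vertexOf a), fun h => (hF.exists_vertexOf a).choose_spec.2 N h⟩

/-- A vertex `K` has at least as many children and points as there are elements of `K` no two of
which lie in a smaller vertex. -/
theorem card_le_children_add_points (hF : IsLaminar F) {K : ClusterVertex F} {Q : Finset α}
    (hQK : Q ⊆ K.1)
    (hQ : ∀ a ∈ Q, ∀ b ∈ Q, a ≠ b → ∀ N : ClusterVertex F, a ∈ N.1 → b ∈ N.1 → K.1 ⊆ N.1) :
    Q.card ≤ {M | IsParent M K}.ncard + {a | hF.vertexOf a = K}.ncard := by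
  classical
  have hchild : ∀ a : {a // a ∈ Q.filter fun a => hF.vertexOf a ≠ K},
      ∃ M : ClusterVertex F, a.1 ∈ M.1 ∧ IsParent M K := by
    rintro ⟨a, ha⟩
    obtain ⟨haQ, hne⟩ := Finset.mem_filter.1 ha
    have hs : (hF.vertexOf a).1 ⊂ K.1 := by
      refine (hF.vertexOf_subset_iff.2 (hQK haQ)).ssubset_of_ne fun h => hne (Subtype.ext h)
    -- The child containing `a` is the largest smaller vertex containing `a`.
    obtain ⟨M, hM, hmax⟩ := Finset.exists_max_image
      (Finset.univ.filter fun N : ClusterVertex F => a ∈ N.1 ∧ N.1 ⊂ K.1) (fun N => N.1.card)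
      ⟨hF.vertexOf a, Finset.mem_filter.2 ⟨Finset.mem_univ _, hF.mem_vertexOf a, hs⟩⟩
    obtain ⟨haM, hMK⟩ := (Finset.mem_filter.1 hM).2
    refine ⟨M, haM, hMK, fun N hN => ?_⟩
    rcases hF.subset_or_subset (hQK haQ) (hN.1 haM) with h | h
    · exact h
    · rcases h.eq_or_ssubset with he | hs'
      · exact he.ge
      · have := hmax N (Finset.mem_filter.2 ⟨Finset.mem_univ _, hN.1 haM, hs'⟩)
        have := Finset.card_lt_card hN
        omega
  choose c hc hcK using hchild
  have h1 : (Q.filter fun a => hF.vertexOf a ≠ K).card ≤ {M | IsParent M K}.ncard := by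
    have hinj : Function.Injective c := by
      intro a b hab
      by_contra hne
      have h := hQ a.1 (Finset.mem_filter.1 a.2).1 b.1 (Finset.mem_filter.1 b.2).1
        (fun h => hne (Subtype.ext h)) (c a) (hc a) (hab ▸ hc b)
      exact (hcK a).1.2 h
    have h2 : Set.range c ⊆ {M | IsParent M K} := by
      rintro _ ⟨a, rfl⟩
      exact hcK a
    have h3 := Set.ncard_le_ncard h2 (Set.toFinite _)
    rw [← Set.image_univ, Set.ncard_image_of_injective _ hinj, Set.ncard_univ,
      Nat.card_eq_fintype_card, Fintype.card_coe] at h3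
    exact h3
  have h2 : (Q.filter fun a => hF.vertexOf a = K).card ≤ {a | hF.vertexOf a = K}.ncard := by
    rw [← Set.ncard_coe_finset]
    refine Set.ncard_le_ncard (fun a ha => ?_) (Set.toFinite _)
    exact (Finset.mem_filter.1 (Finset.mem_coe.1 ha)).2
  have h3 := Finset.card_filter_add_card_filter_not (s := Q) (fun a => hF.vertexOf a = K)
  simp only [ne_eq] at h1
  omega

end IsLaminar

end ClusterTree

section TypeOfClusters

variable {n : ℕ} {i : Fin n} {F : Finset (Finset (Others i))}

/-- The vertex of the `j`-th end: the smallest vertex that contains it, and the whole set for the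
`i`-th end. -/
def IsLaminar.markOf (hF : IsLaminar F) (j : Fin n) : ClusterVertex F :=
  if h : j = i then topVertex else hF.vertexOf ⟨j, h⟩

theorem IsLaminar.markOf_self (hF : IsLaminar F) : hF.markOf i = topVertex := dif_pos rfl

theorem IsLaminar.markOf_val (hF : IsLaminar F) (a : Others i) :
    hF.markOf a.1 = hF.vertexOf a := dif_neg a.2

/-- In addition to its children and points, a vertex has a parent or carries the `i`-th end. -/
theorem IsLaminar.card_lt_valence (hF : IsLaminar F) (hα : 2 ≤ Fintype.card (Others i))
    {K : ClusterVertex F} {Q : Finset (Others i)} (hQK : Q ⊆ K.1)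
    (hQ : ∀ a ∈ Q, ∀ b ∈ Q, a ≠ b → ∀ N : ClusterVertex F, a ∈ N.1 → b ∈ N.1 → K.1 ⊆ N.1) :
    Q.card + 1 ≤ ((clusterTree F).neighborSet K).ncard + {j | hF.markOf j = K}.ncard := by
  have h0 := hF.card_le_children_add_points hQK hQ
  have hchild : {M | IsParent M K} ⊆ (clusterTree F).neighborSet K := fun M hM => Or.inr hM
  have hpts : Subtype.val '' {a : Others i | hF.vertexOf a = K} ⊆ {j | hF.markOf j = K} := by
    rintro _ ⟨a, ha, rfl⟩
    exact (hF.markOf_val a).trans ha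
  have hcard : (Subtype.val '' {a : Others i | hF.vertexOf a = K}).ncard =
      {a : Others i | hF.vertexOf a = K}.ncard :=
    Set.ncard_image_of_injective _ Subtype.val_injective
  by_cases hK : K = topVertex
  · -- The `i`-th end is at the vertex.
    have h1 := Set.ncard_le_ncard hchild (Set.toFinite _)
    have h2 : insert i (Subtype.val '' {a : Others i | hF.vertexOf a = K}) ⊆
        {j | hF.markOf j = K} :=
      Set.insert_subset (hF.markOf_self.trans hK.symm) hpts
    have h3 := Set.ncard_le_ncard h2 (Set.toFinite _)
    have h4 : i ∉ Subtype.val '' {a : Others i | hF.vertexOf a = K} := by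
      rintro ⟨a, -, ha⟩
      exact a.2 ha
    rw [Set.ncard_insert_of_notMem h4 (Set.toFinite _)] at h3
    omega
  · -- The vertex has a parent.
    obtain ⟨P, hP⟩ := hF.exists_isParent hα hK
    have h1 := Set.ncard_le_ncard hpts (Set.toFinite _)
    have h2 : insert P {M | IsParent M K} ⊆ (clusterTree F).neighborSet K :=
      Set.insert_subset (Or.inl hP) hchild
    have h3 := Set.ncard_le_ncard h2 (Set.toFinite _)
    have h4 : P ∉ {M | IsParent M K} := fun h => hP.1.2 h.1.1
    rw [Set.ncard_insert_of_notMem h4 (Set.toFinite _)] at h3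
    omega

/-- Every laminar family of sets of ends comes from a combinatorial type. -/
theorem IsLaminar.exists_combType (hF : IsLaminar F) (hα : 2 ≤ Fintype.card (Others i)) :
    ∃ T : CombType n, T.cone = clusterCone F ∧
      (HasThreeBranches F → 4 ≤ T.valence (T.mark i)) := by
  have htree := hF.isTree_clusterTree hα
  have h3 : ∀ K, 3 ≤ ((clusterTree F).neighborSet K).ncard + {j | hF.markOf j = K}.ncard := by
    intro K
    have hK2 := hF.two_le_card_vertex hα K
    obtain ⟨a, ha⟩ := Finset.card_pos.1 (show 0 < K.1.card by omega)
    -- No smaller vertex contains both `a` and `b`, so that these account for two of the ends or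
    -- edges at `K`.
    obtain ⟨b, hb, hab, hmin⟩ := hF.exists_partner hK2 a
    have hmin' : ∀ N : ClusterVertex F, a ∈ N.1 → b ∈ N.1 → K.1 ⊆ N.1 := by
      intro N haN hbN
      rcases Finset.mem_insert.1 N.2 with h | h
      · exact (Finset.subset_univ _).trans h.ge
      · exact hmin N.1 h haN hbN
    have h := hF.card_lt_valence hα (K := K) (Q := {a, b})
      (by
        intro x hx
        rcases Finset.mem_insert.1 hx with rfl | hx
        · exact ha
        · exact Finset.mem_singleton.1 hx ▸ hb)
      (by
        intro x hx y hy hxy N hxN hyN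
        simp only [Finset.mem_insert, Finset.mem_singleton] at hx hy
        rcases hx with rfl | rfl <;> rcases hy with rfl | rfl
        · exact absurd rfl hxy
        · exact hmin' N hxN hyN
        · exact hmin' N hyN hxN
        · exact absurd rfl hxy)
    rw [Finset.card_pair hab] at h
    exact h
  obtain ⟨T, hT, hval⟩ := TropicalModuli.exists_combType htree hF.markOf h3
  have hside : ∀ K P : ClusterVertex F, IsParent K P →
      {j | hF.markOf j ∈ branch (clusterTree F) K P} = Subtype.val '' (K.1 : Set (Others i)) := by
    intro K P h
    ext j
    rw [Set.mem_ofPred_eq, hF.mem_branch_clusterTree hα h]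
    by_cases hj : j = i
    · subst hj
      rw [hF.markOf_self]
      refine iff_of_false (fun hs => h.1.2 ((Finset.subset_univ _).trans hs)) base_notMem_image
    · rw [show j = (⟨j, hj⟩ : Others i).1 from rfl, hF.markOf_val, hF.vertexOf_subset_iff,
        val_mem_image]
  refine ⟨T, ?_, fun hr => ?_⟩
  · rw [hT]
    unfold clusterCone
    congr 1
    ext x
    constructor
    · rintro ⟨K, P, h | h, rfl⟩
      · refine ⟨K.1, ?_, by rw [clusterVec, ← hside K P h]⟩
        refine Finset.mem_coe.2 ((Finset.mem_insert.1 K.2).resolve_left fun he => ?_)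
        exact h.1.2 ((Finset.subset_univ _).trans he.ge)
      · refine ⟨P.1, ?_, ?_⟩
        · refine Finset.mem_coe.2 ((Finset.mem_insert.1 P.2).resolve_left fun he => ?_)
          exact h.1.2 ((Finset.subset_univ _).trans he.ge)
        · rw [clusterVec, ← hside P K h, ← splitVec_compl]
          congr 1
          ext j
          exact (mem_branch_iff htree (Or.inl h)).symm
    · rintro ⟨K, hK, rfl⟩
      have hK' := Finset.mem_coe.1 hK
      let K' : ClusterVertex F := ⟨K, Finset.mem_insert_of_mem hK'⟩
      obtain ⟨P, hP⟩ := hF.exists_isParent hα (K := K')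
        (fun he => hF.ne_univ K hK' (congrArg Subtype.val he))
      exact ⟨K', P, Or.inl hP, by rw [clusterVec, hside K' P hP]⟩
  · obtain ⟨Q, hQ3, hQ⟩ := hr
    have h := hF.card_lt_valence hα (K := topVertex) (Q := Q) (Finset.subset_univ _)
      (by
        intro a ha b hb hab N haN hbN
        rcases Finset.mem_insert.1 N.2 with he | hN
        · rw [he]
          exact Finset.subset_univ _
        · exact absurd hbN (hQ a ha b hb hab N.1 hN haN))
    rw [hval, hF.markOf_self]
    omega

theorem card_others (i : Fin n) : Fintype.card (Others i) + 1 = n := by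
  have h := Fintype.card_subtype_compl (fun j : Fin n => j = i)
  have hn := i.pos
  rw [Fintype.card_fin, Fintype.card_subtype_eq] at h
  change Fintype.card {j : Fin n // ¬ j = i} + 1 = n
  omega

/-- The cones of the moduli space are those of the laminar families of sets of ends. -/
theorem mem_moduliCones (i : Fin n) (hn : 3 ≤ n) {σ : PointedCone ℝ (Ambient n)} :
    σ ∈ moduliCones n ↔ ∃ F : Finset (Finset (Others i)), IsLaminar F ∧ σ = clusterCone F := by
  constructor
  · rintro ⟨T, rfl⟩
    exact ⟨T.clusters i, CombType.isLaminar_clusters, CombType.cone_eq_clusterCone⟩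
  · rintro ⟨F, hF, rfl⟩
    have := card_others i
    obtain ⟨T, hT, -⟩ := hF.exists_combType (by omega)
    exact ⟨T, hT.symm⟩

/-- The cones of the Psi-class are those of the laminar families with three branches at the root. -/
theorem mem_psiClass (hn : 3 ≤ n) {σ : PointedCone ℝ (Ambient n)} :
    σ ∈ (psiClass n i).cones ↔
      ∃ F : Finset (Finset (Others i)), IsLaminar F ∧ HasThreeBranches F ∧ σ = clusterCone F := by
  constructor
  · rintro ⟨T, hT, rfl⟩
    exact ⟨T.clusters i, CombType.isLaminar_clusters, CombType.hasThreeBranches_clusters hT,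
      CombType.cone_eq_clusterCone⟩
  · rintro ⟨F, hF, hr, rfl⟩
    have := card_others i
    obtain ⟨T, hT, hval⟩ := hF.exists_combType (by omega)
    exact ⟨T, hval hr, hT.symm⟩

end TypeOfClusters

/-! ### The balancing relation -/

section LocalStructure

namespace IsLocalModel

variable {α : Type*} [Fintype α] [DecidableEq α] {F : Finset (Finset α)} {Q : Finset α}
  {B : α → Finset α} {u w x y : α}

theorem mem_iff (h : IsLocalModel F Q B) (hx : x ∈ Q) (hu : u ∈ Q) : x ∈ B u ↔ x = u := by
  refine ⟨fun hm => ?_, fun he => he ▸ h.self_mem x hx⟩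
  by_contra hne
  exact Finset.disjoint_left.1 (h.disjoint x hx u hu hne) (h.self_mem x hx) hm

theorem mem_union_iff (h : IsLocalModel F Q B) (hx : x ∈ Q) (hu : u ∈ Q) (hw : w ∈ Q) :
    x ∈ B u ∪ B w ↔ x = u ∨ x = w := by
  rw [Finset.mem_union, h.mem_iff hx hu, h.mem_iff hx hw]

/-- A union of two branches determines the pair of branches. -/
theorem union_eq_iff (h : IsLocalModel F Q B) (hx : x ∈ Q) (hy : y ∈ Q) (hxy : x ≠ y)
    (hu : u ∈ Q) (hw : w ∈ Q) :
    B u ∪ B w = B x ∪ B y ↔ (u = x ∧ w = y) ∨ (u = y ∧ w = x) := by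
  constructor
  · intro he
    have h1 : x ∈ B u ∪ B w := by
      rw [he, h.mem_union_iff hx hx hy]
      exact Or.inl rfl
    have h2 : y ∈ B u ∪ B w := by
      rw [he, h.mem_union_iff hy hx hy]
      exact Or.inr rfl
    rw [h.mem_union_iff hx hu hw] at h1
    rw [h.mem_union_iff hy hu hw] at h2
    rcases h1 with rfl | rfl <;> rcases h2 with rfl | rfl
    · exact absurd rfl hxy
    · exact Or.inl ⟨rfl, rfl⟩
    · exact Or.inr ⟨rfl, rfl⟩
    · exact absurd rfl hxy
  · rintro (⟨rfl, rfl⟩ | ⟨rfl, rfl⟩)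
    · rfl
    · exact Finset.union_comm _ _

end IsLocalModel

end LocalStructure

section BalancingRelation

variable {n : ℕ} {i : Fin n}

open Classical in
/-- The distance of two ends as a polynomial in the indicators of the set `J`, written as sums over
`J`. -/
theorem splitDist_image (J : Finset (Others i)) (p : Pairs n) :
    splitDist (Subtype.val '' (J : Set (Others i))) p =
      (∑ a ∈ J, if (a : Fin n) = p.1.1 then (1 : ℝ) else 0) +
      (∑ a ∈ J, if (a : Fin n) = p.1.2 then (1 : ℝ) else 0) -
      2 * (∑ a ∈ J, if (a : Fin n) = p.1.1 then (1 : ℝ) else 0) *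
      (∑ a ∈ J, if (a : Fin n) = p.1.2 then (1 : ℝ) else 0) := by
  have key : ∀ s : Fin n, (∑ a ∈ J, if (a : Fin n) = s then (1 : ℝ) else 0) =
      if s ∈ Subtype.val '' (J : Set (Others i)) then 1 else 0 := by
    intro s
    split_ifs with hs
    · obtain ⟨a, ha, rfl⟩ := hs
      rw [Finset.sum_eq_single_of_mem a (Finset.mem_coe.1 ha), if_pos rfl]
      exact fun b _ hb => if_neg fun h => hb (Subtype.ext h)
    · exact Finset.sum_eq_zero fun a ha => if_neg fun h => hs ⟨a, Finset.mem_coe.2 ha, h⟩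
  rw [key, key, splitDist]
  by_cases h1 : p.1.1 ∈ Subtype.val '' (J : Set (Others i)) <;>
    by_cases h2 : p.1.2 ∈ Subtype.val '' (J : Set (Others i)) <;>
    simp only [h1, h2, if_true, if_false, iff_true, iff_false, not_true] <;>
    norm_num

theorem sum_offDiag_eq {ι M : Type*} [DecidableEq ι] [AddCommGroup M] (Q : Finset ι)
    (f : ι → ι → M) :
    ∑ p ∈ Q.offDiag, f p.1 p.2 = (∑ x ∈ Q, ∑ y ∈ Q, f x y) - ∑ x ∈ Q, f x x := by
  rw [eq_sub_iff_add_eq', ← Finset.sum_product', ← Finset.diag_union_offDiag,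
    Finset.sum_union (Finset.disjoint_diag_offDiag Q), Finset.sum_diag]

/-- The relation behind the balancing condition: for disjoint sets `B x`, `x ∈ Q`, the vectors of
the unions of two of them add up to a combination of the vectors of the sets themselves and the
vector of their union. It holds for the vectors of distances, since the distance of `s` and `t` in
the split `I` is the polynomial `1_I(s) + 1_I(t) - 2 * 1_I(s) * 1_I(t)` in the indicators. -/
theorem sum_offDiag_clusterVec {Q : Finset (Others i)} {B : Others i → Finset (Others i)}
    (hB : ∀ x ∈ Q, ∀ y ∈ Q, x ≠ y → Disjoint (B x) (B y)) :
    ∑ p ∈ Q.offDiag, clusterVec (B p.1 ∪ B p.2) =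
      (2 : ℝ) • clusterVec (Q.biUnion B) +
        (2 * ((Q.card : ℝ) - 2)) • ∑ x ∈ Q, clusterVec (B x) := by
  classical
  have hdist : ∑ p ∈ Q.offDiag,
      splitDist (Subtype.val '' ((B p.1 ∪ B p.2 : Finset (Others i)) : Set (Others i))) =
      (2 : ℝ) • splitDist (Subtype.val '' (Q.biUnion B : Set (Others i))) +
        (2 * ((Q.card : ℝ) - 2)) • ∑ x ∈ Q, splitDist (Subtype.val '' (B x : Set (Others i))) := by
    funext p
    simp only [Finset.sum_apply, Pi.add_apply, Pi.smul_apply, smul_eq_mul]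
    simp only [splitDist_image]
    rw [Finset.sum_biUnion hB, Finset.sum_biUnion hB]
    set b : Others i → ℝ := fun x => ∑ a ∈ B x, if (a : Fin n) = p.1.1 then (1 : ℝ) else 0
    set c : Others i → ℝ := fun x => ∑ a ∈ B x, if (a : Fin n) = p.1.2 then (1 : ℝ) else 0
    have h1 : ∀ q ∈ Q.offDiag,
        (∑ a ∈ B q.1 ∪ B q.2, if (a : Fin n) = p.1.1 then (1 : ℝ) else 0) +
        (∑ a ∈ B q.1 ∪ B q.2, if (a : Fin n) = p.1.2 then (1 : ℝ) else 0) -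
        2 * (∑ a ∈ B q.1 ∪ B q.2, if (a : Fin n) = p.1.1 then (1 : ℝ) else 0) *
        (∑ a ∈ B q.1 ∪ B q.2, if (a : Fin n) = p.1.2 then (1 : ℝ) else 0) =
        (b q.1 + b q.2) + (c q.1 + c q.2) - 2 * (b q.1 + b q.2) * (c q.1 + c q.2) := by
      intro q hq
      obtain ⟨h1, h2, h3⟩ := Finset.mem_offDiag.1 hq
      rw [Finset.sum_union (hB _ h1 _ h2 h3), Finset.sum_union (hB _ h1 _ h2 h3)]
    rw [Finset.sum_congr rfl h1, sum_offDiag_eq Q fun x y =>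
      (b x + b y) + (c x + c y) - 2 * (b x + b y) * (c x + c y)]
    obtain ⟨e, he⟩ : ∃ e : Others i → ℝ, ∀ x, e x = b x * c x := ⟨_, fun _ => rfl⟩
    have h2 : ∀ x y, (b x + b y) + (c x + c y) - 2 * (b x + b y) * (c x + c y) =
        (b x + c x - 2 * e x) + (b y + c y - 2 * e y) - 2 * (b x * c y) - 2 * (c x * b y) :=
      fun x y => by
        rw [he, he]
        ring
    have h3 : ∀ x, (b x + b x) + (c x + c x) - 2 * (b x + b x) * (c x + c x) =
        2 * b x + 2 * c x - 8 * e x := fun x => by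
      rw [he]
      ring
    have h4 : ∀ x, b x + c x - 2 * b x * c x = b x + c x - 2 * e x := fun x => by
      rw [he]
      ring
    simp only [h3]
    simp only [h2]
    change _ = 2 * (∑ x ∈ Q, b x + ∑ x ∈ Q, c x - 2 * (∑ x ∈ Q, b x) * ∑ x ∈ Q, c x) +
      2 * ((Q.card : ℝ) - 2) * ∑ x ∈ Q, (b x + c x - 2 * b x * c x)
    simp only [h4, Finset.sum_add_distrib, Finset.sum_sub_distrib, ← Finset.mul_sum,
      ← Finset.sum_mul, Finset.sum_const, nsmul_eq_mul]
    ring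
  have h := congrArg (LinearMap.range (phi n)).mkQ hdist
  simp only [map_sum, map_add, map_smul] at h
  exact h

/-- The split of a single end is the image of a basis vector under `phi`. -/
theorem clusterVec_singleton (a : Others i) : clusterVec {a} = 0 := by
  classical
  rw [clusterVec, splitVec, Submodule.mkQ_apply, Submodule.Quotient.mk_eq_zero]
  refine ⟨Pi.single a.1 1, ?_⟩
  funext p
  change (Pi.single a.1 1 : Fin n → ℝ) p.1.1 + (Pi.single a.1 1 : Fin n → ℝ) p.1.2 = _
  rw [splitDist_image, Finset.sum_singleton, Finset.sum_singleton]
  simp only [Pi.single_apply, eq_comm (a := a.1)]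
  have := p.2.ne
  split_ifs with h1 h2
  · exact absurd (h1.trans h2.symm) this
  all_goals norm_num

/-- The split of all ends but the `i`-th is that of the single end `i`. -/
theorem clusterVec_univ : clusterVec (Finset.univ : Finset (Others i)) = 0 := by
  classical
  have h : (Subtype.val '' ((Finset.univ : Finset (Others i)) : Set (Others i))) = {i}ᶜ := by
    ext j
    simp
  rw [clusterVec, h, splitVec_compl, splitVec, Submodule.mkQ_apply, Submodule.Quotient.mk_eq_zero]
  refine ⟨Pi.single i 1, ?_⟩
  funext p
  change (Pi.single i 1 : Fin n → ℝ) p.1.1 + (Pi.single i 1 : Fin n → ℝ) p.1.2 = _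
  simp only [Pi.single_apply, splitDist, Set.mem_singleton_iff]
  have := p.2.ne
  by_cases h1 : p.1.1 = i <;> by_cases h2 : p.1.2 = i
  · exact absurd (h1.trans h2.symm) this
  all_goals simp [h1, h2]

end BalancingRelation

/-! ### The Psi-class -/

section PsiClass

variable {n : ℕ} {i : Fin n} {F : Finset (Finset (Others i))}

theorem clusterVec_mem_linearSpan {K : Finset (Others i)} (hK : K ∈ F) :
    clusterVec K ∈ linearSpan (clusterCone F) :=
  mem_linearSpan (Submodule.subset_span ⟨K, hK, rfl⟩)

theorem exists_subset_of_isFaceOf_clusterCone {τ : PointedCone ℝ (Ambient n)}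
    (h : τ.IsFaceOf (clusterCone F)) : ∃ F' ⊆ F, τ = clusterCone F' :=
  exists_subset_of_isFaceOf_hull h

theorem isPureOfDim_moduliCones (i : Fin n) (hn : 3 ≤ n) :
    IsPureOfDim (n - 3) (moduliCones n) := by
  have hα := card_others i
  intro σ hσ
  obtain ⟨F, hF, rfl⟩ := (mem_moduliCones i hn).1 hσ
  have h1 := hF.card_add_two_le (by omega)
  obtain ⟨F', hsub, hF', hc⟩ := hF.exists_superset (by omega)
  refine ⟨by rw [hF.dim_clusterCone]; omega, clusterCone F', (mem_moduliCones i hn).2 ⟨F', hF', rfl⟩,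
    hF'.isFaceOf_clusterCone hsub, by rw [hF'.dim_clusterCone]; omega⟩

theorem isRationalFan_psiClass (hn : 3 ≤ n) :
    IsRationalFan (lattice n) (psiClass n i).cones := by
  refine ⟨?_, fun σ hσ => ?_, fun σ hσ τ hτ => ?_, fun σ hσ σ' hσ' => ?_⟩
  · refine (Set.finite_range fun F : Finset (Finset (Others i)) => clusterCone F).subset ?_
    intro σ hσ
    obtain ⟨F, -, -, rfl⟩ := (mem_psiClass hn).1 hσ
    exact ⟨F, rfl⟩
  · obtain ⟨F, hF, -, rfl⟩ := (mem_psiClass hn).1 hσ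
    exact hF.isRationalCone
  · obtain ⟨F, hF, hr, rfl⟩ := (mem_psiClass hn).1 hσ
    obtain ⟨F', hsub, rfl⟩ := exists_subset_of_isFaceOf_clusterCone hτ
    exact (mem_psiClass hn).2 ⟨F', hF.mono hsub, hr.mono hsub, rfl⟩
  · obtain ⟨F, hF, -, rfl⟩ := (mem_psiClass hn).1 hσ
    obtain ⟨F', hF', -, rfl⟩ := (mem_psiClass hn).1 hσ'
    rw [hF.inf_clusterCone hF']
    exact ⟨hF.isFaceOf_clusterCone Finset.inter_subset_left,
      hF'.isFaceOf_clusterCone Finset.inter_subset_right⟩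

theorem isPureOfDim_psiClass (hn : 3 ≤ n) : IsPureOfDim (n - 4) (psiClass n i).cones := by
  have hα := card_others i
  intro σ hσ
  obtain ⟨F, hF, hr, rfl⟩ := (mem_psiClass hn).1 hσ
  have h1 := hF.card_add_three_le hr
  obtain ⟨F', hsub, hF'⟩ := hF.exists_facetFamily hr
  have h2 := hF'.card_add_three
  exact ⟨by rw [hF.dim_clusterCone]; omega, clusterCone F',
    (mem_psiClass hn).2 ⟨F', hF'.isLaminar, hF'.hasThreeBranches, rfl⟩,
    hF'.isLaminar.isFaceOf_clusterCone hsub, by rw [hF'.isLaminar.dim_clusterCone]; omega⟩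

theorem nonempty_psiClass (hn : 4 ≤ n) : (psiClass n i).cones.Nonempty := by
  refine ⟨_, (mem_psiClass (by omega)).2 ⟨∅, ⟨?_, ?_, ?_⟩, ⟨Finset.univ, ?_, ?_⟩, rfl⟩⟩
  · simp
  · simp
  · simp
  · have := card_others i
    rw [Finset.card_univ]
    omega
  · intro x _ y _ _ K hK
    simp at hK

theorem isConnectedInCodimOne_psiClass (hn : 4 ≤ n) :
    IsConnectedInCodimOne (n - 4) (psiClass n i).cones := by
  have hα := card_others i
  intro σ hσ σ' hσ' hd hd'
  obtain ⟨F, hF, hr, rfl⟩ := (mem_psiClass (by omega)).1 hσ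
  obtain ⟨F', hF', hr', rfl⟩ := (mem_psiClass (by omega)).1 hσ'
  rw [hF.dim_clusterCone] at hd
  rw [hF'.dim_clusterCone] at hd'
  have hfacet : IsFacetFamily F := ⟨hF, hr, by omega⟩
  have hfacet' : IsFacetFamily F' := ⟨hF', hr', by omega⟩
  have key : ∀ M, Relation.ReflTransGen IsAdjacent F M → IsFacetFamily M ∧
      Relation.ReflTransGen (fun ρ ρ' => ρ' ∈ (psiClass n i).cones ∧ dim ρ' = n - 4 ∧
        dim (ρ ⊓ ρ') + 1 = n - 4) (clusterCone F) (clusterCone M) := by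
    intro M hM
    induction hM with
    | refl => exact ⟨hfacet, Relation.ReflTransGen.refl⟩
    | @tail b c _ hbc ih =>
      obtain ⟨hc, hbc⟩ := hbc
      obtain ⟨hb, ih⟩ := ih
      refine ⟨hc, ih.tail ⟨(mem_psiClass (by omega)).2 ⟨c, hc.isLaminar, hc.hasThreeBranches, rfl⟩,
        ?_, ?_⟩⟩
      · have := hc.card_add_three
        rw [hc.isLaminar.dim_clusterCone]
        omega
      · have := hb.card_add_three
        rw [hb.isLaminar.inf_clusterCone hc.isLaminar,
          (hb.isLaminar.mono Finset.inter_subset_left).dim_clusterCone]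
        omega
  exact (key F' (hfacet.reflTransGen hfacet')).2

theorem mem_facetsAt_psiClass (hF : IsLaminar F) (hcard : F.card + 5 = n)
    {σ : PointedCone ℝ (Ambient n)} :
    σ ∈ facetsAt (n - 4) (psiClass n i).cones (clusterCone F) ↔
      ∃ K, (K ∉ F ∧ IsFacetFamily (insert K F)) ∧ σ = clusterCone (insert K F) := by
  have hα := card_others i
  constructor
  · rintro ⟨hσ, hd, hf⟩
    obtain ⟨F', hF', hr', rfl⟩ := (mem_psiClass (by omega)).1 hσ
    rw [hF'.dim_clusterCone] at hd
    obtain ⟨K, hK, rfl⟩ := Finset.exists_eq_insert_iff.2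
      ⟨hF.subset_of_clusterCone_le hF' hf.le, (by omega : F.card + 1 = F'.card)⟩
    exact ⟨K, ⟨hK, hF', hr', by omega⟩, rfl⟩
  · rintro ⟨K, ⟨hK, hfac⟩, rfl⟩
    refine ⟨(mem_psiClass (by omega)).2 ⟨_, hfac.isLaminar, hfac.hasThreeBranches, rfl⟩, ?_,
      hfac.isLaminar.isFaceOf_clusterCone (Finset.subset_insert _ _)⟩
    have := hfac.card_add_three
    rw [hfac.isLaminar.dim_clusterCone]
    omega

theorem clusterCone_insert_eq_iff {K K' : Finset (Others i)} (hK : K ∉ F)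
    (hF : IsLaminar (insert K F)) (hF' : IsLaminar (insert K' F)) :
    clusterCone (insert K F) = clusterCone (insert K' F) ↔ K = K' := by
  refine ⟨fun h => ?_, fun h => by rw [h]⟩
  have hm : K ∈ insert K' F := hF.clusterCone_injective hF' h ▸ Finset.mem_insert_self K F
  exact (Finset.mem_insert.1 hm).resolve_right hK

variable {Q : Finset (Others i)} {B : Others i → Finset (Others i)}

/-- The facets at a cone of codimension one in terms of the local model. -/
theorem IsLocalModel.mem_facetsAt (h : IsLocalModel F Q B) (hF : IsLaminar F)
    (hcard : F.card + 5 = n) {σ : PointedCone ℝ (Ambient n)} :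
    σ ∈ facetsAt (n - 4) (psiClass n i).cones (clusterCone F) ↔
      ∃ x ∈ Q, ∃ y ∈ Q, x ≠ y ∧ σ = clusterCone (insert (B x ∪ B y) F) := by
  rw [mem_facetsAt_psiClass hF hcard]
  constructor
  · rintro ⟨K, hK, rfl⟩
    obtain ⟨x, hx, y, hy, hxy, rfl⟩ := (h.facet_iff K).1 hK
    exact ⟨x, hx, y, hy, hxy, rfl⟩
  · rintro ⟨x, hx, y, hy, hxy, rfl⟩
    exact ⟨_, (h.facet_iff _).2 ⟨x, hx, y, hy, hxy, rfl⟩, rfl⟩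

theorem IsLocalModel.cone_eq_iff (h : IsLocalModel F Q B) {x y u w : Others i} (hx : x ∈ Q)
    (hy : y ∈ Q) (hxy : x ≠ y) (hu : u ∈ Q) (hw : w ∈ Q) (huw : u ≠ w) :
    clusterCone (insert (B u ∪ B w) F) = clusterCone (insert (B x ∪ B y) F) ↔
      (u = x ∧ w = y) ∨ (u = y ∧ w = x) := by
  obtain ⟨h1, h2⟩ := (h.facet_iff _).2 ⟨u, hu, w, hw, huw, rfl⟩
  obtain ⟨-, h3⟩ := (h.facet_iff _).2 ⟨x, hx, y, hy, hxy, rfl⟩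
  rw [clusterCone_insert_eq_iff h1 h2.isLaminar h3.isLaminar, h.union_eq_iff hx hy hxy hu hw]

/-- Summed over the facets, the normal vectors are combinations of the branches of the local model
and their union, each of which is a cluster of the cone or has the zero vector. -/
theorem isBalancedAt_psiClass (hF : IsLaminar F) (hr : HasThreeBranches F)
    (hcard : F.card + 5 = n) :
    IsBalancedAt (lattice n) (n - 4) (psiClass n i).cones (psiClass n i).weight
      (clusterCone F) := by
  classical
  have hα := card_others i
  obtain ⟨Q, B, h⟩ := hF.exists_isLocalModel hr (by omega)
  let v : PointedCone ℝ (Ambient n) → Ambient n := fun σ =>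
    if hσ : ∃ K, (K ∉ F ∧ IsFacetFamily (insert K F)) ∧ σ = clusterCone (insert K F) then
      clusterVec hσ.choose else 0
  have hv : ∀ K, K ∉ F → IsFacetFamily (insert K F) →
      v (clusterCone (insert K F)) = clusterVec K := by
    intro K hK hfac
    have hex : ∃ K', (K' ∉ F ∧ IsFacetFamily (insert K' F)) ∧
        clusterCone (insert K F) = clusterCone (insert K' F) := ⟨K, ⟨hK, hfac⟩, rfl⟩
    have he : K = hex.choose := (clusterCone_insert_eq_iff hK hfac.isLaminar
      hex.choose_spec.1.2.isLaminar).1 hex.choose_spec.2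
    change (if hσ : _ then _ else _) = _
    rw [dif_pos hex, ← he]
  refine ⟨v, fun σ hσ => ?_, ?_⟩
  · obtain ⟨K, ⟨hK, hfac⟩, rfl⟩ := (mem_facetsAt_psiClass hF hcard).1 hσ
    rw [hv K hK hfac]
    exact hfac.isLaminar.isPrimitiveNormal hK
  · -- Every facet arises from two ordered pairs of branches.
    let φ : Others i × Others i → PointedCone ℝ (Ambient n) := fun p =>
      clusterCone (insert (B p.1 ∪ B p.2) F)
    have hset : facetsAt (n - 4) (psiClass n i).cones (clusterCone F) =
        ((Q.offDiag.image φ : Finset _) : Set _) := by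
      ext σ
      rw [h.mem_facetsAt hF hcard, Finset.mem_coe, Finset.mem_image]
      constructor
      · rintro ⟨x, hx, y, hy, hxy, rfl⟩
        exact ⟨(x, y), Finset.mem_offDiag.2 ⟨hx, hy, hxy⟩, rfl⟩
      · rintro ⟨⟨x, y⟩, hp, rfl⟩
        obtain ⟨hx, hy, hxy⟩ := Finset.mem_offDiag.1 hp
        exact ⟨x, hx, y, hy, hxy, rfl⟩
    have hfib : ∀ σ ∈ Q.offDiag.image φ, (Q.offDiag.filter fun p => φ p = σ).card = 2 := by
      intro σ hσ
      obtain ⟨⟨x, y⟩, hp, rfl⟩ := Finset.mem_image.1 hσ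
      obtain ⟨hx, hy, hxy⟩ := Finset.mem_offDiag.1 hp
      have : (Q.offDiag.filter fun p => φ p = φ (x, y)) = {(x, y), (y, x)} := by
        ext ⟨u, w⟩
        rw [Finset.mem_filter, Finset.mem_offDiag, Finset.mem_insert, Finset.mem_singleton,
          Prod.mk.injEq, Prod.mk.injEq]
        constructor
        · rintro ⟨⟨hu, hw, huw⟩, he⟩
          exact (h.cone_eq_iff hx hy hxy hu hw huw).1 he
        · rintro (⟨rfl, rfl⟩ | ⟨rfl, rfl⟩)
          · exact ⟨⟨hx, hy, hxy⟩, rfl⟩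
          · exact ⟨⟨hy, hx, hxy.symm⟩, (h.cone_eq_iff hx hy hxy hy hx hxy.symm).2
              (Or.inr ⟨rfl, rfl⟩)⟩
      rw [this, Finset.card_pair]
      intro he
      exact hxy (Prod.mk.injEq _ _ _ _ ▸ he).1
    have hsum : ∑ p ∈ Q.offDiag, clusterVec (B p.1 ∪ B p.2) =
        (2 : ℝ) • ∑ σ ∈ Q.offDiag.image φ, v σ := by
      rw [Finset.sum_congr rfl (g := fun p => v (φ p)), Finset.sum_comp, Finset.smul_sum]
      · refine Finset.sum_congr rfl fun σ hσ => ?_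
        rw [hfib σ hσ, ← Nat.cast_smul_eq_nsmul ℝ]
        norm_num
      · intro p hp
        obtain ⟨hx, hy, hxy⟩ := Finset.mem_offDiag.1 hp
        obtain ⟨h1, h2⟩ := (h.facet_iff _).2 ⟨p.1, hx, p.2, hy, hxy, rfl⟩
        exact (hv _ h1 h2).symm
    have hmem : (2 : ℝ) • ∑ σ ∈ Q.offDiag.image φ, v σ ∈ linearSpan (clusterCone F) := by
      rw [← hsum, sum_offDiag_clusterVec h.disjoint]
      refine Submodule.add_mem _ (Submodule.smul_mem _ _ ?_)
        (Submodule.smul_mem _ _ (Submodule.sum_mem _ fun x hx => ?_))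
      · rcases Finset.mem_insert.1 h.biUnion_mem with he | hm
        · rw [he, clusterVec_univ]
          exact Submodule.zero_mem _
        · exact clusterVec_mem_linearSpan hm
      · rcases h.eq_singleton_or_mem x hx with he | hm
        · rw [he, clusterVec_singleton]
          exact Submodule.zero_mem _
        · exact clusterVec_mem_linearSpan hm
    rw [hset, finsum_mem_coe_finset]
    have hone : ∀ σ, (((psiClass n i).weight σ : ℚ) : ℝ) • v σ = v σ := by
      intro σ
      change ((1 : ℚ) : ℝ) • v σ = v σ
      rw [Rat.cast_one, one_smul]
    simp only [hone]
    have := Submodule.smul_mem _ (2⁻¹ : ℝ) hmem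
    rwa [inv_smul_smul₀ (two_ne_zero' ℝ)] at this

/-- Two facets that arise from joining a branch to two different branches have the same weight: the
difference of Gromov products that separates them vanishes on the cone of codimension one and on
the primitive normal vectors of the other facets. -/
theorem IsLocalModel.weight_eq (h : IsLocalModel F Q B) (hF : IsLaminar F) (hcard : F.card + 5 = n)
    {a : PointedCone ℝ (Ambient n) → ℚ}
    (ha : IsBalancedAt (lattice n) (n - 4) (psiClass n i).cones a (clusterCone F))
    {x y z : Others i} (hx : x ∈ Q) (hy : y ∈ Q) (hz : z ∈ Q) (hxy : x ≠ y) (hxz : x ≠ z) :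
    a (clusterCone (insert (B x ∪ B y) F)) = a (clusterCone (insert (B x ∪ B z) F)) := by
  classical
  by_cases hyz : y = z
  · rw [hyz]
  obtain ⟨v, hv, hsum⟩ := ha
  obtain ⟨g, hg⟩ := exists_gromovDiff hxy hxz
  have hg0 : ∀ t ∈ linearSpan (clusterCone F), g t = 0 := by
    intro t ht
    rw [clusterCone, linearSpan_hull] at ht
    induction ht using Submodule.span_induction with
    | mem t ht =>
      obtain ⟨K, hK, rfl⟩ := ht
      have hK' := Finset.mem_coe.1 hK
      have hiff : x ∈ K ∧ y ∈ K ↔ x ∈ K ∧ z ∈ K :=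
        ⟨fun hm => ⟨hm.1, h.isStar K hK' x hx y hy hxy hm.1 hm.2 hz⟩,
          fun hm => ⟨hm.1, h.isStar K hK' x hx z hz hxz hm.1 hm.2 hy⟩⟩
      rw [hg, if_congr hiff rfl rfl, sub_self]
    | zero => exact map_zero g
    | add s t _ _ hs ht => rw [map_add, hs, ht, add_zero]
    | smul c t _ ht => rw [map_smul, ht, smul_zero]
  have hgv : ∀ σ ∈ facetsAt (n - 4) (psiClass n i).cones (clusterCone F), g (v σ) =
      (if σ = clusterCone (insert (B x ∪ B y) F) then 1 else 0) -
        (if σ = clusterCone (insert (B x ∪ B z) F) then 1 else 0) := by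
    intro σ hσ
    have hσ' := hσ
    obtain ⟨u, hu, w, hw, huw, rfl⟩ := (h.mem_facetsAt hF hcard).1 hσ
    obtain ⟨h1, h2⟩ := (h.facet_iff _).2 ⟨u, hu, w, hw, huw, rfl⟩
    have hdim : dim (clusterCone F) < dim (clusterCone (insert (B u ∪ B w) F)) := by
      rw [hF.dim_clusterCone, h2.isLaminar.dim_clusterCone, Finset.card_insert_of_notMem h1]
      exact Nat.lt_succ_self _
    have hsub := (h2.isLaminar.isPrimitiveNormal h1).sub_mem (hv _ hσ')
      (h2.isLaminar.isFaceOf_clusterCone (Finset.subset_insert _ _)) h2.isLaminar.isRationalCone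
      hdim
    have h3 := hg0 _ hsub
    rw [map_sub, sub_eq_zero] at h3
    have key : ∀ t ∈ Q, x ≠ t → ((x ∈ B u ∪ B w ∧ t ∈ B u ∪ B w) ↔
        clusterCone (insert (B u ∪ B w) F) = clusterCone (insert (B x ∪ B t) F)) := by
      intro t ht hxt
      rw [h.mem_union_iff hx hu hw, h.mem_union_iff ht hu hw, h.cone_eq_iff hx ht hxt hu hw huw]
      constructor
      · rintro ⟨rfl | rfl, rfl | rfl⟩ <;> simp_all
      · rintro (⟨rfl, rfl⟩ | ⟨rfl, rfl⟩) <;> simp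
    rw [h3, hg, if_congr (key y hy hxy) rfl rfl, if_congr (key z hz hxz) rfl rfl]
  have hfin := facetsAt_finite (k := n - 4)
    (isRationalFan_psiClass (i := i) (by omega)).finite (clusterCone F)
  have h4 := hg0 _ hsum
  rw [finsum_mem_eq_finite_toFinset_sum _ hfin, map_sum] at h4
  rw [Finset.sum_congr rfl (g := fun σ =>
      (if σ = clusterCone (insert (B x ∪ B y) F) then ((a σ : ℚ) : ℝ) else 0) -
        (if σ = clusterCone (insert (B x ∪ B z) F) then ((a σ : ℚ) : ℝ) else 0))
      (fun σ hσ => by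
        rw [map_smul, hgv σ (hfin.mem_toFinset.1 hσ), smul_eq_mul]
        split_ifs <;> ring),
    Finset.sum_sub_distrib, Finset.sum_ite_eq', Finset.sum_ite_eq',
    if_pos (hfin.mem_toFinset.2 ((h.mem_facetsAt hF hcard).2 ⟨x, hx, y, hy, hxy, rfl⟩)),
    if_pos (hfin.mem_toFinset.2 ((h.mem_facetsAt hF hcard).2 ⟨x, hx, z, hz, hxz, rfl⟩)),
    sub_eq_zero] at h4
  exact_mod_cast h4

theorem isLocallyIrreducible_psiClass (hn : 4 ≤ n) :
    IsLocallyIrreducible (lattice n) (n - 4) (psiClass n i) := by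
  have hα := card_others i
  intro τ hτ hd a ha
  obtain ⟨F, hF, hr, rfl⟩ := (mem_psiClass (by omega)).1 hτ
  rw [hF.dim_clusterCone] at hd
  have hcard : F.card + 5 = n := by omega
  obtain ⟨Q, B, h⟩ := hF.exists_isLocalModel hr (by omega)
  obtain ⟨u, hu, w, hw, huw⟩ := Finset.one_lt_card.1
    (lt_of_lt_of_le (by norm_num) h.three_le_card : 1 < Q.card)
  refine ⟨a (clusterCone (insert (B u ∪ B w) F)), fun σ hσ => ?_⟩
  obtain ⟨x, hx, y, hy, hxy, rfl⟩ := (h.mem_facetsAt hF hcard).1 hσ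
  change _ = _ * (1 : ℚ)
  rw [mul_one]
  by_cases hxw : x = w
  -- Exchange the elements of the pair `x`, `y` for those of the pair `u`, `w` one at a time.
  · subst hxw
    rw [h.weight_eq hF hcard ha hx hy hu hxy huw.symm, Finset.union_comm]
  · rw [h.weight_eq hF hcard ha hx hy hw hxy hxw, Finset.union_comm,
      h.weight_eq hF hcard ha hw hx hu (Ne.symm hxw) huw.symm, Finset.union_comm]

theorem isTropicalCycle_psiClass (hn : 4 ≤ n) :
    IsTropicalCycle (lattice n) (n - 4) (psiClass n i) := by
  refine ⟨isRationalFan_psiClass (by omega), isPureOfDim_psiClass (by omega),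
    fun _ _ _ => one_ne_zero, fun τ hτ hd => ?_⟩
  obtain ⟨F, hF, hr, rfl⟩ := (mem_psiClass (by omega)).1 hτ
  rw [hF.dim_clusterCone] at hd
  exact isBalancedAt_psiClass hF hr (by omega)

end PsiClass

end TropicalModuli

end

theorem mainTheorem2 (n : ℕ) (hn : 4 ≤ n) (i : Fin n) :
    -- the moduli space is purely of dimension `n - 3`, and `ψ_i` consists of cones of it
    TropicalModuli.IsPureOfDim (n - 3) (TropicalModuli.moduliCones n) ∧
    (TropicalModuli.psiClass n i).cones ⊆ TropicalModuli.moduliCones n ∧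
    -- `ψ_i` is a tropical cycle of dimension `n - 4`
    TropicalModuli.IsTropicalCycle (TropicalModuli.lattice n) (n - 4)
      (TropicalModuli.psiClass n i) ∧
    -- `ψ_i` is connected in codimension one and locally irreducible
    TropicalModuli.IsConnectedInCodimOne (n - 4) (TropicalModuli.psiClass n i).cones ∧
    TropicalModuli.IsLocallyIrreducible (TropicalModuli.lattice n) (n - 4)
      (TropicalModuli.psiClass n i) ∧
    -- `ψ_i` is (globally) irreducible
    TropicalModuli.IsIrreducibleCycle (TropicalModuli.lattice n) (n - 4)
      (TropicalModuli.psiClass n i) :=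
  ⟨TropicalModuli.isPureOfDim_moduliCones i (by omega), fun _ ⟨T, _, hT⟩ => ⟨T, hT⟩,
    TropicalModuli.isTropicalCycle_psiClass hn, TropicalModuli.isConnectedInCodimOne_psiClass hn,
    TropicalModuli.isLocallyIrreducible_psiClass hn,
    TropicalModuli.isIrreducibleCycle_of_isLocallyIrreducible
      (TropicalModuli.isTropicalCycle_psiClass hn) (TropicalModuli.nonempty_psiClass hn)
      (TropicalModuli.isConnectedInCodimOne_psiClass hn)
      (TropicalModuli.isLocallyIrreducible_psiClass hn)⟩
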